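/- **Setting.** Let $S$ be a smooth manifold diffeomorphic to $\mathbb R^3$, $C^\infty=C^\infty(\mathbb R\times S,\mathbb R)$, $t:\mathbb R\times S\to\mathbb R$ the first projection, $D_0=\partial/\partial t$. Let $W$ be the free $C^\infty$-module with conformally orthonormal basis $\theta_0,\theta_1,\theta_2,\theta_3$ of signature $-+++$. Let $\mathrm{CDer}(W)$ be the Lie algebra of $\mathbb R$-linear maps $\delta:W\to W$ with $\delta(fw)=X(f)w+f\delta(w)$ for some $X\in\mathrm{Der}(C^\infty)$, that preserve the conformal inner product. Derivations of $C^\infty$ are elements of $\mathrm{CDer}(W)$ by annihilating the $\theta_\mu$; further $\sigma_0=\mathrm{id}_W$, $\sigma_i$ ($i=1,2,3$) is the $C^\infty$-linear map $\theta_0\mapsto\theta_i$, $\theta_i\mapsto\theta_0$ (zero on the other two), and $\sigma_{ij}=[\sigma_i,\sigma_j]$. Let $\mathcal L=\wedge W\otimes_{C^\infty}\mathrm{CDer}(W)$ with $$[\omega\delta,\omega'\delta']=\omega\,\delta(\omega')\delta'-(-1)^{|\omega||\omega'|}\omega'\delta'(\omega)\delta+\omega\omega'[\delta,\delta'],$$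 let $\mathcal I\subset\mathcal L$ be the $\wedge W$-submodule generated by the Weyl tensors in $\mathcal L^2$ (elements of $\wedge^2W\otimes\mathfrak{so}(W)$ that satisfy the first Bianchi identity and are trace-free), and $\mathcal E=\mathcal L/\mathcal I$. One has $\mathcal E^1=\mathcal L^1$. For a decomposition $W=W_0\oplus W_1$ into the spans of two pairs of basis elements, with $\theta_0\in W_0$, let $F_{\lhd q}(\wedge W)$ be the span of the monomials in the $\theta_\mu$ whose degree in $W_1$ is $\le q$ and $\equiv q$ mod $2$; similarly on $\wedge W\otimes\wedge^4W$. Let $F_{\lhd p}\mathcal E$ be the set of elements of parity $p$ (for the $\mathbb Z_2$-grading of $\mathcal E$ induced by $W_0\oplus W_1$) that map $F_{\lhd q}$ to $F_{\lhd q+p}$ for all $q\ge0$, both on $\wedge W$ and on $\wedge W\otimes\wedge^4W$, and let $F_p\mathcal E=F_{\lhd p}\mathcal E\oplus F_{\lhd p-1}\mathcal E$. For the decompositions with $W_1$ spanned by $\{\theta_2,\theta_3\}$, $\{\theta_3,\theta_1\}$, $\{\theta_1,\theta_2\}$ call these filtrations $F,F',F''$, and let $F_{p_1p_2p_3}\mathcal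 E=F_{p_1}\mathcal E\cap F'_{p_2}\mathcal E\cap F''_{p_3}\mathcal E$. Let $\mathcal P=\{\sum_\alpha s^\alpha x_\alpha\mid x_\alpha\in F_\alpha\mathcal E\}\subset\mathcal E[[s_1,s_2,s_3]]$, $\mathcal A_{\rm free}=\mathcal P/(s_1,s_2,s_3)\mathcal P$, and $\mathrm{MC}(\mathcal A_{\rm free})=\{x\in\mathcal A_{\rm free}^1\mid[x,x]=0\}$. **Affine gauge subspace.** Below $(i,j,k)$ is always a cyclic permutation of $(1,2,3)$. The affine gauge subspace is $\theta_0D_0+\mathcal A^1_{{\rm free},G}$, where $\mathcal A^1_{{\rm free},G}$ consists of the classes of the $C^\infty$-linear combinations of: $\theta_0\sigma_0+\theta_i\sigma_i$; $\;s_i^2(-\theta_i\sigma_{jk}+\theta_j\sigma_{ki}+\theta_k\sigma_{ij})$; $\;s_js_k$ times any of $\theta_iX$ ($X\in\mathrm{Der}(C^\infty)$), $\theta_0\sigma_i+\theta_i\sigma_0$, $\theta_j\sigma_k+\theta_k\sigma_j$, $\theta_k\sigma_{ki}$, $\theta_j\sigma_{ij}$; $\;s_i^2s_js_k(\theta_j\sigma_k-\theta_k\sigma_j)$.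 It is parametrized by $\mu_i,\gamma_i^a\in C^\infty$ ($a=0,\dots,6$) and $\beta_i\in\mathrm{Der}(C^\infty)$: with $\bar s_i=s_ie^{\mu_i}$, $$\begin{aligned}\theta_0D_0+\sum_{(i,j,k)\text{ cyclic}}\Big(&-\gamma_i^0(\theta_i\sigma_i+\theta_0\sigma_0)-\bar s_i^2\gamma_i^1(\theta_i\sigma_{jk}-\theta_j\sigma_{ki}-\theta_k\sigma_{ij})+\bar s_j\bar s_k\theta_i\beta_i\\&-\bar s_j\bar s_k(\gamma_i^2+\beta_i(\mu_1+\mu_2+\mu_3))(\theta_0\sigma_i+\theta_i\sigma_0)-\bar s_j\bar s_k(\gamma_i^3-\beta_i(\mu_k))\theta_k\sigma_{ki}\\&-\bar s_j\bar s_k(\gamma_i^4+\beta_i(\mu_j))\theta_j\sigma_{ij}-\bar s_j\bar s_k\gamma_i^5(\theta_k\sigma_j+\theta_j\sigma_k)+\bar s_j\bar s_k\bar s_i^2\gamma_i^6(\theta_j\sigma_k-\theta_k\sigma_j)\Big).\end{aligned}$$ **The set $\mathrm{MC}_{\rm pre}$.** It is the set of tuples $(g_1^0,g_2^0,g_3^0,D_1,D_2,D_3,\xi)$,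 where $g_i^0,\xi\in C^\infty(S,\mathbb R)$ and $D_1,D_2,D_3$ is a frame of smooth vector fields on $S$, with structure functions $c_{jk}^i$ given by $[D_j,D_k]=\sum_{i=1}^3c_{jk}^iD_i$, such that $$0=g_2^0g_3^0+g_3^0g_1^0+g_1^0g_2^0,\qquad 0=D_i(g_j^0+g_k^0)+c_{ij}^j(g_i^0-g_j^0)+c_{ik}^k(g_i^0-g_k^0)-2D_i(\xi)g_i^0$$ for all cyclic $(i,j,k)$. To such a tuple one associates $$g_i^1=-\tfrac12c_{jk}^i,\qquad g_i^2=D_i(\xi),\qquad g_i^3=-c_{ki}^k-g_i^2,\qquad g_i^4=-c_{ij}^j+g_i^2 .$$ **Lemma.** Let $D_1,D_2,D_3$ be a frame of smooth vector fields on $S$, extended to $\mathbb R\times S$ by $D_i(t)=0$, and let $\gamma_i^0,\dots,\gamma_i^4\in C^\infty(\mathbb R\times S,\mathbb R)$, $i=1,2,3$. The element with parameters $\mu_i=t\gamma_i^0$, $\beta_i=D_i$, $\gamma_i^0,\dots,\gamma_i^4$ and $\gamma_i^5=\gamma_i^6=0$ lies in $$\mathrm{MC}(\mathcal A_{\rm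 free})\cap(\theta_0D_0+\mathcal A^1_{{\rm free},G})$$ if and only if there are $g_1^0,g_2^0,g_3^0,\xi\in C^\infty(S,\mathbb R)$ such that $(g_1^0,g_2^0,g_3^0,D_1,D_2,D_3,\xi)\in\mathrm{MC}_{\rm pre}$ and $\gamma_i^a=g_i^a$ (as functions that do not depend on $t$) for $i=1,2,3$, $a=0,\dots,4$. Consequently, the set of elements of $\mathrm{MC}(\mathcal A_{\rm free})\cap(\theta_0D_0+\mathcal A^1_{{\rm free},G})$ that admit parameters with $\mu_i=t\gamma_i^0$, $\beta_i=D_i$ for a frame $D_i$ on $S$, and $\gamma_i^5=\gamma_i^6=0$, is equal to the set of the elements so obtained from all tuples in $\mathrm{MC}_{\rm pre}$ over $S$ via $\gamma_i^a=g_i^a$. -/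

import Mathlib

open scoped Manifold ContDiff

set_option linter.unusedSectionVars false

noncomputable section

namespace BKL

/-! ## The graded Lie algebra `E` over a commutative real algebra `A`

`A` stands for the smooth functions on the base, and `W` is the free `A`-module with conformally
orthonormal basis `θ_0, θ_1, θ_2, θ_3` of signature `-+++`. -/

section Algebra

variable (A : Type*) [CommRing A] [Algebra ℝ A]

/-- The exterior algebra `∧W`, by its coefficients on the monomials
`θ_J = θ_{j_1} ∧ ⋯ ∧ θ_{j_r}`, `J = {j_1 < ⋯ < j_r} ⊆ {0,1,2,3}`. -/
abbrev ExtW : Type _ := Finset (Fin 4) → A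

/-- The sign (or zero) with `θ_J ∧ θ_K = sgn J K • θ_{J ∪ K}`. -/
def sgn (J K : Finset (Fin 4)) : ℤ :=
  if Disjoint J K then (-1) ^ ((J ×ˢ K).filter fun p => p.2 < p.1).card else 0

/-- The Minkowski matrix in the basis `θ`. -/
def eta : Matrix (Fin 4) (Fin 4) A := Matrix.diagonal ![-1, 1, 1, 1]

/-- `CDerEnd(W)`: the pair `(X, m)` is the `ℝ`-linear endomorphism
`f θ_j ↦ X(f) θ_j + f ∑ i, m i j θ_i` of `W`, a first-order operator over the derivation `X`; it is
required to preserve the conformal inner product infinitesimally. The pairs `(X, 0)` are the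
basis-dependent copy of `Der(A)`. -/
def confDer : Submodule A (Derivation ℝ A A × Matrix (Fin 4) (Fin 4) A) where
  carrier := {δ | ∃ f : A, δ.2.transpose * eta A + eta A * δ.2 = f • eta A}
  zero_mem' := ⟨0, by simp⟩
  add_mem' := by
    rintro δ ε ⟨f, hf⟩ ⟨g, hg⟩
    refine ⟨f + g, ?_⟩
    rw [Prod.snd_add, Matrix.transpose_add, add_mul, mul_add, add_smul, ← hf, ← hg]
    abel
  smul_mem' := by
    rintro a δ ⟨f, hf⟩
    refine ⟨a * f, ?_⟩
    rw [Prod.smul_snd, Matrix.transpose_smul, Matrix.smul_mul, Matrix.mul_smul, ← smul_add, hf,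
      smul_smul]

/-- `CDerEnd(W)` as a type. -/
abbrev CDer : Type _ := confDer A

variable {A}

/-- The derivation of `A` underlying an element of `CDerEnd(W)`. -/
def CDer.der (δ : CDer A) : Derivation ℝ A A := δ.1.1

/-- The matrix of an element of `CDerEnd(W)`. -/
def CDer.mat (δ : CDer A) : Matrix (Fin 4) (Fin 4) A := δ.1.2

theorem eta_map (X : Derivation ℝ A A) : (eta A).map X = 0 := by
  ext i j
  fin_cases i <;> fin_cases j <;> simp [eta, Matrix.diagonal]

theorem map_mul_eta (X : Derivation ℝ A A) (m : Matrix (Fin 4) (Fin 4) A) :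
    (m * eta A).map X = m.map X * eta A := by
  ext i j
  fin_cases j <;> simp [eta, Matrix.mul_diagonal]

theorem map_eta_mul (X : Derivation ℝ A A) (m : Matrix (Fin 4) (Fin 4) A) :
    (eta A * m).map X = eta A * m.map X := by
  ext i j
  fin_cases i <;> simp [eta, Matrix.diagonal_mul]

theorem map_conformal (X : Derivation ℝ A A) {m : Matrix (Fin 4) (Fin 4) A} {f : A}
    (h : m.transpose * eta A + eta A * m = f • eta A) :
    (m.map X).transpose * eta A + eta A * m.map X = X f • eta A := by
  have h1 : (m.transpose * eta A + eta A * m).map X = (f • eta A).map X := by rw [h]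
  have h2 : (m.transpose * eta A + eta A * m).map X
      = (m.transpose * eta A).map X + (eta A * m).map X := by
    ext i j; simp
  have h3 : (f • eta A).map X = X f • eta A := by
    ext i j
    have := congrFun (congrFun (eta_map X) i) j
    simp only [Matrix.map_apply, Matrix.zero_apply] at this
    simp [this, mul_comm]
  rw [h2, map_mul_eta, map_eta_mul, h3] at h1
  exact h1

theorem commutator_conformal {m n : Matrix (Fin 4) (Fin 4) A} {f g : A}
    (hm : m.transpose * eta A + eta A * m = f • eta A)
    (hn : n.transpose * eta A + eta A * n = g • eta A) :
    (m * n - n * m).transpose * eta A + eta A * (m * n - n * m) = 0 := by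
  have hm' : m.transpose * eta A = f • eta A - eta A * m := eq_sub_of_add_eq hm
  have hn' : n.transpose * eta A = g • eta A - eta A * n := eq_sub_of_add_eq hn
  rw [Matrix.transpose_sub, Matrix.transpose_mul, Matrix.transpose_mul, sub_mul, mul_assoc,
    mul_assoc, hm', hn', mul_sub, mul_sub, Matrix.mul_smul, Matrix.mul_smul, ← mul_assoc,
    ← mul_assoc, hm', hn', sub_mul, sub_mul, Matrix.smul_mul, Matrix.smul_mul, smul_sub, smul_sub,
    smul_smul, smul_smul, mul_comm f g, mul_sub, mul_assoc, mul_assoc]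
  abel

/-- The Lie bracket of `CDerEnd(W)`, the commutator of operators on `W`. -/
def CDer.bracket (δ ε : CDer A) : CDer A :=
  ⟨(⁅δ.der, ε.der⁆,
    ε.mat.map δ.der - δ.mat.map ε.der + (δ.mat * ε.mat - ε.mat * δ.mat)), by
    obtain ⟨f, hf⟩ := δ.2
    obtain ⟨g, hg⟩ := ε.2
    refine ⟨δ.der g - ε.der f, ?_⟩
    have h1 := map_conformal δ.der hg
    have h2 := map_conformal ε.der hf
    have h3 := commutator_conformal hf hg
    simp only [CDer.mat, Matrix.transpose_add, Matrix.transpose_sub, add_mul, sub_mul, mul_add,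
      mul_sub, sub_smul] at h1 h2 h3 ⊢
    rw [← h1, ← h2]
    refine Eq.trans ?_ (add_zero _)
    rw [← h3]
    abel⟩

/-- The wedge product of `∧W`. -/
def wedge (u ν : ExtW A) : ExtW A :=
  ∑ J, ∑ K, Pi.single (J ∪ K) (sgn J K • (u J * ν K))

/-- The monomial `θ_J`. -/
def theta (J : Finset (Fin 4)) : ExtW A := Pi.single J 1

/-- The action of `δ ∈ CDerEnd(W)` on `∧W` as a derivation: the factor `θ_j` of a monomial
`θ_J = sgn {j} (J \ {j}) • θ_j ∧ θ_{J \ {j}}` is replaced by `∑ i, m i j θ_i`. -/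
def CDer.act (δ : CDer A) (u : ExtW A) : ExtW A :=
  ∑ J, (Pi.single J (δ.der (u J)) +
    u J • ∑ j ∈ J, ∑ i, δ.mat i j • (sgn {j} (J.erase j) • wedge (theta {i}) (theta (J.erase j))))

variable (A) in
/-- `L = ∧W ⊗ CDerEnd(W)`: the element `∑ J, θ_J ⊗ x J`. -/
abbrev L : Type _ := Finset (Fin 4) → CDer A

/-- The elements of degree `n` of `L`, namely `∧^n W ⊗ CDerEnd(W)`. -/
def IsDeg (n : ℕ) (x : L A) : Prop := ∀ J : Finset (Fin 4), J.card ≠ n → x J = 0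

/-- `ω ⊗ δ` as an element of `L`. -/
def tens (u : ExtW A) (δ : CDer A) : L A := fun J => u J • δ

/-- `θ_J ∧ x` for `x ∈ L`. -/
def thetaMul (J : Finset (Fin 4)) (x : L A) : L A :=
  ∑ K, Pi.single (J ∪ K) (sgn J K • x K)

/-- The graded Lie bracket of `L`, determined by
`[ωδ, ω'δ'] = ω δ(ω') δ' - (-1)^{|ω||ω'|} ω' δ'(ω) δ + ω ω' [δ, δ']`. -/
def bracket (x y : L A) : L A :=
  ∑ J, ∑ K,
    (tens (wedge (theta J) ((x J).act (theta K))) (y K)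
      - (-1 : ℤ) ^ (J.card * K.card) • tens (wedge (theta K) ((y K).act (theta J))) (x J)
      + tens (wedge (theta J) (theta K)) ((x J).bracket (y K)))

/-- The representation of `L` on `∧W`: `ωδ` acts as `ν ↦ ω ∧ δ(ν)`. -/
def rep (x : L A) (ν : ExtW A) : ExtW A :=
  ∑ J, wedge (theta J) ((x J).act ν)

/-- The representation of `L` on `∧W ⊗ Ω`, `Ω = ∧⁴W`: `ωδ` acts as
`ν z ↦ ω δ(ν) z + ω ν δ(z)`. Here `ν` stands for `ν z` with `z = θ_0θ_1θ_2θ_3`, and `δ(z)` is the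
trace of the matrix of `δ` times `z`. -/
def repOmega (x : L A) (ν : ExtW A) : ExtW A :=
  ∑ J, wedge (theta J) ((x J).act ν + (x J).mat.trace • ν)

/-- Weyl tensors in `∧²W ⊗ so(W) ⊆ L²`: algebraic curvature tensors (the first Bianchi identity is
the vanishing of the action on `W ⊆ ∧W`) that are trace-free. -/
structure IsWeyl (w : L A) : Prop where
  deg : IsDeg 2 w
  der : ∀ J, (w J).der = 0
  so : ∀ J, (w J).mat.trace = 0
  bianchi : ∀ j : Fin 4, rep w (theta {j}) = 0
  ricci : ∀ b i : Fin 4, ∑ a : Fin 4, sgn {a} {b} • (w {a, b}).mat i a = 0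

variable (A) in
/-- The ideal `I ⊆ L`: the `∧W`-submodule generated by the Weyl tensors. -/
def weylIdeal : Submodule A (L A) :=
  Submodule.span A {y | ∃ (J : Finset (Fin 4)) (w : L A), IsWeyl w ∧ y = thetaMul J w}

variable (A) in
/-- `E = L / I`, whose Maurer-Cartan equation is the vacuum Einstein equations. In degree one
`E¹ = L¹`. -/
abbrev E : Type _ := L A ⧸ weylIdeal A

/-! ### The Belinskii-Khalatnikov-Lifshitz filtrations -/

theorem wedge_add (u ν ν' : ExtW A) : wedge u (ν + ν') = wedge u ν + wedge u ν' := by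
  simp only [wedge, Pi.add_apply, mul_add, smul_add, Pi.single_add, Finset.sum_add_distrib]

theorem wedge_smul (a : A) (u ν : ExtW A) : wedge u (a • ν) = a • wedge u ν := by
  simp only [wedge, Finset.smul_sum, ← Pi.single_smul]
  refine Finset.sum_congr rfl fun J _ => Finset.sum_congr rfl fun K _ => ?_
  congr 1
  rw [Pi.smul_apply, smul_eq_mul, smul_comm a, smul_eq_mul, mul_left_comm]

theorem act_add (δ ε : CDer A) (u : ExtW A) : (δ + ε).act u = δ.act u + ε.act u := by
  have h1 : (δ + ε).der = δ.der + ε.der := rfl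
  have h2 : (δ + ε).mat = δ.mat + ε.mat := rfl
  simp only [CDer.act, h1, h2, Derivation.add_apply, Matrix.add_apply, add_smul, Pi.single_add,
    Finset.sum_add_distrib, smul_add]
  abel

theorem act_smul (a : A) (δ : CDer A) (u : ExtW A) : (a • δ).act u = a • δ.act u := by
  have h1 : (a • δ).der = a • δ.der := rfl
  have h2 : (a • δ).mat = a • δ.mat := rfl
  simp only [CDer.act, h1, h2, Derivation.smul_apply, Matrix.smul_apply, Finset.smul_sum, smul_add,
    ← Pi.single_smul, smul_smul, smul_eq_mul]
  refine Finset.sum_congr rfl fun J _ => congrArg _ ?_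
  refine Finset.sum_congr rfl fun j _ => Finset.sum_congr rfl fun i _ => ?_
  rw [mul_left_comm]

theorem rep_add (x y : L A) (ν : ExtW A) : rep (x + y) ν = rep x ν + rep y ν := by
  simp only [rep, Pi.add_apply, act_add, wedge_add, Finset.sum_add_distrib]

theorem rep_smul (a : A) (x : L A) (ν : ExtW A) : rep (a • x) ν = a • rep x ν := by
  simp only [rep, Pi.smul_apply, act_smul, wedge_smul, Finset.smul_sum]

theorem repOmega_add (x y : L A) (ν : ExtW A) :
    repOmega (x + y) ν = repOmega x ν + repOmega y ν := by
  have h (δ ε : CDer A) : (δ + ε).mat.trace = δ.mat.trace + ε.mat.trace := Matrix.trace_add _ _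
  rw [repOmega, repOmega, repOmega, ← Finset.sum_add_distrib]
  refine Finset.sum_congr rfl fun J _ => ?_
  rw [Pi.add_apply, act_add, h, add_smul, ← wedge_add, add_add_add_comm]

theorem repOmega_smul (a : A) (x : L A) (ν : ExtW A) :
    repOmega (a • x) ν = a • repOmega x ν := by
  have h (δ : CDer A) : (a • δ).mat.trace = a • δ.mat.trace := Matrix.trace_smul _ _
  rw [repOmega, repOmega, Finset.smul_sum]
  refine Finset.sum_congr rfl fun J _ => ?_
  rw [Pi.smul_apply, act_smul, h, smul_assoc, ← smul_add, wedge_smul]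

/-- For a decomposition `W = W_0 ⊕ W_1`, where `W_1` is spanned by the `θ_j` with `j ∈ T`: the
piece `F_{◁q}(∧W)`, spanned by the monomials whose degree in `W_1` is at most `q` and has the parity
of `q`. -/
def FExt (T : Finset (Fin 4)) (q : ℕ) : Submodule A (ExtW A) where
  carrier := {u | ∀ J, ¬ ((J ∩ T).card ≤ q ∧ (J ∩ T).card % 2 = q % 2) → u J = 0}
  zero_mem' := fun _ _ => rfl
  add_mem' := fun {u ν} h h' J hJ => by rw [Pi.add_apply, h J hJ, h' J hJ, add_zero]
  smul_mem' := fun a u h J hJ => by rw [Pi.smul_apply, h J hJ, smul_zero]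

/-- The elements of `CDerEnd(W)` that preserve `W_0` and `W_1`. -/
def evenCDer (T : Finset (Fin 4)) : Submodule A (CDer A) where
  carrier := {δ | ∀ i j, ¬ (i ∈ T ↔ j ∈ T) → δ.mat i j = 0}
  zero_mem' := fun _ _ _ => rfl
  add_mem' := fun {δ ε} h h' i j hij => by
    change δ.mat i j + ε.mat i j = 0
    rw [h i j hij, h' i j hij, add_zero]
  smul_mem' := fun a δ h i j hij => by
    change a * δ.mat i j = 0
    rw [h i j hij, mul_zero]

/-- The elements of `CDerEnd(W)` that exchange `W_0` and `W_1`. -/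
def oddCDer (T : Finset (Fin 4)) : Submodule A (CDer A) where
  carrier := {δ | δ.der = 0 ∧ ∀ i j, (i ∈ T ↔ j ∈ T) → δ.mat i j = 0}
  zero_mem' := ⟨rfl, fun _ _ _ => rfl⟩
  add_mem' := fun {δ ε} h h' => by
    refine ⟨?_, fun i j hij => ?_⟩
    · change δ.der + ε.der = 0
      rw [h.1, h'.1, add_zero]
    · change δ.mat i j + ε.mat i j = 0
      rw [h.2 i j hij, h'.2 i j hij, add_zero]
  smul_mem' := fun a δ h => by
    refine ⟨?_, fun i j hij => ?_⟩
    · change a • δ.der = 0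
      rw [h.1, smul_zero]
    · change a * δ.mat i j = 0
      rw [h.2 i j hij, mul_zero]

/-- The part of `L` of parity `p`, for the `ℤ/2`-grading induced by `W = W_0 ⊕ W_1`. -/
def parityL (T : Finset (Fin 4)) (p : ℕ) : Submodule A (L A) :=
  Submodule.pi Set.univ fun J =>
    if (J ∩ T).card % 2 = p % 2 then evenCDer T else oddCDer T

/-- `F_{◁p}L`: the elements of parity `p` that map `F_{◁q}` to `F_{◁(q+p)}` for all `q`, in both
representations `∧W` and `∧W ⊗ Ω`. -/
def FTriL (T : Finset (Fin 4)) (p : ℕ) : Submodule A (L A) where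
  carrier := {x | x ∈ parityL T p ∧ ∀ q, ∀ ν ∈ FExt (A := A) T q,
    rep x ν ∈ FExt (A := A) T (q + p) ∧ repOmega x ν ∈ FExt (A := A) T (q + p)}
  zero_mem' := by
    refine ⟨Submodule.zero_mem _, fun q ν _ => ?_⟩
    have h1 : rep (0 : L A) ν = 0 := by simpa using rep_smul (0 : A) 0 ν
    have h2 : repOmega (0 : L A) ν = 0 := by simpa using repOmega_smul (0 : A) 0 ν
    rw [h1, h2]
    exact ⟨Submodule.zero_mem _, Submodule.zero_mem _⟩
  add_mem' := fun {x y} hx hy => by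
    refine ⟨Submodule.add_mem _ hx.1 hy.1, fun q ν hν => ?_⟩
    rw [rep_add, repOmega_add]
    exact ⟨Submodule.add_mem _ (hx.2 q ν hν).1 (hy.2 q ν hν).1,
      Submodule.add_mem _ (hx.2 q ν hν).2 (hy.2 q ν hν).2⟩
  smul_mem' := fun a x hx => by
    refine ⟨Submodule.smul_mem _ a hx.1, fun q ν hν => ?_⟩
    rw [rep_smul, repOmega_smul]
    exact ⟨Submodule.smul_mem _ a (hx.2 q ν hν).1, Submodule.smul_mem _ a (hx.2 q ν hν).2⟩

/-- `F_{◁p}E`. Both representations vanish on `I`, so this is the image of `F_{◁p}L`. -/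
def FTriE (T : Finset (Fin 4)) (p : ℕ) : Submodule A (E A) :=
  (FTriL T p).map (weylIdeal A).mkQ

/-- The 1-index filtration `F_p E = F_{◁p}E ⊕ F_{◁(p-1)}E`, with `F_{◁(-1)}E = 0`. -/
def F1 (T : Finset (Fin 4)) : ℕ → Submodule A (E A)
  | 0 => FTriE T 0
  | p + 1 => FTriE T (p + 1) ⊔ FTriE T p

/-- The indices spanning `W_1` in the three decompositions of `W`. -/
def W1 : Fin 3 → Finset (Fin 4) := ![{2, 3}, {3, 1}, {1, 2}]

/-- The 3-index filtration `F_{p_1p_2p_3}E = F_{p_1}E ∩ F'_{p_2}E ∩ F''_{p_3}E`. -/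
def F3 (α : Fin 3 → ℕ) : Submodule A (E A) := ⨅ i, F1 (W1 i) (α i)

/-! ### The Rees algebra and its associated graded -/

/-- Formal power series `∑ s^α x_α` in `s_1, s_2, s_3`, by their coefficients. -/
abbrev Ser (V : Type*) : Type _ := (Fin 3 → ℕ) → V

variable (A) in
/-- The Rees algebra `P_free` of the 3-index filtration. -/
def PFree : Submodule A (Ser (E A)) := Submodule.pi Set.univ F3

variable (A) in
/-- Multiplication by the symbol `s_i`. -/
def sMul (i : Fin 3) : Ser (E A) →ₗ[A] Ser (E A) where
  toFun x := fun α => if α i = 0 then 0 else x (α - Pi.single i 1)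
  map_add' x y := by
    ext α
    by_cases h : α i = 0 <;> simp [h]
  map_smul' a x := by
    ext α
    by_cases h : α i = 0 <;> simp [h]

variable (A) in
/-- The ideal `(s_1, s_2, s_3) = s_1 P_free + s_2 P_free + s_3 P_free` of `P_free`. The associated
graded is `A_free = P_free / (s_1, s_2, s_3)`. -/
def sIdeal : Submodule A (Ser (E A)) := ⨆ i, (PFree A).map (sMul A i)

/-- The image in `E[[s_1,s_2,s_3]]` of a series with coefficients in `L`. -/
def toE (x : Ser (L A)) : Ser (E A) := fun α => (weylIdeal A).mkQ (x α)

/-- The bracket of power series. -/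
def serBracket (x y : Ser (L A)) : Ser (L A) :=
  fun α => ∑ κ ∈ Finset.Iic α, bracket (x κ) (y (α - κ))

variable (A) in
/-- `MC(A_free)`, through representatives in `P_free¹` (recall `E¹ = L¹`): the class of `x` in
`A_free = P_free / (s_1,s_2,s_3)` is a Maurer-Cartan element, that is, `x` is an element of `P_free`
of degree one, and the class of `[x,x]` in `A_free` is zero. -/
def MCFree : Set (Ser (L A)) :=
  {x | (∀ α, IsDeg 1 (x α)) ∧ toE x ∈ PFree A ∧ toE (serBracket x x) ∈ sIdeal A}

/-! ### The affine gauge subspace -/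

/-- An element of `Der(A)`, as the operator on `W` that annihilates the basis `θ`. -/
def ofDer (X : Derivation ℝ A A) : CDer A := ⟨(X, 0), 0, by simp⟩

/-- `σ_0`, the identity of `W`. -/
def sigma0 : CDer A := ⟨(0, 1), 2, by simp [two_smul]⟩

/-- `σ_{i+1}`, the boost `θ_0 ↦ θ_{i+1}`, `θ_{i+1} ↦ θ_0`. -/
def boost (i : Fin 3) : CDer A :=
  ⟨(0, Matrix.single i.succ 0 1 + Matrix.single 0 i.succ 1), 0, by
    ext a b
    fin_cases i <;> fin_cases a <;> fin_cases b <;>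
      simp [eta, Matrix.mul_diagonal, Matrix.diagonal_mul]⟩

/-- With the spatial indices `1, 2, 3` written as `0, 1, 2 : Fin 3` and `(i, j, k)` cyclic, the
rotation `σ_{jk} = [σ_j, σ_k]`: `θ_k ↦ θ_j`, `θ_j ↦ -θ_k`. -/
def rot (i : Fin 3) : CDer A :=
  ⟨(0, Matrix.single (i + 1).succ (i + 2).succ 1 - Matrix.single (i + 2).succ (i + 1).succ 1), 0, by
    ext a b
    fin_cases i <;> fin_cases a <;> fin_cases b <;>
      simp [eta, Matrix.mul_diagonal, Matrix.diagonal_mul]⟩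

/-- `θ_0 δ ∈ L¹`. -/
def th0 (δ : CDer A) : L A := tens (theta {0}) δ

/-- `θ_{i+1} δ ∈ L¹`. -/
def th (i : Fin 3) (δ : CDer A) : L A := tens (theta {i.succ}) δ

/-- The exponent of `s_i²`. -/
def expSq (i : Fin 3) : Fin 3 → ℕ := Pi.single i 2

/-- The exponent of `s_j s_k`, with `(i, j, k)` cyclic. -/
def expCross (i : Fin 3) : Fin 3 → ℕ := Pi.single (i + 1) 1 + Pi.single (i + 2) 1

/-- `G_α E_G¹`, the degree one part of the gauge subspace, with `(i, j, k) = (i, i+1, i+2)`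
cyclic. -/
def gaugePart (α : Fin 3 → ℕ) : Submodule A (L A) :=
  Submodule.span A
    ({y | α = 0 ∧ ∃ i, y = th0 sigma0 + th i (boost i)} ∪
     {y | ∃ i, α = expSq i ∧
        y = -th i (rot i) + th (i + 1) (rot (i + 1)) + th (i + 2) (rot (i + 2))} ∪
     {y | ∃ i, α = expCross i ∧ ((∃ X : Derivation ℝ A A, y = th i (ofDer X)) ∨
        y = th0 (boost i) + th i sigma0 ∨
        y = th (i + 1) (boost (i + 2)) + th (i + 2) (boost (i + 1)) ∨
        y = th (i + 2) (rot (i + 1)) ∨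
        y = th (i + 1) (rot (i + 2)))} ∪
     {y | ∃ i, α = expCross i + expSq i ∧
        y = th (i + 1) (boost (i + 2)) - th (i + 2) (boost (i + 1))})

/-- The monomial `s^α v`. -/
def mon (α : Fin 3 → ℕ) (v : L A) : Ser (L A) := Pi.single α v

/-- The affine gauge subspace `θ_0 D_0 + A_{free,G}¹`. -/
def affineGauge (D0 : Derivation ℝ A A) : Set (Ser (L A)) :=
  {x | ∃ y : Ser (L A), (∀ α, y α ∈ gaugePart α) ∧ x = mon 0 (th0 (ofDer D0)) + y}

/-- The over-parametrized element of the affine gauge subspace with parameters `μ_i`, `β_i`,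
`γ_i^a` (`a = 0, …, 6`). Here `e i` is to be `exp μ_i`. -/
def overparam (D0 : Derivation ℝ A A) (e μ : Fin 3 → A) (β : Fin 3 → Derivation ℝ A A)
    (γ : Fin 3 → Fin 7 → A) : Ser (L A) :=
  mon 0 (th0 (ofDer D0)) +
  ∑ i : Fin 3,
    let j := i + 1
    let k := i + 2
    (mon 0 (-(γ i 0 • (th i (boost i) + th0 sigma0))) +
     mon (expSq i)
      (-((e i ^ 2 * γ i 1) • (th i (rot i) - th j (rot j) - th k (rot k)))) +
     mon (expCross i) ((e j * e k) •
      (th i (ofDer (β i))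
        - (γ i 2 + β i (μ 0 + μ 1 + μ 2)) • (th0 (boost i) + th i sigma0)
        - (γ i 3 - β i (μ k)) • th k (rot j)
        - (γ i 4 + β i (μ j)) • th j (rot k)
        - γ i 5 • (th k (boost j) + th j (boost k)))) +
     mon (expCross i + expSq i)
      ((e j * e k * e i ^ 2 * γ i 6) • (th j (boost k) - th k (boost j))))

end Algebra

/-! ## The base manifold `ℝ × S` -/

section VectorFields

variable {V : Type*} [NormedAddCommGroup V] [NormedSpace ℝ V] {H : Type*} [TopologicalSpace H]
  (I : ModelWithCorners ℝ V H) {M : Type*} [TopologicalSpace M] [ChartedSpace H M]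
  [IsManifold I ∞ M]

theorem contMDiff_apply_vectorField {X : ∀ p : M, TangentSpace I p}
    (hX : ContMDiff I I.tangent ∞ (fun p => (⟨p, X p⟩ : TangentBundle I M)))
    (f : C^∞⟮I, M; ℝ⟯) :
    ContMDiff I 𝓘(ℝ, ℝ) ∞ (fun p => (mfderiv I 𝓘(ℝ, ℝ) f p (X p) : ℝ)) := by
  have h1 : ContMDiff I.tangent 𝓘(ℝ, ℝ).tangent ∞ (tangentMap I 𝓘(ℝ, ℝ) f) :=
    f.contMDiff.contMDiff_tangentMap (by simp)
  have h2 := h1.comp hX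
  have h3 := (contMDiff_tangentBundleModelSpaceHomeomorph (I := 𝓘(ℝ, ℝ)) (n := ∞)).comp h2
  have h4 : ContMDiff (𝓘(ℝ, ℝ).prod 𝓘(ℝ, ℝ)) 𝓘(ℝ, ℝ) ∞ (fun p : ModelProd ℝ ℝ => p.2) := by
    unfold ModelProd
    rw [← chartedSpaceSelf_prod]
    exact contMDiff_snd
  exact h4.comp h3

/-- A smooth vector field as a derivation `f ↦ df(X)` of the smooth functions. -/
def derivationOf (X : ∀ p : M, TangentSpace I p)
    (hX : ContMDiff I I.tangent ∞ (fun p => (⟨p, X p⟩ : TangentBundle I M))) :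
    Derivation ℝ C^∞⟮I, M; ℝ⟯ C^∞⟮I, M; ℝ⟯ :=
  Derivation.mk'
    { toFun := fun f => ⟨fun p => (mfderiv I 𝓘(ℝ, ℝ) f p (X p) : ℝ),
        contMDiff_apply_vectorField I hX f⟩
      map_add' := by
        intro f g
        ext p
        exact congrArg (fun T : TangentSpace I p →L[ℝ] ℝ => T (X p))
          (mfderiv_add f.mdifferentiableAt g.mdifferentiableAt)
      map_smul' := by
        intro c f
        ext p
        exact congrArg (fun T : TangentSpace I p →L[ℝ] ℝ => T (X p))
          (const_smul_mfderiv f.mdifferentiableAt c) }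
    (by
      intro f g
      ext p
      exact congrArg (fun T : TangentSpace I p →L[ℝ] ℝ => T (X p))
        ((f.mdifferentiableAt.hasMFDerivAt.mul g.mdifferentiableAt.hasMFDerivAt).mfderiv))

end VectorFields

section Geometry

variable (S : Type*) [TopologicalSpace S] [ChartedSpace (EuclideanSpace ℝ (Fin 3)) S]

/-- Smooth functions on `S`. -/
abbrev CS : Type _ := C^∞⟮𝓡 3, S; ℝ⟯

/-- Smooth functions on the base manifold `ℝ × S`. -/
abbrev CM : Type _ := C^∞⟮𝓘(ℝ, ℝ).prod (𝓡 3), ℝ × S; ℝ⟯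

variable [IsManifold (𝓡 3) ∞ S]

/-- A smooth vector field on `S`. -/
abbrev VF : Type _ :=
  Cₛ^∞⟮𝓡 3; EuclideanSpace ℝ (Fin 3), (TangentSpace (𝓡 3) : S → Type _)⟯

variable {S}

/-- The derivation of `C^∞(S)` given by a vector field on `S`. -/
def VF.der (X : VF S) : Derivation ℝ (CS S) (CS S) := derivationOf (𝓡 3) X X.contMDiff

theorem contMDiff_prodVF (c : ℝ) (X : VF S) :
    ContMDiff (𝓘(ℝ, ℝ).prod (𝓡 3)) (𝓘(ℝ, ℝ).prod (𝓡 3)).tangent ∞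
      (fun p : ℝ × S =>
        (⟨p, (c, X p.2)⟩ : TangentBundle (𝓘(ℝ, ℝ).prod (𝓡 3)) (ℝ × S))) := by
  have : IsManifold (𝓡 3) 1 S := IsManifold.of_le (n := ∞) (by simp)
  have h0 : ContMDiff 𝓘(ℝ, ℝ) 𝓘(ℝ, ℝ).tangent ∞
      (fun t : ℝ => (⟨t, c⟩ : TangentBundle 𝓘(ℝ, ℝ) ℝ)) := by
    have hc : @ContMDiff ℝ _ ℝ _ _ ℝ _ 𝓘(ℝ, ℝ) ℝ _ _ (ℝ × ℝ) _ _ (ModelProd ℝ ℝ) _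
        (𝓘(ℝ, ℝ).prod 𝓘(ℝ, ℝ)) (ModelProd ℝ ℝ) _ (chartedSpaceSelf (ModelProd ℝ ℝ)) ∞
        (fun t : ℝ => ((t, c) : ModelProd ℝ ℝ)) := by
      unfold ModelProd
      rw [← chartedSpaceSelf_prod]
      exact contMDiff_id.prodMk contMDiff_const
    exact (contMDiff_tangentBundleModelSpaceHomeomorph_symm (I := 𝓘(ℝ, ℝ)) (n := ∞)).comp hc
  have h1 := contMDiff_equivTangentBundleProd_symm (n := ∞) (I := 𝓘(ℝ, ℝ)) (M := ℝ)
    (I' := 𝓡 3) (M' := S)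
  exact h1.comp ((h0.comp contMDiff_fst).prodMk (X.contMDiff.comp contMDiff_snd))

/-- The derivation of `C^∞(ℝ × S)` given by the vector field `c ∂/∂t + X`. -/
def prodDer (c : ℝ) (X : VF S) : Derivation ℝ (CM S) (CM S) :=
  derivationOf (𝓘(ℝ, ℝ).prod (𝓡 3)) (fun p : ℝ × S => (c, X p.2)) (contMDiff_prodVF c X)

variable (S) in
/-- `D_0 = ∂/∂t`. -/
def D0 : Derivation ℝ (CM S) (CM S) := prodDer 1 0

/-- A vector field `X` on `S`, extended to `ℝ × S` by `X(t) = 0`. -/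
def VF.ext (X : VF S) : Derivation ℝ (CM S) (CM S) := prodDer 0 X

/-- The exponential of a smooth function on `ℝ × S`. -/
def expCM (f : CM S) : CM S := ⟨fun p => Real.exp (f p), Real.contDiff_exp.contMDiff.comp f.contMDiff⟩

variable (S) in
/-- The time function `t`. -/
def time : CM S := ⟨fun p => p.1, contMDiff_fst⟩

/-- A smooth function on `S`, as a function on `ℝ × S` that does not depend on `t`. -/
def pull (f : CS S) : CM S := ⟨fun p => f p.2, f.contMDiff.comp contMDiff_snd⟩

variable (S) in
/-- A frame `D_1, D_2, D_3` of smooth vector fields on `S`, indexed by `0, 1, 2 : Fin 3`. -/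
structure Frame where
  D : Fin 3 → VF S
  linearIndependent : ∀ x : S, LinearIndependent ℝ (fun i => D i x)

variable (S) in
/-- `MC_pre(A_free)` over `S`: the tuples `(g_1⁰, g_2⁰, g_3⁰, D_1, D_2, D_3, ξ)` that satisfy the
constraint equations. The field `c`, with `c j k i = c_{jk}^i`, holds the structure functions of the
frame, which the frame determines. Cyclic `(i, j, k)` are `(i, i+1, i+2)`. -/
structure MCPre where
  g0 : Fin 3 → CS S
  frame : Frame S
  ξ : CS S
  c : Fin 3 → Fin 3 → Fin 3 → CS S
  lie_eq : ∀ j k, ⁅(frame.D j).der, (frame.D k).der⁆ = ∑ i, c j k i • (frame.D i).der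
  constraint_alg : 0 = g0 1 * g0 2 + g0 2 * g0 0 + g0 0 * g0 1
  constraint_diff : ∀ i : Fin 3,
    let j := i + 1
    let k := i + 2
    0 = (frame.D i).der (g0 j + g0 k) + c i j j * (g0 i - g0 j) + c i k k * (g0 i - g0 k)
      - 2 * (frame.D i).der ξ * g0 i

/-- The functions `g_i^a`, `a = 0, …, 4`, associated to an element of `MC_pre(A_free)`. -/
def MCPre.g (T : MCPre S) (i : Fin 3) : Fin 5 → CS S :=
  let j := i + 1
  let k := i + 2
  let g2 := (T.frame.D i).der T.ξ
  ![T.g0 i, (-1 / 2 : ℝ) • T.c j k i, g2, -T.c k i k - g2, -T.c i j j + g2]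

/-- The over-parametrized element with `μ_i = t γ_i⁰`, `β_i = D_i`, `γ_i⁵ = γ_i⁶ = 0`, for a frame
and functions `γ_i⁰, …, γ_i⁴`. -/
def normalElement (F : Frame S) (γ : Fin 3 → Fin 5 → CM S) : Ser (L (CM S)) :=
  overparam (D0 S) (fun i => expCM (time S * γ i 0)) (fun i => time S * γ i 0)
    (fun i => (F.D i).ext)
    (fun i => ![γ i 0, γ i 1, γ i 2, γ i 3, γ i 4, 0, 0])

end Geometry

end BKL

end

/-! For the three decompositions of W, θ_0 is even throughout, and θ_i is odd exactly for the two
decompositions other than the i-th. The three parities split L into four sectors, labelled by θ_0,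
..., θ_3, and the bracket adds parities. With γ_i⁵ = γ_i⁶ = 0 the element is x = u + ∑ s_i² p_i + ∑
s_j s_k q_i, where u and p_i lie in the sector of θ_0 and q_i in that of θ_i. So every coefficient
of [x,x] lies in a single sector and has few components.

At s^α the ideal (s_1,s_2,s_3) admits the sum of the F_{α-e_n}E over the n with α_n ≠ 0. This
decides how much of each coefficient must vanish. At s⁰ nothing is admitted: [u,u] is a Weyl tensor,
which means ∂_tγ_i⁰ = 0 and the quadratic relation. At s_i² one Bianchi component survives, and it
gives ∂_tγ_i¹ = 0. At s_j s_k the admitted spaces are even for a decomposition in which the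
coefficient is odd, so [u,q_i] vanishes in E; this gives ∂_tγ_i² = ∂_tγ_i³ = ∂_tγ_i⁴ = 0 and one
constraint. At s_i² s_j s_k the coefficient is [p_i,q_i] + [q_j,q_k] up to a factor 2. Its
derivation expresses [D_j,D_k] in the frame, its trace says that the one-form with components γ_i²
is closed, and its remaining Bianchi component is the Jacobi identity of the frame, which holds
automatically. All other monomials impose nothing. The factors e_i = exp(tγ_i⁰) absorb the time
dependence, and the terms proportional to t cancel by the derivative of the quadratic relation and
by the bracket relation applied to the γ_n⁰.

Necessity (`reducedEquations_of_MC`) evaluates linear functionals that vanish on the Weyl ideal and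
on the admitted spaces. Sufficiency (`gaugeElement_mem_MCFree`) recognizes Weyl tensors and elements
of the filtration. `jacobiEquation_of_lie` supplies the Jacobi identity. Since S is diffeomorphic to
ℝ³, the closed one-form has a potential ξ (`exists_potential`), and this turns the reduced equations
into those of MC_pre. `normalElement_mem_iff` combines the two directions. -/

noncomputable section
namespace BKL
-- Coefficients of the representations and of the bracket in the monomial basis.
section Evaluation
variable {A : Type*} [CommRing A] [Algebra ℝ A]

theorem CDer.ext' {δ ε : CDer A} (h : δ.der = ε.der) (h' : δ.mat = ε.mat) : δ = ε :=
  Subtype.ext (Prod.ext h h')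

@[simp] theorem der_zero : (0 : CDer A).der = 0 := rfl
@[simp] theorem mat_zero : (0 : CDer A).mat = 0 := rfl
@[simp] theorem der_add (δ ε : CDer A) : (δ + ε).der = δ.der + ε.der := rfl
@[simp] theorem mat_add (δ ε : CDer A) : (δ + ε).mat = δ.mat + ε.mat := rfl
@[simp] theorem der_sub (δ ε : CDer A) : (δ - ε).der = δ.der - ε.der := rfl
@[simp] theorem mat_sub (δ ε : CDer A) : (δ - ε).mat = δ.mat - ε.mat := rfl
@[simp] theorem der_neg (δ : CDer A) : (-δ).der = -δ.der := rfl
@[simp] theorem mat_neg (δ : CDer A) : (-δ).mat = -δ.mat := rfl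
@[simp] theorem der_smul (a : A) (δ : CDer A) : (a • δ).der = a • δ.der := rfl
@[simp] theorem mat_smul (a : A) (δ : CDer A) : (a • δ).mat = a • δ.mat := rfl

theorem der_sum {ι : Type*} (s : Finset ι) (f : ι → CDer A) :
    (∑ i ∈ s, f i).der = ∑ i ∈ s, (f i).der :=
  map_sum (LinearMap.fst A _ _ ∘ₗ (confDer A).subtype) f s

theorem mat_sum {ι : Type*} (s : Finset ι) (f : ι → CDer A) :
    (∑ i ∈ s, f i).mat = ∑ i ∈ s, (f i).mat :=
  map_sum (LinearMap.snd A _ _ ∘ₗ (confDer A).subtype) f s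

@[simp] theorem der_bracket (δ ε : CDer A) : (δ.bracket ε).der = ⁅δ.der, ε.der⁆ := rfl
@[simp] theorem mat_bracket (δ ε : CDer A) : (δ.bracket ε).mat =
    ε.mat.map δ.der - δ.mat.map ε.der + (δ.mat * ε.mat - ε.mat * δ.mat) := rfl

theorem sgn_eq_zero {J K : Finset (Fin 4)} (h : ¬ Disjoint J K) : sgn J K = 0 := if_neg h

@[simp] theorem sgn_empty_left (K : Finset (Fin 4)) : sgn ∅ K = 1 := by simp [sgn]
@[simp] theorem sgn_empty_right (K : Finset (Fin 4)) : sgn K ∅ = 1 := by simp [sgn]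

theorem sgn_singleton (a b : Fin 4) : sgn {a} {b} = if a = b then 0 else if b < a then -1 else 1 := by
  revert a b; decide

theorem wedge_theta_apply (J M : Finset (Fin 4)) (ν : ExtW A) :
    wedge (theta J) ν M = if J ⊆ M then sgn J (M \ J) • ν (M \ J) else 0 := by
  have h : wedge (theta J) ν M = ∑ K, Pi.single (M := fun _ => A) (J ∪ K) (sgn J K • ν K) M := by
    rw [wedge, Finset.sum_apply, Finset.sum_eq_single J]
    · simp [theta, Finset.sum_apply]
    · intro K _ hK
      simp [theta, Finset.sum_apply, hK]
    · simp
  rw [h]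
  split_ifs with hJ
  · rw [Finset.sum_eq_single (M \ J)]
    · rw [Finset.union_sdiff_of_subset hJ, Pi.single_eq_same]
    · intro K _ hK
      by_cases hd : Disjoint J K
      · rw [Pi.single_eq_of_ne]
        rintro rfl
        exact hK (by rw [Finset.union_sdiff_cancel_left hd])
      · simp [sgn_eq_zero hd]
    · simp
  · refine Finset.sum_eq_zero fun K _ => Pi.single_eq_of_ne ?_ _
    rintro rfl
    exact hJ Finset.subset_union_left

theorem rep_apply (x : L A) (ν : ExtW A) (M : Finset (Fin 4)) :
    rep x ν M = ∑ J ∈ M.powerset, sgn J (M \ J) • (x J).act ν (M \ J) := by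
  rw [rep, Finset.sum_apply]
  simp only [wedge_theta_apply]
  rw [← Finset.sum_filter]
  refine Finset.sum_congr ?_ fun _ _ => rfl
  ext; simp

theorem repOmega_apply (x : L A) (ν : ExtW A) (M : Finset (Fin 4)) :
    repOmega x ν M = ∑ J ∈ M.powerset,
      sgn J (M \ J) • ((x J).act ν (M \ J) + (x J).mat.trace * ν (M \ J)) := by
  rw [repOmega, Finset.sum_apply]
  simp only [wedge_theta_apply]
  rw [← Finset.sum_filter]
  refine Finset.sum_congr ?_ fun _ _ => rfl
  ext; simp

/-- A contribution to θ_N arises when θ_i with i ∈ N has replaced some θ_j; the two signs move θ_j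
and θ_i to the front. If j already belongs to N \ {i}, the first sign is zero, so no case
distinction is needed. -/
theorem act_apply (δ : CDer A) (ν : ExtW A) (N : Finset (Fin 4)) :
    δ.act ν N = δ.der (ν N) + ∑ i ∈ N, ∑ j,
      (sgn {j} (N.erase i) * sgn {i} (N.erase i)) •
        (δ.mat i j * ν (insert j (N.erase i))) := by
  rw [CDer.act, Finset.sum_apply]
  simp only [Pi.add_apply, Finset.sum_add_distrib]
  congr 1
  · rw [Finset.sum_eq_single N] <;> simp +contextual
  have key (J : Finset (Fin 4)) :
      (ν J • ∑ j ∈ J, ∑ i, δ.mat i j •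
        (sgn {j} (J.erase j) • wedge (A := A) (theta {i}) (theta (J.erase j)))) N =
      ∑ j, ∑ i, if j ∈ J ∧ i ∈ N ∧ N.erase i = J.erase j then
        (sgn {j} (N.erase i) * sgn {i} (N.erase i)) • (δ.mat i j * ν J) else 0 := by
    rw [Pi.smul_apply, Finset.sum_apply, smul_eq_mul, Finset.mul_sum]
    refine Finset.sum_subset_zero_on_sdiff (Finset.subset_univ J) ?_ fun j hj => ?_
    · intro j hj
      refine Finset.sum_eq_zero fun i _ => if_neg fun h => ?_
      exact (Finset.mem_sdiff.1 hj).2 h.1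
    · rw [Finset.sum_apply, Finset.mul_sum]
      refine Finset.sum_congr rfl fun i _ => ?_
      simp only [Pi.smul_apply, wedge_theta_apply, Finset.singleton_subset_iff,
        Finset.sdiff_singleton_eq_erase]
      simp only [theta, Pi.single_apply]
      split_ifs with h1 h2 h3 h3 h3
      · rw [h2, mul_smul]
        simp only [zsmul_eq_mul, smul_eq_mul]
        ring
      · exact absurd ⟨hj, h1, h2⟩ h3
      · exact absurd h3.2.2 h2
      · simp
      · exact absurd h3.2.1 h1
      · simp
  simp only [key]
  rw [Finset.sum_comm]
  simp_rw [Finset.sum_comm (s := (Finset.univ : Finset (Finset (Fin 4))))]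
  rw [Finset.sum_comm]
  symm
  refine Finset.sum_subset_zero_on_sdiff (Finset.subset_univ N) (fun i hi => ?_) fun i hi => ?_
  · refine Finset.sum_eq_zero fun j _ => Finset.sum_eq_zero fun J _ => if_neg fun h => ?_
    exact (Finset.mem_sdiff.1 hi).2 h.2.1
  · symm
    refine Finset.sum_congr rfl fun j _ => ?_
    by_cases hj : j ∈ N.erase i
    · rw [sgn_eq_zero (by simpa using hj), zero_mul, zero_smul]
      refine Finset.sum_eq_zero fun J _ => ?_
      simp
    · rw [Finset.sum_eq_single (insert j (N.erase i))]
      · rw [if_pos ⟨Finset.mem_insert_self _ _, hi, (Finset.erase_insert hj).symm⟩]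
      · intro J _ hJ
        refine if_neg fun h => hJ ?_
        rw [h.2.2, Finset.insert_erase h.1]
      · simp

theorem wedge_theta_theta (J K : Finset (Fin 4)) :
    wedge (A := A) (theta J) (theta K) = sgn J K • theta (J ∪ K) := by
  ext M
  rw [wedge_theta_apply, theta, theta, Pi.smul_apply, Pi.single_apply, Pi.single_apply]
  by_cases hd : Disjoint J K
  · by_cases hM : M = J ∪ K
    · subst hM
      simp [Finset.union_sdiff_cancel_left hd]
    · rw [if_neg hM, smul_zero]
      split_ifs with h1 h2
      · exact absurd (by rw [← h2, Finset.union_sdiff_of_subset h1]) hM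
      · simp
      · rfl
  · rw [sgn_eq_zero hd, zero_smul]
    split_ifs with h1 h2
    · exact absurd (h2 ▸ Finset.disjoint_sdiff) hd
    · simp
    · rfl

theorem wedge_sum {ι : Type*} (s : Finset ι) (u : ExtW A) (f : ι → ExtW A) :
    wedge u (∑ i ∈ s, f i) = ∑ i ∈ s, wedge u (f i) :=
  map_sum (⟨⟨wedge u, by simpa using wedge_smul (0 : A) u 0⟩, wedge_add u⟩ : ExtW A →+ ExtW A) f s

theorem act_theta_singleton (δ : CDer A) (b : Fin 4) :
    δ.act (theta {b}) = ∑ k, δ.mat k b • theta {k} := by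
  rw [CDer.act, Finset.sum_eq_single {b}]
  · have h : theta (A := A) {b} {b} = 1 := Pi.single_eq_same _ _
    rw [Finset.sum_singleton, h, Derivation.map_one_eq_zero, Pi.single_zero, zero_add, one_smul]
    refine Finset.sum_congr rfl fun k _ => ?_
    rw [wedge_theta_theta, Finset.erase_singleton, sgn_empty_right, sgn_empty_right, one_smul,
      one_smul, Finset.union_empty]
  · intro J _ hJ
    simp [theta, hJ]
  · simp

/-- The degree one element `∑ a, θ_a δ_a`. -/
def form1 (δ : Fin 4 → CDer A) : L A := ∑ a, tens (theta {a}) (δ a)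

/-- The degree two element `∑ a b, θ_a θ_b Y_{ab}`. -/
def form2 (Y : Fin 4 → Fin 4 → CDer A) : L A :=
  ∑ a, ∑ b, tens (wedge (theta {a}) (theta {b})) (Y a b)

theorem form1_singleton (δ : Fin 4 → CDer A) (a : Fin 4) : form1 δ {a} = δ a := by
  rw [form1, Finset.sum_apply, Finset.sum_eq_single a]
  · simp [tens, theta]
  · intro b _ hb
    simp [tens, theta, Ne.symm hb]
  · simp

theorem form1_isDeg (δ : Fin 4 → CDer A) : IsDeg 1 (form1 δ) := by
  intro J hJ
  rw [form1, Finset.sum_apply]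
  refine Finset.sum_eq_zero fun a _ => ?_
  have : J ≠ {a} := by rintro rfl; simp at hJ
  simp [tens, theta, this]

theorem form2_isDeg (Y : Fin 4 → Fin 4 → CDer A) : IsDeg 2 (form2 Y) := by
  intro J hJ
  rw [form2, Finset.sum_apply]
  refine Finset.sum_eq_zero fun a _ => ?_
  rw [Finset.sum_apply]
  refine Finset.sum_eq_zero fun b _ => ?_
  rw [wedge_theta_theta, tens, Pi.smul_apply, theta, Pi.single_apply]
  by_cases hab : a = b
  · subst hab; simp [sgn_eq_zero]
  · rw [if_neg, smul_zero, zero_smul]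
    rintro rfl
    exact hJ (Finset.card_pair hab)

/-- The family Y is not determined by the form; only its antisymmetrization is. Every later
component of a bracket is therefore a difference of two values of Y. -/
theorem form2_pair (Y : Fin 4 → Fin 4 → CDer A) {c d : Fin 4} (h : c < d) :
    form2 Y {c, d} = Y c d - Y d c := by
  have hcd : c ≠ d := h.ne
  have key (a b : Fin 4) : tens (wedge (A := A) (theta {a}) (theta {b})) (Y a b) {c, d} =
      if a = c then (if b = d then Y a b else 0)
      else if a = d then (if b = c then - Y a b else 0) else 0 := by
    rw [wedge_theta_theta, tens, Pi.smul_apply, theta, Pi.single_apply]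
    have h0 : ({c, d} : Finset (Fin 4)) = {a} ∪ {b} ↔ (a = c ∧ b = d) ∨ (a = d ∧ b = c) := by
      revert a b c d; decide
    simp only [h0, sgn_singleton]
    by_cases h1 : a = c
    · subst h1
      by_cases h2 : b = d
      · subst h2
        simp [hcd, h.not_gt]
      · simp [h2, hcd]
    · by_cases h2 : a = d
      · subst h2
        by_cases h3 : b = c
        · subst h3
          simp only [h1, if_false, if_true, h, and_self, or_true, false_and]
          rw [neg_one_smul]
          exact neg_one_smul A (Y a b)
        · simp [h1, h3]
      · simp [h1, h2]
  rw [form2, Finset.sum_apply]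
  simp only [Finset.sum_apply, key]
  rw [Fintype.sum_eq_add c d hcd]
  · simp [hcd.symm, sub_eq_add_neg]
  · rintro x ⟨h1, h2⟩
    simp [h1, h2]

theorem sum_singletons {B : Type*} [AddCommMonoid B] (G : Finset (Fin 4) → B)
    (h : ∀ J : Finset (Fin 4), J.card ≠ 1 → G J = 0) : ∑ J, G J = ∑ a, G {a} := by
  have h1 := Finset.sum_map Finset.univ ⟨fun a : Fin 4 => ({a} : Finset (Fin 4)),
    Finset.singleton_injective⟩ G
  refine Eq.trans ?_ h1
  refine (Finset.sum_subset (Finset.subset_univ _) fun J _ hJ => h J fun hc => hJ ?_).symm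
  obtain ⟨a, rfl⟩ := Finset.card_eq_one.1 hc
  simp

theorem zero_act (u : ExtW A) : (0 : CDer A).act u = 0 := by simp [CDer.act]

theorem wedge_zero (u : ExtW A) : wedge u 0 = 0 := by simp [wedge]

theorem bracket_zero (δ : CDer A) : δ.bracket 0 = 0 := by
  apply CDer.ext'
  · simp
  · ext; simp

theorem zero_bracket (δ : CDer A) : (0 : CDer A).bracket δ = 0 := by
  apply CDer.ext'
  · simp
  · ext; simp

theorem tens_zero (u : ExtW A) : tens u (0 : CDer A) = 0 := by
  funext J; simp [tens]

theorem zero_tens (δ : CDer A) : tens (0 : ExtW A) δ = 0 := by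
  funext J; simp [tens]

theorem tens_add (u : ExtW A) (δ ε : CDer A) : tens u (δ + ε) = tens u δ + tens u ε :=
  funext fun _ => smul_add _ _ _

theorem tens_smul (u : ExtW A) (a : A) (δ : CDer A) : tens u (a • δ) = a • tens u δ :=
  funext fun _ => smul_comm _ _ _

theorem tens_sum {ι : Type*} (s : Finset ι) (u : ExtW A) (f : ι → CDer A) :
    tens u (∑ i ∈ s, f i) = ∑ i ∈ s, tens u (f i) :=
  map_sum (⟨⟨tens u, tens_zero u⟩, tens_add u⟩ : CDer A →+ L A) f s

theorem sum_smul_tens {ι : Type*} (s : Finset ι) (a : ι → A) (u : ι → ExtW A) (δ : CDer A) :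
    tens (∑ i ∈ s, a i • u i) δ = ∑ i ∈ s, tens (u i) (a i • δ) := by
  ext1 J
  simp [tens, Finset.sum_smul, smul_smul, mul_comm]

/-- The coefficients of the bracket of two elements of degree one. -/
def bracketCoeff (δ ε : Fin 4 → CDer A) (a b : Fin 4) : CDer A :=
  (δ a).bracket (ε b) + ∑ c, (δ a).mat b c • ε c + ∑ c, (ε a).mat b c • δ c

/-- In degree (1,1) the sign in the definition of the bracket turns the subtracted term into a sum.
Relabelling then puts every contribution into the form θ_a θ_b times a coefficient. -/
theorem bracket_form1 (δ ε : Fin 4 → CDer A) :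
    bracket (form1 δ) (form1 ε) = form2 (bracketCoeff δ ε) := by
  have h (a : Fin 4) : ∑ K, (tens (wedge (theta {a})
      ((form1 δ {a}).act (theta K))) (form1 ε K)
      - (-1 : ℤ) ^ (({a} : Finset (Fin 4)).card * K.card) •
        tens (wedge (theta K) ((form1 ε K).act (theta {a}))) (form1 δ {a})
      + tens (wedge (theta {a}) (theta K)) ((form1 δ {a}).bracket (form1 ε K))) =
      ∑ b, (∑ c, tens (wedge (theta {a}) (theta {c})) ((δ a).mat c b • ε b) +
        ∑ c, tens (wedge (theta {b}) (theta {c})) ((ε b).mat c a • δ a) +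
        tens (wedge (theta {a}) (theta {b})) ((δ a).bracket (ε b))) := by
    rw [sum_singletons _ fun K hK => ?_]
    · refine Finset.sum_congr rfl fun b _ => ?_
      rw [form1_singleton, form1_singleton, act_theta_singleton, act_theta_singleton, wedge_sum,
        wedge_sum, Finset.card_singleton, Finset.card_singleton]
      simp only [wedge_smul, sum_smul_tens, mul_one, pow_one, neg_smul, one_smul, sub_neg_eq_add]
    · simp only [form1_isDeg ε K hK, tens_zero, zero_act, wedge_zero, zero_tens, bracket_zero]
      simp
  rw [bracket, sum_singletons _ fun J hJ => ?_]
  · refine (Finset.sum_congr rfl fun a _ => h a).trans ?_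
    simp only [form2, bracketCoeff, tens_add, tens_sum, Finset.sum_add_distrib]
    refine Eq.trans (add_comm _ _) (Eq.trans (add_assoc _ _ _).symm ?_)
    refine congrArg₂ _ (congrArg₂ _ rfl ?_) ?_
    -- The first matrix term requires an exchange of the two inner indices, the second a cyclic
    -- relabelling of all three.
    · exact Finset.sum_congr rfl fun a _ => Finset.sum_comm
    · refine Finset.sum_comm.trans ?_
      exact Finset.sum_congr rfl fun a _ => Finset.sum_comm
  · simp only [form1_isDeg δ J hJ, tens_zero, zero_act, wedge_zero, zero_tens, zero_bracket]
    simp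

end Evaluation
end BKL
end

/-! ### Functionals vanishing on the Weyl ideal, and parities. -/

noncomputable section
namespace BKL
section Filtration
variable {A : Type*} [CommRing A] [Algebra ℝ A]

/-- The covector θ_k produced from θ_j must complete the monomial of y to θ_M, so only the
coefficients of y on the sets M \ {k} enter. When M has three elements these are of degree two, and
the components are those of the first Bianchi identity. -/
theorem rep_theta_singleton (y : L A) (j : Fin 4) (M : Finset (Fin 4)) :
    rep y (theta {j}) M = ∑ k ∈ M, sgn (M.erase k) {k} • (y (M.erase k)).mat k j := by
  rw [rep, Finset.sum_apply]
  simp only [act_theta_singleton, wedge_sum, wedge_smul, wedge_theta_theta, Finset.sum_apply,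
    Pi.smul_apply]
  rw [Finset.sum_comm]
  symm
  refine Finset.sum_subset_zero_on_sdiff (Finset.subset_univ M) (fun k hk => ?_) fun k hk => ?_
  · refine Finset.sum_eq_zero fun J _ => ?_
    have : M ≠ J ∪ {k} := by rintro rfl; simp at hk
    rw [theta, Pi.single_eq_of_ne this, smul_zero, smul_zero]
  · rw [Finset.sum_eq_single (M.erase k)]
    · have : M = M.erase k ∪ {k} := by
        rw [Finset.union_comm, ← Finset.insert_eq, Finset.insert_erase hk]
      rw [theta, ← this, Pi.single_eq_same, smul_eq_mul, mul_smul_comm, mul_one]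
    · intro J _ hJ
      by_cases hkJ : k ∈ J
      · simp [sgn_eq_zero, hkJ]
      · have : M ≠ J ∪ {k} := by
          rintro rfl
          rw [Finset.union_comm, ← Finset.insert_eq, Finset.erase_insert hkJ] at hJ
          exact hJ rfl
        rw [theta, Pi.single_eq_of_ne this, smul_zero, smul_zero]
    · simp

/-! ### Linear functionals that vanish on the Weyl ideal -/

/-- The coefficient of `θ_J` in a derivation, applied to a function. -/
def derFun (J : Finset (Fin 4)) (f : A) : L A →ₗ[A] A where
  toFun y := (y J).der f
  map_add' _ _ := rfl
  map_smul' _ _ := rfl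

/-- The trace of the coefficient of `θ_J`. -/
def trFun (J : Finset (Fin 4)) : L A →ₗ[A] A where
  toFun y := (y J).mat.trace
  map_add' _ _ := Matrix.trace_add _ _
  map_smul' _ _ := Matrix.trace_smul _ _

/-- The Ricci contraction. -/
def ricFun (b i : Fin 4) : L A →ₗ[A] A where
  toFun y := ∑ a : Fin 4, sgn {a} {b} • (y {a, b}).mat i a
  map_add' x y := by
    simp only [Pi.add_apply, mat_add, Matrix.add_apply, smul_add, Finset.sum_add_distrib]
  map_smul' c y := by
    simp only [Pi.smul_apply, mat_smul, Matrix.smul_apply, Finset.smul_sum, RingHom.id_apply]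
    exact Finset.sum_congr rfl fun a _ => smul_comm _ _ _

/-- The coefficient of `θ_M` in the action on `θ_j`. -/
def repFun (j : Fin 4) (M : Finset (Fin 4)) : L A →ₗ[A] A where
  toFun y := rep y (theta {j}) M
  map_add' x y := by rw [rep_add]; rfl
  map_smul' c y := by rw [rep_smul]; rfl

theorem thetaMul_empty (w : L A) : thetaMul ∅ w = w := by
  funext K
  rw [thetaMul, Finset.sum_apply, Finset.sum_eq_single K]
  · simp
  · intro J _ hJ
    rw [Finset.empty_union, Pi.single_eq_of_ne hJ.symm]
  · simp

theorem thetaMul_isDeg {J : Finset (Fin 4)} {w : L A} {n : ℕ} (hw : IsDeg n w) :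
    IsDeg (J.card + n) (thetaMul J w) := by
  intro K hK
  rw [thetaMul, Finset.sum_apply]
  refine Finset.sum_eq_zero fun M _ => ?_
  by_cases hd : Disjoint J M
  · by_cases hM : K = J ∪ M
    · subst hM
      rw [Pi.single_eq_same, hw M, smul_zero]
      rintro rfl
      exact hK (Finset.card_union_of_disjoint hd)
    · rw [Pi.single_eq_of_ne hM]
  · rw [sgn_eq_zero hd, zero_smul, Pi.single_zero, Pi.zero_apply]

/-- A generator θ_J w with J nonempty has degree at least three. A functional that sees only degree
two therefore has to be tested on the Weyl tensors alone. -/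
theorem weylIdeal_le_ker (l : L A →ₗ[A] A)
    (h2 : ∀ y : L A, (∀ J : Finset (Fin 4), J.card = 2 → y J = 0) → l y = 0)
    (hw : ∀ w : L A, IsWeyl w → l w = 0) : weylIdeal A ≤ LinearMap.ker l := by
  rw [weylIdeal, Submodule.span_le]
  rintro _ ⟨J, w, h, rfl⟩
  change l _ = 0
  by_cases hJ : J = ∅
  · rw [hJ, thetaMul_empty, hw w h]
  · refine h2 _ fun K hK => thetaMul_isDeg h.deg K ?_
    have := Finset.card_pos.2 (Finset.nonempty_iff_ne_empty.2 hJ)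
    omega

theorem weylIdeal_le_derFun {J : Finset (Fin 4)} (hJ : J.card = 2) (f : A) :
    weylIdeal A ≤ LinearMap.ker (derFun J f) := by
  refine weylIdeal_le_ker _ (fun y hy => ?_) fun w hw => ?_
  · change (y J).der f = 0
    rw [hy J hJ]; rfl
  · change (w J).der f = 0
    rw [hw.der J]; rfl

theorem weylIdeal_le_trFun {J : Finset (Fin 4)} (hJ : J.card = 2) :
    weylIdeal A ≤ LinearMap.ker (trFun J) := by
  refine weylIdeal_le_ker _ (fun y hy => ?_) fun w hw => hw.so J
  change (y J).mat.trace = 0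
  rw [hy J hJ]
  simp

theorem weylIdeal_le_ricFun (b i : Fin 4) : weylIdeal A ≤ LinearMap.ker (ricFun b i) := by
  refine weylIdeal_le_ker _ (fun y hy => ?_) fun w hw => hw.ricci b i
  change ∑ a : Fin 4, sgn {a} {b} • (y {a, b}).mat i a = 0
  refine Finset.sum_eq_zero fun a _ => ?_
  by_cases hab : a = b
  · rw [sgn_eq_zero (by simp [hab]), zero_smul]
  · rw [hy _ (Finset.card_pair hab)]; simp

theorem weylIdeal_le_repFun (j : Fin 4) {M : Finset (Fin 4)} (hM : M.card = 3) :
    weylIdeal A ≤ LinearMap.ker (repFun j M) := by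
  refine weylIdeal_le_ker _ (fun y hy => ?_) fun w hw => ?_
  · change rep y (theta {j}) M = 0
    rw [rep_theta_singleton]
    refine Finset.sum_eq_zero fun k hk => ?_
    rw [hy _ (by rw [Finset.card_erase_of_mem hk, hM])]; simp
  · change rep w (theta {j}) M = 0
    rw [hw.bianchi]; rfl

/-! ### Parity -/

/-- The elements of `CDerEnd(W)` of parity `n`. -/
def parCDer (T : Finset (Fin 4)) (n : ℕ) : Submodule A (CDer A) :=
  if n % 2 = 0 then evenCDer T else oddCDer T

theorem mem_parityL {T : Finset (Fin 4)} {p : ℕ} {y : L A} :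
    y ∈ parityL T p ↔ ∀ J, y J ∈ parCDer T ((J ∩ T).card + p) := by
  simp only [parityL, Submodule.mem_pi, Set.mem_univ, true_imp_iff, parCDer]
  refine forall_congr' fun J => ?_
  have : (J ∩ T).card % 2 = p % 2 ↔ ((J ∩ T).card + p) % 2 = 0 := by omega
  simp only [this]

theorem parCDer_congr {T : Finset (Fin 4)} {m n : ℕ} (h : m % 2 = n % 2) :
    parCDer (A := A) T m = parCDer T n := by rw [parCDer, parCDer, h]

theorem card_insert_inter {T N : Finset (Fin 4)} {i : Fin 4} (h : i ∉ N) :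
    ((insert i N) ∩ T).card = (N ∩ T).card + ({i} ∩ T).card := by
  by_cases hi : i ∈ T
  · rw [Finset.insert_inter_of_mem hi, Finset.card_insert_of_notMem (by simp [h]),
      Finset.singleton_inter_of_mem hi, Finset.card_singleton]
  · rw [Finset.insert_inter_of_notMem hi, Finset.singleton_inter_of_notMem hi]; simp

theorem card_singleton_inter (T : Finset (Fin 4)) (i : Fin 4) :
    ({i} ∩ T).card = if i ∈ T then 1 else 0 := by
  split_ifs with h
  · rw [Finset.singleton_inter_of_mem h, Finset.card_singleton]
  · rw [Finset.singleton_inter_of_notMem h, Finset.card_empty]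

/-- The even and the odd case merge into one congruence for |{i} ∩ T| + |{j} ∩ T| + n, so that later
parity arguments become linear arithmetic. -/
theorem mem_parCDer {T : Finset (Fin 4)} {n : ℕ} {δ : CDer A} :
    δ ∈ parCDer T n ↔ (n % 2 = 1 → δ.der = 0) ∧
      ∀ i j, (({i} ∩ T).card + ({j} ∩ T).card + n) % 2 = 1 → δ.mat i j = 0 := by
  have h (i j : Fin 4) : (({i} ∩ T).card + ({j} ∩ T).card) % 2 = 0 ↔ (i ∈ T ↔ j ∈ T) := by
    rw [card_singleton_inter, card_singleton_inter]
    split_ifs <;> simp_all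
  rw [parCDer]
  split_ifs with hn
  · change (∀ i j, ¬ (i ∈ T ↔ j ∈ T) → δ.mat i j = 0) ↔ _
    refine ⟨fun H => ⟨fun h1 => by omega, fun i j hij => H i j ?_⟩, fun H i j hij => H.2 i j ?_⟩
    · rw [← h]; omega
    · rw [← h] at hij; omega
  · change (δ.der = 0 ∧ ∀ i j, (i ∈ T ↔ j ∈ T) → δ.mat i j = 0) ↔ _
    refine ⟨fun H => ⟨fun _ => H.1, fun i j hij => H.2 i j ?_⟩,
      fun H => ⟨H.1 (by omega), fun i j hij => H.2 i j ?_⟩⟩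
    · rw [← h]; omega
    · rw [← h] at hij; omega

theorem act_parity {T : Finset (Fin 4)} {n q : ℕ} {δ : CDer A} (hδ : δ ∈ parCDer T n)
    {ν : ExtW A} (hν : ∀ J, (J ∩ T).card % 2 ≠ q % 2 → ν J = 0) (N : Finset (Fin 4))
    (hN : (N ∩ T).card % 2 ≠ (q + n) % 2) : δ.act ν N = 0 := by
  rw [mem_parCDer] at hδ
  rw [act_apply, Finset.sum_eq_zero fun i hi => Finset.sum_eq_zero fun j _ => ?_, add_zero]
  · by_cases hn : n % 2 = 1
    · rw [hδ.1 hn]; rfl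
    · rw [hν N (by omega), map_zero]
  · by_cases hj : j ∈ N.erase i
    · rw [sgn_eq_zero (by simpa using hj), zero_mul, zero_smul]
    have h1 := card_insert_inter (T := T) hj
    have h2 := card_insert_inter (T := T) (Finset.notMem_erase i N)
    rw [Finset.insert_erase hi] at h2
    by_cases h : (({i} ∩ T).card + ({j} ∩ T).card + n) % 2 = 1
    · rw [hδ.2 i j h, zero_mul, smul_zero]
    · rw [hν _ (by omega), mul_zero, smul_zero]

theorem trace_of_odd {T : Finset (Fin 4)} {n : ℕ} {δ : CDer A} (hδ : δ ∈ parCDer T n)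
    (hn : n % 2 = 1) : δ.mat.trace = 0 :=
  Finset.sum_eq_zero fun i _ => (mem_parCDer.1 hδ).2 i i (by omega)

theorem card_sdiff_inter {T J M : Finset (Fin 4)} (h : J ⊆ M) :
    (M ∩ T).card = (J ∩ T).card + ((M \ J) ∩ T).card := by
  rw [← Finset.card_union_of_disjoint, ← Finset.union_inter_distrib_right,
    Finset.union_sdiff_of_subset h]
  exact Finset.disjoint_of_subset_left Finset.inter_subset_left
    (Finset.disjoint_of_subset_right Finset.inter_subset_left Finset.disjoint_sdiff)

theorem rep_parity {T : Finset (Fin 4)} {p q : ℕ} {y : L A} (hy : y ∈ parityL T p)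
    {ν : ExtW A} (hν : ∀ J, (J ∩ T).card % 2 ≠ q % 2 → ν J = 0) (M : Finset (Fin 4))
    (hM : (M ∩ T).card % 2 ≠ (q + p) % 2) : rep y ν M = 0 ∧ repOmega y ν M = 0 := by
  rw [mem_parityL] at hy
  have h1 (J) (hJ : J ∈ M.powerset) : (y J).act ν (M \ J) = 0 := by
    have := card_sdiff_inter (T := T) (Finset.mem_powerset.1 hJ)
    exact act_parity (hy J) hν _ (by omega)
  have h2 (J) (hJ : J ∈ M.powerset) : (y J).mat.trace * ν (M \ J) = 0 := by
    have := card_sdiff_inter (T := T) (Finset.mem_powerset.1 hJ)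
    by_cases h : ((J ∩ T).card + p) % 2 = 1
    · rw [trace_of_odd (hy J) h, zero_mul]
    · rw [hν _ (by omega), mul_zero]
  rw [rep_apply, repOmega_apply]
  exact ⟨Finset.sum_eq_zero fun J hJ => by rw [h1 J hJ, smul_zero],
    Finset.sum_eq_zero fun J hJ => by rw [h1 J hJ, h2 J hJ, add_zero, smul_zero]⟩

/-- Since W_1 has rank two, the W_1-degree is at most 2. Given the parity, the bound by q + p can
fail only for degree 2 against q + p = 0. The only case to exclude is p = q = 0 and a monomial
containing all of W_1. -/
theorem mem_FTriL_of_parity {T : Finset (Fin 4)} (hT : T.card = 2) {p : ℕ} {y : L A}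
    (hy : y ∈ parityL T p) (h0 : p = 0 → ∀ ν ∈ FExt (A := A) T 0, ∀ M, T ⊆ M →
      rep y ν M = 0 ∧ repOmega y ν M = 0) : y ∈ FTriL T p := by
  refine ⟨hy, fun q ν hν => ?_⟩
  have key (M) (hM : ¬ ((M ∩ T).card ≤ q + p ∧ (M ∩ T).card % 2 = (q + p) % 2)) :
      rep y ν M = 0 ∧ repOmega y ν M = 0 := by
    by_cases hpar : (M ∩ T).card % 2 = (q + p) % 2
    · have h1 : (M ∩ T).card ≤ 2 := hT ▸ Finset.card_le_card Finset.inter_subset_right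
      have hp : p = 0 := by omega
      have hq : q = 0 := by omega
      subst hq
      refine h0 hp ν hν M ?_
      have : (M ∩ T).card = T.card := by omega
      exact Finset.inter_eq_right.1 (Finset.eq_of_subset_of_card_le Finset.inter_subset_right
        this.ge)
    · refine rep_parity hy (q := q) (fun J hJ => hν J fun h => hJ h.2) M hpar
  exact ⟨fun M hM => (key M hM).1, fun M hM => (key M hM).2⟩

theorem parity_le_FTriL {T : Finset (Fin 4)} (hT : T.card = 2) {p : ℕ} (hp : p ≠ 0) :
    parityL (A := A) T p ≤ FTriL T p :=
  fun _ hy => mem_FTriL_of_parity hT hy fun h => absurd h hp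

theorem single_mem_FExt {T J : Finset (Fin 4)} (h : J ∩ T = ∅) (f : A) :
    (Pi.single J f : ExtW A) ∈ FExt (A := A) T 0 := by
  intro K hK
  refine Pi.single_eq_of_ne ?_ _
  rintro rfl
  simp [h] at hK

/-- Acting on functions isolates the derivation of the coefficient on M; acting on multiples of the
volume element isolates its trace as well. This is where the second representation gives a condition
of its own. -/
theorem rep_single_empty (y : L A) (f : A) (M : Finset (Fin 4)) :
    rep y (Pi.single ∅ f) M = (y M).der f ∧
      repOmega y (Pi.single ∅ f) M = (y M).der f + (y M).mat.trace * f := by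
  have h (δ : CDer A) (N : Finset (Fin 4)) :
      δ.act (Pi.single ∅ f : ExtW A) N = if N = ∅ then δ.der f else 0 := by
    rw [act_apply, Finset.sum_eq_zero fun i _ => Finset.sum_eq_zero fun j _ => ?_, add_zero]
    · split_ifs with hN
      · rw [hN, Pi.single_eq_same]
      · rw [Pi.single_eq_of_ne hN, map_zero]
    · rw [Pi.single_eq_of_ne (Finset.insert_ne_empty _ _), mul_zero, smul_zero]
  rw [rep_apply, repOmega_apply, Finset.sum_eq_single M, Finset.sum_eq_single M]
  · simp [h]
  · intro J hJ hJM
    have : M \ J ≠ ∅ := fun h' => hJM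
      (Finset.Subset.antisymm (Finset.mem_powerset.1 hJ) (Finset.sdiff_eq_empty_iff_subset.1 h'))
    rw [h, if_neg this, Pi.single_eq_of_ne this]; simp
  · simp
  · intro J hJ hJM
    have : M \ J ≠ ∅ := fun h' => hJM
      (Finset.Subset.antisymm (Finset.mem_powerset.1 hJ) (Finset.sdiff_eq_empty_iff_subset.1 h'))
    rw [h, if_neg this]; simp
  · simp

theorem FTriL_zero_der {T : Finset (Fin 4)} (hT : T ≠ ∅) {y : L A} (hy : y ∈ FTriL T 0) :
    (y T).der = 0 := by
  ext f
  rw [← (rep_single_empty y f T).1]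
  exact (hy.2 0 _ (single_mem_FExt (by simp) f)).1 T (by simpa using fun h => absurd h hT)

theorem FTriL_zero_trace {T : Finset (Fin 4)} (hT : T ≠ ∅) {y : L A} (hy : y ∈ FTriL T 0) :
    (y T).mat.trace = 0 := by
  have h := (rep_single_empty y 1 T).2
  rw [Derivation.map_one_eq_zero, zero_add, mul_one] at h
  rw [← h]
  exact (hy.2 0 _ (single_mem_FExt (by simp) 1)).2 T (by simpa using fun h => absurd h hT)

theorem FTriL_zero_rep {T M : Finset (Fin 4)} (hM : (M ∩ T).Nonempty) {j : Fin 4} (hj : j ∉ T)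
    {y : L A} (hy : y ∈ FTriL T 0) : rep y (theta {j}) M = 0 :=
  (hy.2 0 _ (single_mem_FExt (Finset.singleton_inter_of_notMem hj) 1)).1 M
    (by simpa using fun h => absurd h (Finset.nonempty_iff_ne_empty.1 hM))

theorem form1_mem_parityL {T : Finset (Fin 4)} {p : ℕ} {δ : Fin 4 → CDer A}
    (h : ∀ a, δ a ∈ parCDer T (({a} ∩ T).card + p)) : form1 δ ∈ parityL T p := by
  rw [mem_parityL]
  intro J
  by_cases hJ : J.card = 1
  · obtain ⟨a, rfl⟩ := Finset.card_eq_one.1 hJ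
    rw [form1_singleton]
    exact h a
  · rw [form1_isDeg δ J hJ]
    exact Submodule.zero_mem _

theorem bracket_mem_parCDer {T : Finset (Fin 4)} {m n : ℕ} {δ ε : CDer A}
    (hδ : δ ∈ parCDer T m) (hε : ε ∈ parCDer T n) : δ.bracket ε ∈ parCDer T (m + n) := by
  rw [mem_parCDer] at hδ hε ⊢
  constructor
  · intro h
    rw [der_bracket]
    by_cases hm : m % 2 = 1
    · rw [hδ.1 hm, zero_lie]
    · rw [hε.1 (by omega), lie_zero]
  · intro i j h
    have h1 : δ.der (ε.mat i j) = 0 := by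
      by_cases hm : m % 2 = 1
      · rw [hδ.1 hm]; rfl
      · rw [hε.2 i j (by omega), map_zero]
    have h2 : ε.der (δ.mat i j) = 0 := by
      by_cases hn : n % 2 = 1
      · rw [hε.1 hn]; rfl
      · rw [hδ.2 i j (by omega), map_zero]
    rw [mat_bracket, Matrix.add_apply, Matrix.sub_apply, Matrix.sub_apply, Matrix.map_apply,
      Matrix.map_apply, h1, h2, Matrix.mul_apply, Matrix.mul_apply,
      Finset.sum_eq_zero fun k _ => ?_, Finset.sum_eq_zero fun k _ => ?_]
    · simp
    · by_cases hk : (({i} ∩ T).card + ({k} ∩ T).card + n) % 2 = 1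
      · rw [hε.2 i k hk, zero_mul]
      · rw [hδ.2 k j (by omega), mul_zero]
    · by_cases hk : (({i} ∩ T).card + ({k} ∩ T).card + m) % 2 = 1
      · rw [hδ.2 i k hk, zero_mul]
      · rw [hε.2 k j (by omega), mul_zero]

theorem smul_mem_parCDer {T : Finset (Fin 4)} {m n : ℕ} {a : A} {δ : CDer A}
    (hδ : δ ∈ parCDer T m) (ha : (m + n) % 2 = 1 → a = 0) : a • δ ∈ parCDer T n := by
  by_cases h : (m + n) % 2 = 1
  · rw [ha h, zero_smul]
    exact Submodule.zero_mem _
  · rw [parCDer_congr (n := m) (by omega)]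
    exact Submodule.smul_mem _ _ hδ

theorem form2_mem_parityL {T : Finset (Fin 4)} {p : ℕ} {Y : Fin 4 → Fin 4 → CDer A}
    (h : ∀ a b, Y a b ∈ parCDer T (({a} ∩ T).card + ({b} ∩ T).card + p)) :
    form2 Y ∈ parityL T p := by
  rw [mem_parityL]
  intro J
  by_cases hJ : J.card = 2
  · obtain ⟨a, b, hab, rfl⟩ := Finset.card_eq_two.1 hJ
    have key (a b : Fin 4) (hab : a < b) : form2 Y {a, b} ∈ parCDer T (({a, b} ∩ T).card + p) := by
      rw [form2_pair Y hab, card_insert_inter (by simpa using hab.ne), add_comm ({b} ∩ T).card]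
      refine Submodule.sub_mem _ (h a b) ?_
      rw [add_comm ({a} ∩ T).card]
      exact h b a
    rcases hab.lt_or_gt with h' | h'
    · exact key a b h'
    · rw [Finset.pair_comm]
      exact key b a h'
  · rw [form2_isDeg Y J hJ]
    exact Submodule.zero_mem _

/-- Parities add in each of the three terms of `bracketCoeff`: a matrix entry of the wrong parity is
zero, which removes the summands that would violate this. -/
theorem bracket_mem_parityL {T : Finset (Fin 4)} {p q : ℕ} {δ ε : Fin 4 → CDer A}
    (hδ : ∀ a, δ a ∈ parCDer T (({a} ∩ T).card + p))
    (hε : ∀ a, ε a ∈ parCDer T (({a} ∩ T).card + q)) :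
    bracket (form1 δ) (form1 ε) ∈ parityL T (p + q) := by
  rw [bracket_form1]
  refine form2_mem_parityL fun a b => ?_
  refine Submodule.add_mem _ (Submodule.add_mem _ ?_ (Submodule.sum_mem _ fun c _ => ?_))
    (Submodule.sum_mem _ fun c _ => ?_)
  · rw [parCDer_congr (n := ({a} ∩ T).card + p + (({b} ∩ T).card + q)) (by omega)]
    exact bracket_mem_parCDer (hδ a) (hε b)
  · exact smul_mem_parCDer (hε c) fun h => (mem_parCDer.1 (hδ a)).2 _ _ (by omega)
  · exact smul_mem_parCDer (hδ c) fun h => (mem_parCDer.1 (hε a)).2 _ _ (by omega)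

end Filtration
end BKL
end

/-! ### Criteria for membership in F_{◁0} in degrees one and two. -/

set_option linter.unusedSimpArgs false
noncomputable section
namespace BKL
section Criteria
variable {A : Type*} [CommRing A] [Algebra ℝ A]

theorem act_singleton (δ : CDer A) (ν : ExtW A) (a : Fin 4) :
    δ.act ν {a} = δ.der (ν {a}) + ∑ j, δ.mat a j * ν {j} := by
  rw [act_apply, Finset.sum_singleton]
  simp

theorem act_pair (δ : CDer A) (ν : ExtW A) {a b : Fin 4} (h : a < b) :
    δ.act ν {a, b} = δ.der (ν {a, b}) + ∑ j, (sgn {j} {b} • (δ.mat a j * ν {j, b}) -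
      sgn {j} {a} • (δ.mat b j * ν {j, a})) := by
  have h1 : ({a, b} : Finset (Fin 4)).erase a = {b} :=
    Finset.erase_insert (by simpa using h.ne)
  have h2 : ({a, b} : Finset (Fin 4)).erase b = {a} := by
    rw [Finset.pair_comm]
    exact Finset.erase_insert (by simpa using h.ne')
  rw [act_apply, Finset.sum_pair h.ne, h1, h2, ← Finset.sum_add_distrib]
  congr 1
  refine Finset.sum_congr rfl fun j _ => ?_
  have h3 : sgn {a} {b} = 1 := by rw [sgn_singleton, if_neg h.ne, if_neg h.not_gt]
  have h4 : sgn {b} {a} = -1 := by rw [sgn_singleton, if_neg h.ne', if_pos h]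
  rw [h3, h4, mul_one, mul_neg, mul_one, neg_smul, sub_eq_add_neg]

theorem rep_apply_of_isDeg {n : ℕ} {y : L A} (hy : IsDeg n y) (ν : ExtW A)
    (M : Finset (Fin 4)) :
    rep y ν M = ∑ J ∈ M.powersetCard n, sgn J (M \ J) • (y J).act ν (M \ J) := by
  rw [rep_apply]
  symm
  refine Finset.sum_subset (fun J hJ => ?_) fun J hJ hJ' => ?_
  · exact Finset.mem_powerset.2 (Finset.mem_powersetCard.1 hJ).1
  · rw [hy J, zero_act, Pi.zero_apply, smul_zero]
    exact fun h => hJ' (Finset.mem_powersetCard.2 ⟨Finset.mem_powerset.1 hJ, h⟩)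

theorem rep_two_triple {y : L A} (hy : IsDeg 2 y) (ν : ExtW A) {a b c : Fin 4} (hab : a < b)
    (hbc : b < c) : rep y ν {a, b, c} =
      (y {b, c}).act ν {a} - (y {a, c}).act ν {b} + (y {a, b}).act ν {c} := by
  have h1 : ({a, b, c} : Finset (Fin 4)).powersetCard 2 = {{b, c}, {a, c}, {a, b}} ∧
      ({a, c} : Finset (Fin 4)) ≠ {a, b} ∧
      ({b, c} : Finset (Fin 4)) ∉ ({{a, c}, {a, b}} : Finset (Finset (Fin 4))) ∧
      ({a, b, c} : Finset (Fin 4)) \ {b, c} = {a} ∧ ({a, b, c} : Finset (Fin 4)) \ {a, c} = {b} ∧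
      ({a, b, c} : Finset (Fin 4)) \ {a, b} = {c} ∧ sgn {b, c} {a} = 1 ∧ sgn {a, c} {b} = -1 ∧
      sgn {a, b} {c} = 1 := by
    revert a b c; decide
  obtain ⟨h1, h2, h3, h4, h5, h6, h7, h8, h9⟩ := h1
  rw [rep_apply_of_isDeg hy, h1, Finset.sum_insert h3, Finset.sum_pair h2, h4, h5, h6, h7, h8, h9,
    one_smul, one_smul, neg_one_smul]
  abel

theorem rep_two_univ {y : L A} (hy : IsDeg 2 y) (ν : ExtW A) : rep y ν {0, 1, 2, 3} =
      (y {0, 1}).act ν {2, 3} - (y {0, 2}).act ν {1, 3} + (y {0, 3}).act ν {1, 2} +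
      (y {1, 2}).act ν {0, 3} - (y {1, 3}).act ν {0, 2} + (y {2, 3}).act ν {0, 1} := by
  have h : ({0, 1, 2, 3} : Finset (Fin 4)).powersetCard 2 =
      {{0, 1}, {0, 2}, {0, 3}, {1, 2}, {1, 3}, {2, 3}} := by decide
  rw [rep_apply_of_isDeg hy, h]
  repeat rw [Finset.sum_insert (by decide)]
  rw [Finset.sum_singleton]
  have h1 : ({0, 1, 2, 3} : Finset (Fin 4)) \ {0, 1} = {2, 3} := by decide
  have h2 : ({0, 1, 2, 3} : Finset (Fin 4)) \ {0, 2} = {1, 3} := by decide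
  have h3 : ({0, 1, 2, 3} : Finset (Fin 4)) \ {0, 3} = {1, 2} := by decide
  have h4 : ({0, 1, 2, 3} : Finset (Fin 4)) \ {1, 2} = {0, 3} := by decide
  have h5 : ({0, 1, 2, 3} : Finset (Fin 4)) \ {1, 3} = {0, 2} := by decide
  have h6 : ({0, 1, 2, 3} : Finset (Fin 4)) \ {2, 3} = {0, 1} := by decide
  have k1 : sgn {0, 1} {2, 3} = 1 := by decide
  have k2 : sgn {0, 2} {1, 3} = -1 := by decide
  have k3 : sgn {0, 3} {1, 2} = 1 := by decide
  have k4 : sgn {1, 2} {0, 3} = 1 := by decide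
  have k5 : sgn {1, 3} {0, 2} = -1 := by decide
  have k6 : sgn {2, 3} {0, 1} = 1 := by decide
  rw [h1, h2, h3, h4, h5, h6, k1, k2, k3, k4, k5, k6]
  simp only [one_smul, neg_one_smul]
  abel

theorem rep_one_pair {y : L A} (hy : IsDeg 1 y) (ν : ExtW A) {a b : Fin 4} (hab : a < b) :
    rep y ν {a, b} = (y {a}).act ν {b} - (y {b}).act ν {a} := by
  have h1 : ({a, b} : Finset (Fin 4)).powersetCard 1 = {{a}, {b}} ∧
      ({a} : Finset (Fin 4)) ≠ {b} ∧
      ({a, b} : Finset (Fin 4)) \ {a} = {b} ∧ ({a, b} : Finset (Fin 4)) \ {b} = {a} ∧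
      sgn {a} {b} = 1 ∧ sgn {b} {a} = -1 := by
    revert a b; decide
  obtain ⟨h1, h2, h3, h4, h5, h6⟩ := h1
  rw [rep_apply_of_isDeg hy, h1, Finset.sum_pair h2, h3, h4, h5, h6,
    one_smul, neg_one_smul]
  abel

theorem rep_one_triple {y : L A} (hy : IsDeg 1 y) (ν : ExtW A) {a b c : Fin 4} (hab : a < b)
    (hbc : b < c) : rep y ν {a, b, c} =
      (y {a}).act ν {b, c} - (y {b}).act ν {a, c} + (y {c}).act ν {a, b} := by
  have h1 : ({a, b, c} : Finset (Fin 4)).powersetCard 1 = {{a}, {b}, {c}} ∧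
      ({b} : Finset (Fin 4)) ≠ {c} ∧
      ({a} : Finset (Fin 4)) ∉ ({{b}, {c}} : Finset (Finset (Fin 4))) ∧
      ({a, b, c} : Finset (Fin 4)) \ {a} = {b, c} ∧ ({a, b, c} : Finset (Fin 4)) \ {b} = {a, c} ∧
      ({a, b, c} : Finset (Fin 4)) \ {c} = {a, b} ∧ sgn {a} {b, c} = 1 ∧ sgn {b} {a, c} = -1 ∧
      sgn {c} {a, b} = 1 := by
    revert a b c; decide
  obtain ⟨h1, h2, h3, h4, h5, h6, h7, h8, h9⟩ := h1
  rw [rep_apply_of_isDeg hy, h1, Finset.sum_insert h3, Finset.sum_pair h2, h4, h5, h6, h7, h8, h9,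
    one_smul, one_smul, neg_one_smul]
  abel

/-- An element of F_{◁0} is supported on subsets of the two-element complement of T, hence has no
component of degree three, and a degree one element could reach the top degree only from there. -/
theorem rep_one_univ {y : L A} {T : Finset (Fin 4)} (hT : T.card = 2) (hy : IsDeg 1 y)
    {ν : ExtW A} (hν : ν ∈ FExt T 0) : rep y ν Finset.univ = 0 := by
  rw [rep_apply_of_isDeg hy]
  refine Finset.sum_eq_zero fun J hJ => ?_
  have hJc := (Finset.mem_powersetCard.1 hJ).2
  have hN : (Finset.univ \ J).card = 3 := by
    rw [Finset.card_sdiff_of_subset (Finset.subset_univ J), hJc]; rfl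
  have h3 (N : Finset (Fin 4)) (hN : N.card = 3) : ν N = 0 := by
    refine hν N fun h => ?_
    have h1 := Finset.card_union_add_card_inter N T
    have h2 : (N ∪ T).card ≤ 4 := Finset.card_le_univ _
    omega
  rw [act_apply, h3 _ hN, map_zero, Finset.sum_eq_zero fun i hi => Finset.sum_eq_zero fun j _ => ?_,
    add_zero, smul_zero]
  by_cases hj : j ∈ (Finset.univ \ J).erase i
  · rw [sgn_eq_zero (by simpa using hj), zero_mul, zero_smul]
  · rw [h3, mul_zero, smul_zero]
    rw [Finset.card_insert_of_notMem hj, Finset.card_erase_of_mem hi, hN]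

/-- The representations differ by the terms trace(y_J) ν_{M \ J}. As ν vanishes on every set that
meets T, only J ⊇ T contributes; the degree bound leaves J = T, whose trace is zero by assumption.
-/
theorem repOmega_eq_rep {T : Finset (Fin 4)} {n : ℕ} (hn : n ≤ T.card) {y : L A} (hy : IsDeg n y)
    (htr : (y T).mat.trace = 0) {ν : ExtW A} (hν : ν ∈ FExt T 0) {M : Finset (Fin 4)}
    (hM : T ⊆ M) : repOmega y ν M = rep y ν M := by
  rw [rep_apply, repOmega_apply]
  refine Finset.sum_congr rfl fun J hJ => ?_
  suffices h : (y J).mat.trace * ν (M \ J) = 0 by rw [h, add_zero]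
  by_cases hTJ : T ⊆ J
  · by_cases hJT : J = T
    · rw [hJT, htr, zero_mul]
    · rw [hy J, mat_zero, Matrix.trace_zero, zero_mul]
      have := Finset.card_lt_card (lt_of_le_of_ne hTJ (Ne.symm hJT))
      omega
  · rw [hν, mul_zero]
    rintro ⟨h, -⟩
    refine hTJ fun t ht => ?_
    by_contra htJ
    have : t ∈ (M \ J) ∩ T := by simp [hM ht, htJ, ht]
    simp [Finset.card_eq_zero.1 (Nat.le_zero.1 h)] at this

theorem W1_card (i : Fin 3) : (W1 i).card = 2 := by revert i; decide

theorem FExt_zero_apply {T J : Finset (Fin 4)} {ν : ExtW A} (hν : ν ∈ FExt T 0)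
    (h : ¬ Disjoint J T) : ν J = 0 :=
  hν J fun h' => h (Finset.disjoint_iff_inter_eq_empty.2 (Finset.card_eq_zero.1
    (Nat.le_zero.1 h'.1)))

theorem superset_W1 : ∀ (i : Fin 3) (M : Finset (Fin 4)), W1 i ⊆ M →
    M = W1 i ∨ M = insert 0 (W1 i) ∨ M = insert i.succ (W1 i) ∨ M = {0, 1, 2, 3} := by
  decide

theorem rep_theta_pair (y : L A) (j : Fin 4) {a b : Fin 4} (hab : a < b) :
    rep y (theta {j}) {a, b} = (y {a}).mat b j - (y {b}).mat a j := by
  have h : ({a, b} : Finset (Fin 4)).erase a = {b} ∧ ({a, b} : Finset (Fin 4)).erase b = {a} ∧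
      sgn {a} {b} = 1 ∧ sgn {b} {a} = -1 := by
    revert a b; decide
  obtain ⟨h1, h2, h3, h4⟩ := h
  rw [rep_theta_singleton, Finset.sum_pair hab.ne, h1, h2, h3, h4, one_smul, neg_one_smul]
  abel

theorem rep_theta_triple (y : L A) (j : Fin 4) {a b c : Fin 4} (hab : a < b) (hbc : b < c) :
    rep y (theta {j}) {a, b, c} =
      (y {b, c}).mat a j - (y {a, c}).mat b j + (y {a, b}).mat c j := by
  have h : ({a, b, c} : Finset (Fin 4)).erase a = {b, c} ∧
      ({a, b, c} : Finset (Fin 4)).erase b = {a, c} ∧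
      ({a, b, c} : Finset (Fin 4)).erase c = {a, b} ∧
      sgn {b, c} {a} = 1 ∧ sgn {a, c} {b} = -1 ∧ sgn {a, b} {c} = 1 ∧
      a ∉ ({b, c} : Finset (Fin 4)) := by
    revert a b c; decide
  obtain ⟨h1, h2, h3, h4, h5, h6, h7⟩ := h
  rw [rep_theta_singleton, Finset.sum_insert h7, Finset.sum_pair hbc.ne, h1, h2, h3, h4, h5, h6,
    one_smul, one_smul, neg_one_smul]
  abel

/-- One covector of x cannot supply both elements of W_1, so derivatives of functions do not reach
W_1-degree two. The part of x raising ∧W_0 by two W_1-degrees is thus A-linear and a graded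
derivation, determined by its values on the generators θ_0 and θ_i of W_0. -/
theorem mem_FTriL_zero_of_deg_one {i : Fin 3} {x : L A} (hx : IsDeg 1 x)
    (hp : x ∈ parityL (W1 i) 0) (h0 : rep x (theta {0}) (W1 i) = 0)
    (h1 : rep x (theta {i.succ}) (W1 i) = 0) : x ∈ FTriL (W1 i) 0 := by
  refine mem_FTriL_of_parity (W1_card i) hp fun _ ν hν M hM => ?_
  have htr : (x (W1 i)).mat.trace = 0 := by
    rw [hx _ (by simp [W1_card]), mat_zero, Matrix.trace_zero]
  rw [repOmega_eq_rep (by simp [W1_card]) hx htr hν hM, and_self]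
  have key (J : Finset (Fin 4)) (h : ¬ Disjoint J (W1 i)) : ν J = 0 := FExt_zero_apply hν h
  have hu : rep x ν {0, 1, 2, 3} = 0 := rep_one_univ (W1_card i) hx hν
  have c10 : ({1, 0} : Finset (Fin 4)) = {0, 1} := by decide
  have c20 : ({2, 0} : Finset (Fin 4)) = {0, 2} := by decide
  have c30 : ({3, 0} : Finset (Fin 4)) = {0, 3} := by decide
  fin_cases i
  · have e0 : W1 0 = {2, 3} := by decide
    have e1 : insert 0 (W1 0) = {0, 2, 3} := by decide
    have e2 : insert (Fin.succ 0) (W1 0) = {1, 2, 3} := by decide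
    change rep x (theta {0}) (W1 0) = 0 at h0
    change rep x (theta {1}) (W1 0) = 0 at h1
    rw [e0, rep_theta_pair _ _ (by decide)] at h0 h1
    have hM' := superset_W1 0 M hM
    rw [e1, e2, e0] at hM'
    rcases hM' with rfl | rfl | rfl | rfl
    · rw [rep_one_pair hx ν (by decide), act_singleton, act_singleton]
      simp (disch := decide) only [Fin.sum_univ_four, key, map_zero]
      linear_combination ν {0} * h0 + ν {1} * h1
    · rw [rep_one_triple hx ν (by decide) (by decide), act_pair _ _ (by decide),
        act_pair _ _ (by decide), act_pair _ _ (by decide)]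
      simp (disch := decide) only [Fin.sum_univ_four, key, c10, c20, c30]
      simp [sgn_singleton]
      -- The component on {0, 2, 3} of the image of θ_0θ_1 keeps θ_0 and replaces θ_1; on {1, 2, 3}
      -- the roles are exchanged. The other two decompositions follow the same pattern.
      linear_combination -ν {0, 1} * h1
    · rw [rep_one_triple hx ν (by decide) (by decide), act_pair _ _ (by decide),
        act_pair _ _ (by decide), act_pair _ _ (by decide)]
      simp (disch := decide) only [Fin.sum_univ_four, key, c10, c20, c30]
      simp [sgn_singleton]
      linear_combination ν {0, 1} * h0
    · exact hu
  · have e0 : W1 1 = {1, 3} := by decide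
    have e1 : insert 0 (W1 1) = {0, 1, 3} := by decide
    have e2 : insert (Fin.succ 1) (W1 1) = {1, 2, 3} := by decide
    change rep x (theta {0}) (W1 1) = 0 at h0
    change rep x (theta {2}) (W1 1) = 0 at h1
    rw [e0, rep_theta_pair _ _ (by decide)] at h0 h1
    have hM' := superset_W1 1 M hM
    rw [e1, e2, e0] at hM'
    rcases hM' with rfl | rfl | rfl | rfl
    · rw [rep_one_pair hx ν (by decide), act_singleton, act_singleton]
      simp (disch := decide) only [Fin.sum_univ_four, key, map_zero]
      linear_combination ν {0} * h0 + ν {2} * h1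
    · rw [rep_one_triple hx ν (by decide) (by decide), act_pair _ _ (by decide),
        act_pair _ _ (by decide), act_pair _ _ (by decide)]
      simp (disch := decide) only [Fin.sum_univ_four, key, c10, c20, c30]
      simp [sgn_singleton]
      linear_combination -ν {0, 2} * h1
    · rw [rep_one_triple hx ν (by decide) (by decide), act_pair _ _ (by decide),
        act_pair _ _ (by decide), act_pair _ _ (by decide)]
      simp (disch := decide) only [Fin.sum_univ_four, key, c10, c20, c30]
      simp [sgn_singleton]
      linear_combination -ν {0, 2} * h0
    · exact hu
  · have e0 : W1 2 = {1, 2} := by decide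
    have e1 : insert 0 (W1 2) = {0, 1, 2} := by decide
    have e2 : insert (Fin.succ 2) (W1 2) = {1, 2, 3} := by decide
    change rep x (theta {0}) (W1 2) = 0 at h0
    change rep x (theta {3}) (W1 2) = 0 at h1
    rw [e0, rep_theta_pair _ _ (by decide)] at h0 h1
    have hM' := superset_W1 2 M hM
    rw [e1, e2, e0] at hM'
    rcases hM' with rfl | rfl | rfl | rfl
    · rw [rep_one_pair hx ν (by decide), act_singleton, act_singleton]
      simp (disch := decide) only [Fin.sum_univ_four, key, map_zero]
      linear_combination ν {0} * h0 + ν {3} * h1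
    · rw [rep_one_triple hx ν (by decide) (by decide), act_pair _ _ (by decide),
        act_pair _ _ (by decide), act_pair _ _ (by decide)]
      simp (disch := decide) only [Fin.sum_univ_four, key, c10, c20, c30]
      simp [sgn_singleton]
      linear_combination -ν {0, 3} * h1
    · rw [rep_one_triple hx ν (by decide) (by decide), act_pair _ _ (by decide),
        act_pair _ _ (by decide), act_pair _ _ (by decide)]
      simp (disch := decide) only [Fin.sum_univ_four, key, c10, c20, c30]
      simp [sgn_singleton]
      linear_combination ν {0, 3} * h0
    · exact hu

theorem act_empty (δ : CDer A) (ν : ExtW A) : δ.act ν ∅ = δ.der (ν ∅) := by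
  rw [act_apply, Finset.sum_empty, add_zero]

theorem rep_two_self {y : L A} (hy : IsDeg 2 y) (ν : ExtW A) {T : Finset (Fin 4)}
    (hT : T.card = 2) : rep y ν T = (y T).der (ν ∅) := by
  have h : T.powersetCard 2 = {T} := by rw [← hT]; exact Finset.powersetCard_self T
  rw [rep_apply_of_isDeg hy, h, Finset.sum_singleton, Finset.sdiff_self, sgn_empty_right, one_smul,
    act_empty]

/-- In degree two the covectors of y can exhaust W_1, and then the coefficient on W_1 also
differentiates functions. Its derivation and trace are assumed to vanish: the first makes the
relevant part of y A-linear, the second makes both representations agree. What remains is determined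
by θ_0 and θ_i, with components on W_1 enlarged by θ_0 or θ_i. -/
theorem mem_FTriL_zero_of_deg_two {i : Fin 3} {y : L A} (hy : IsDeg 2 y)
    (hp : y ∈ parityL (W1 i) 0) (hd : (y (W1 i)).der = 0) (htr : (y (W1 i)).mat.trace = 0)
    (h : ∀ j ∈ ({0, i.succ} : Finset (Fin 4)), ∀ k ∈ ({0, i.succ} : Finset (Fin 4)),
      rep y (theta {j}) (insert k (W1 i)) = 0) : y ∈ FTriL (W1 i) 0 := by
  refine mem_FTriL_of_parity (W1_card i) hp fun _ ν hν M hM => ?_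
  rw [repOmega_eq_rep (by simp [W1_card]) hy htr hν hM, and_self]
  have key (J : Finset (Fin 4)) (h : ¬ Disjoint J (W1 i)) : ν J = 0 := FExt_zero_apply hν h
  have h00 := h 0 (by simp) 0 (by simp)
  have h01 := h 0 (by simp) i.succ (by simp)
  have h10 := h i.succ (by simp) 0 (by simp)
  have h11 := h i.succ (by simp) i.succ (by simp)
  have hT : rep y ν (W1 i) = 0 := by rw [rep_two_self hy ν (W1_card i), hd]; rfl
  have hM' := superset_W1 i M hM
  have c10 : ({1, 0} : Finset (Fin 4)) = {0, 1} := by decide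
  have c20 : ({2, 0} : Finset (Fin 4)) = {0, 2} := by decide
  have c30 : ({3, 0} : Finset (Fin 4)) = {0, 3} := by decide
  clear hM h hp hν htr
  fin_cases i
  · have e0 : W1 0 = {2, 3} := by decide
    have e1 : insert 0 (W1 0) = {0, 2, 3} := by decide
    have e2 : insert (Fin.succ 0) (W1 0) = {1, 2, 3} := by decide
    change (y (W1 0)).der = 0 at hd
    change rep y (theta {0}) (insert 0 (W1 0)) = 0 at h00
    change rep y (theta {0}) (insert (Fin.succ 0) (W1 0)) = 0 at h01
    change rep y (theta {1}) (insert 0 (W1 0)) = 0 at h10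
    change rep y (theta {1}) (insert (Fin.succ 0) (W1 0)) = 0 at h11
    change M = W1 0 ∨ M = insert 0 (W1 0) ∨ M = insert (Fin.succ 0) (W1 0) ∨ _ at hM'
    rw [e0] at hd
    rw [e1, rep_theta_triple _ _ (by decide) (by decide)] at h00 h10
    rw [e2, rep_theta_triple _ _ (by decide) (by decide)] at h01 h11
    rw [e1, e2] at hM'
    rcases hM' with rfl | rfl | rfl | rfl
    · exact hT
    · rw [rep_two_triple hy ν (by decide) (by decide)]
      simp (disch := decide) only [act_singleton, hd, Fin.sum_univ_four, key, map_zero]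
      simp
      linear_combination ν {0} * h00 + ν {1} * h10
    · rw [rep_two_triple hy ν (by decide) (by decide)]
      simp (disch := decide) only [act_singleton, hd, Fin.sum_univ_four, key, map_zero]
      simp
      linear_combination ν {0} * h01 + ν {1} * h11
    · rw [rep_two_univ hy ν]
      simp (disch := decide) only [act_pair, hd, Fin.sum_univ_four, key, c10, c20, c30, map_zero]
      simp [sgn_singleton]
      -- In top degree θ_0θ_1 acquires one term from θ_0 and one from θ_1, which keep the respective
      -- covector and multiply by θ_2θ_3.
      linear_combination ν {0, 1} * (h00 + h11)
  · have e0 : W1 1 = {1, 3} := by decide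
    have e1 : insert 0 (W1 1) = {0, 1, 3} := by decide
    have e2 : insert (Fin.succ 1) (W1 1) = {1, 2, 3} := by decide
    change (y (W1 1)).der = 0 at hd
    change rep y (theta {0}) (insert 0 (W1 1)) = 0 at h00
    change rep y (theta {0}) (insert (Fin.succ 1) (W1 1)) = 0 at h01
    change rep y (theta {2}) (insert 0 (W1 1)) = 0 at h10
    change rep y (theta {2}) (insert (Fin.succ 1) (W1 1)) = 0 at h11
    change M = W1 1 ∨ M = insert 0 (W1 1) ∨ M = insert (Fin.succ 1) (W1 1) ∨ _ at hM'
    rw [e0] at hd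
    rw [e1, rep_theta_triple _ _ (by decide) (by decide)] at h00 h10
    rw [e2, rep_theta_triple _ _ (by decide) (by decide)] at h01 h11
    rw [e1, e2] at hM'
    rcases hM' with rfl | rfl | rfl | rfl
    · exact hT
    · rw [rep_two_triple hy ν (by decide) (by decide)]
      simp (disch := decide) only [act_singleton, hd, Fin.sum_univ_four, key, map_zero]
      simp
      linear_combination ν {0} * h00 + ν {2} * h10
    · rw [rep_two_triple hy ν (by decide) (by decide)]
      simp (disch := decide) only [act_singleton, hd, Fin.sum_univ_four, key, map_zero]
      simp
      linear_combination ν {0} * h01 + ν {2} * h11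
    · rw [rep_two_univ hy ν]
      simp (disch := decide) only [act_pair, hd, Fin.sum_univ_four, key, c10, c20, c30, map_zero]
      simp [sgn_singleton]
      -- Moving θ_2 into place gives θ_0θ_1θ_3θ_2 = -θ_0θ_1θ_2θ_3 for the term from θ_0, whereas the
      -- term from θ_2 needs no transposition; hence the relative sign.
      linear_combination ν {0, 2} * (h11 - h00)
  · have e0 : W1 2 = {1, 2} := by decide
    have e1 : insert 0 (W1 2) = {0, 1, 2} := by decide
    have e2 : insert (Fin.succ 2) (W1 2) = {1, 2, 3} := by decide
    change (y (W1 2)).der = 0 at hd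
    change rep y (theta {0}) (insert 0 (W1 2)) = 0 at h00
    change rep y (theta {0}) (insert (Fin.succ 2) (W1 2)) = 0 at h01
    change rep y (theta {3}) (insert 0 (W1 2)) = 0 at h10
    change rep y (theta {3}) (insert (Fin.succ 2) (W1 2)) = 0 at h11
    change M = W1 2 ∨ M = insert 0 (W1 2) ∨ M = insert (Fin.succ 2) (W1 2) ∨ _ at hM'
    rw [e0] at hd
    rw [e1, rep_theta_triple _ _ (by decide) (by decide)] at h00 h10
    rw [e2, rep_theta_triple _ _ (by decide) (by decide)] at h01 h11
    rw [e1, e2] at hM'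
    rcases hM' with rfl | rfl | rfl | rfl
    · exact hT
    · rw [rep_two_triple hy ν (by decide) (by decide)]
      simp (disch := decide) only [act_singleton, hd, Fin.sum_univ_four, key, map_zero]
      simp
      linear_combination ν {0} * h00 + ν {3} * h10
    · rw [rep_two_triple hy ν (by decide) (by decide)]
      simp (disch := decide) only [act_singleton, hd, Fin.sum_univ_four, key, map_zero]
      simp
      linear_combination ν {0} * h01 + ν {3} * h11
    · rw [rep_two_univ hy ν]
      simp (disch := decide) only [act_pair, hd, Fin.sum_univ_four, key, c10, c20, c30, map_zero]
      simp [sgn_singleton]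
      linear_combination ν {0, 3} * (h00 + h11)

end Criteria
end BKL
end

/-! ### Joint parity sectors, the three-index filtration, and the ideal of the symbols. -/

noncomputable section
namespace BKL
section Sectors
variable {A : Type*} [CommRing A] [Algebra ℝ A]

/-- The parities of `θ_a` and of `θ_b` add up to that of `θ_c`, for the three decompositions. -/
def Compat (c a b : Fin 4) : Prop :=
  ∀ n, (({a} ∩ W1 n).card + ({b} ∩ W1 n).card + ({c} ∩ W1 n).card) % 2 = 0

instance (c a b : Fin 4) : Decidable (Compat c a b) := by unfold Compat; infer_instance

/-- The elements of `L` that have the parities of `θ_c`, for the three decompositions. -/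
def InSector (c : Fin 4) (y : L A) : Prop := ∀ n, y ∈ parityL (W1 n) ({c} ∩ W1 n).card

theorem not_compat {c a b : Fin 4} (h : ¬ Compat c a b) :
    ∃ n, (({a} ∩ W1 n).card + ({b} ∩ W1 n).card + ({c} ∩ W1 n).card) % 2 = 1 := by
  simp only [Compat, not_forall] at h
  obtain ⟨n, hn⟩ := h
  exact ⟨n, by omega⟩

theorem InSector.der_eq_zero {c : Fin 4} {y : L A} (hy : InSector c y) {a b : Fin 4} (hab : a ≠ b)
    (h : ¬ Compat c a b) : (y {a, b}).der = 0 := by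
  obtain ⟨n, hn⟩ := not_compat h
  refine (mem_parCDer.1 (mem_parityL.1 (hy n) {a, b})).1 ?_
  rw [card_insert_inter (by simpa using hab)]
  omega

theorem InSector.trace_eq_zero {c : Fin 4} {y : L A} (hy : InSector c y) {a b : Fin 4}
    (hab : a ≠ b) (h : ¬ Compat c a b) : (y {a, b}).mat.trace = 0 := by
  obtain ⟨n, hn⟩ := not_compat h
  refine trace_of_odd (mem_parityL.1 (hy n) {a, b}) ?_
  rw [card_insert_inter (by simpa using hab)]
  omega

theorem ricFun_of_parity {T : Finset (Fin 4)} {p : ℕ} {y : L A} (hy : y ∈ parityL T p)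
    {b i : Fin 4} (h : (({b} ∩ T).card + ({i} ∩ T).card + p) % 2 = 1) : ricFun b i y = 0 := by
  change ∑ a : Fin 4, sgn {a} {b} • (y {a, b}).mat i a = 0
  refine Finset.sum_eq_zero fun a _ => ?_
  by_cases hab : a = b
  · rw [sgn_eq_zero (by simp [hab]), zero_smul]
  · rw [(mem_parCDer.1 (mem_parityL.1 hy {a, b})).2 i a, smul_zero]
    rw [card_insert_inter (by simpa using hab)]
    omega

theorem repFun_of_parity {T : Finset (Fin 4)} {p : ℕ} {y : L A} (hy : y ∈ parityL T p)
    {j : Fin 4} {M : Finset (Fin 4)} (h : (({j} ∩ T).card + (M ∩ T).card + p) % 2 = 1) :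
    rep y (theta {j}) M = 0 := by
  refine (rep_parity hy (q := ({j} ∩ T).card) (fun J hJ => ?_) M (by omega)).1
  refine Pi.single_eq_of_ne ?_ _
  rintro rfl
  exact hJ rfl

theorem card_erase_inter_W1 (m : Fin 4) (n : Fin 3) :
    (Finset.univ.erase m ∩ W1 n).card + ({m} ∩ W1 n).card = 2 := by
  revert m n; decide

theorem InSector.rep_eq_zero {c : Fin 4} {y : L A} (hy : InSector c y) {j m : Fin 4}
    (h : ¬ Compat c j m) : rep y (theta {j}) (Finset.univ.erase m) = 0 := by
  obtain ⟨n, hn⟩ := not_compat h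
  have := card_erase_inter_W1 m n
  exact repFun_of_parity (hy n) (by omega)

/-- Derivations, traces, Ricci components and Bianchi components each have a definite parity for
every decomposition. Those incompatible with the sector vanish, so the defining conditions of a Weyl
tensor reduce to the compatible index pairs. -/
theorem isWeyl_of_inSector {c : Fin 4} {y : L A} (hd : IsDeg 2 y) (hy : InSector c y)
    (hder : ∀ a b, a < b → Compat c a b → (y {a, b}).der = 0)
    (htr : ∀ a b, a < b → Compat c a b → (y {a, b}).mat.trace = 0)
    (hric : ∀ b i, Compat c b i → ricFun b i y = 0)
    (hrep : ∀ j m, Compat c j m → rep y (theta {j}) (Finset.univ.erase m) = 0) : IsWeyl y where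
  deg := hd
  der J := by
    by_cases hJ : J.card = 2
    · obtain ⟨a, b, hab, rfl⟩ := Finset.card_eq_two.1 hJ
      by_cases h : Compat c a b
      · rcases hab.lt_or_gt with h' | h'
        · exact hder a b h' h
        · rw [Finset.pair_comm]
          refine hder b a h' fun n => ?_
          rw [add_comm ({b} ∩ W1 n).card]
          exact h n
      · exact hy.der_eq_zero hab h
    · rw [hd J hJ]; rfl
  so J := by
    by_cases hJ : J.card = 2
    · obtain ⟨a, b, hab, rfl⟩ := Finset.card_eq_two.1 hJ
      by_cases h : Compat c a b
      · rcases hab.lt_or_gt with h' | h'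
        · exact htr a b h' h
        · rw [Finset.pair_comm]
          refine htr b a h' fun n => ?_
          rw [add_comm ({b} ∩ W1 n).card]
          exact h n
      · exact hy.trace_eq_zero hab h
    · rw [hd J hJ]
      simp
  bianchi j := by
    funext M
    by_cases hM : M.card = 3
    · obtain ⟨m, rfl⟩ : ∃ m, M = Finset.univ.erase m := by
        revert M; decide
      by_cases h : Compat c j m
      · exact hrep j m h
      · exact hy.rep_eq_zero h
    · rw [rep_theta_singleton, Finset.sum_eq_zero fun k hk => ?_]
      · rfl
      · rw [hd (M.erase k), mat_zero, Matrix.zero_apply, smul_zero]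
        rw [Finset.card_erase_of_mem hk]
        have := Finset.card_pos.2 ⟨k, hk⟩
        omega
  ricci b i := by
    by_cases h : Compat c b i
    · exact hric b i h
    · obtain ⟨n, hn⟩ := not_compat h
      exact ricFun_of_parity (hy n) hn

/-- One of the indices p, p - 1 is even. For p ≥ 2 it is nonzero, and parity alone gives membership;
for p = 0 or 1 it is 0, and membership in F_{◁0} is needed. -/
theorem mem_F1_of_even {T : Finset (Fin 4)} (hT : T.card = 2) {y : L A} (hy : y ∈ parityL T 0)
    {p : ℕ} (h : y ∈ FTriL T 0 ∨ 2 ≤ p) : (weylIdeal A).mkQ y ∈ F1 (A := A) T p := by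
  match p with
  | 0 => exact Submodule.mem_map_of_mem (h.resolve_right (by omega))
  | 1 =>
    exact Submodule.mem_sup_right (Submodule.mem_map_of_mem (h.resolve_right (by omega)))
  | p + 2 =>
    have key (n : ℕ) (hn : n % 2 = 0) (h0 : n ≠ 0) : (weylIdeal A).mkQ y ∈ FTriE (A := A) T n := by
      refine Submodule.mem_map_of_mem (parity_le_FTriL hT h0 ?_)
      rw [mem_parityL] at hy ⊢
      intro J
      rw [parCDer_congr (n := (J ∩ T).card + 0) (by omega)]
      exact hy J
    rcases Nat.mod_two_eq_zero_or_one p with hp | hp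
    · exact Submodule.mem_sup_left (key _ (by omega) (by omega))
    · exact Submodule.mem_sup_right (key _ (by omega) (by omega))

theorem mem_F1_of_odd {T : Finset (Fin 4)} (hT : T.card = 2) {y : L A} (hy : y ∈ parityL T 1)
    {p : ℕ} (h : p ≠ 0) : (weylIdeal A).mkQ y ∈ F1 (A := A) T p := by
  have key (n : ℕ) (hn : n % 2 = 1) : (weylIdeal A).mkQ y ∈ FTriE (A := A) T n := by
    refine Submodule.mem_map_of_mem (parity_le_FTriL hT (by omega) ?_)
    rw [mem_parityL] at hy ⊢
    intro J
    rw [parCDer_congr (n := (J ∩ T).card + 1) (by omega)]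
    exact hy J
  match p with
  | p + 1 =>
    rcases Nat.mod_two_eq_zero_or_one p with hp | hp
    · exact Submodule.mem_sup_left (key _ (by omega))
    · exact Submodule.mem_sup_right (key _ hp)

theorem InSector.even {c : Fin 4} {y : L A} (hy : InSector c y) {n : Fin 3} (h : c ∉ W1 n) :
    y ∈ parityL (W1 n) 0 := by
  have := hy n
  rwa [Finset.singleton_inter_of_notMem h, Finset.card_empty] at this

theorem InSector.odd {c : Fin 4} {y : L A} (hy : InSector c y) {n : Fin 3} (h : c ∈ W1 n) :
    y ∈ parityL (W1 n) 1 := by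
  have := hy n
  rwa [Finset.singleton_inter_of_mem h, Finset.card_singleton] at this

theorem insert_W1 (n : Fin 3) : insert 0 (W1 n) = Finset.univ.erase n.succ ∧
    insert n.succ (W1 n) = Finset.univ.erase 0 := by
  revert n; decide

theorem W1_eq_pair (n : Fin 3) : ∃ a b, a ≠ b ∧ W1 n = {a, b} ∧ ¬ Compat 0 a b := by
  revert n; decide

theorem succ_notMem_W1 (n : Fin 3) : n.succ ∉ W1 n := by
  revert n; decide

/-- In the sector of θ_0 two distinct indices are never compatible. The coefficient on each W_1
therefore has neither derivation nor trace, and only the diagonal Bianchi components survive. -/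
theorem InSector.mem_F3_zero {y : L A} (hd : IsDeg 2 y) (hy : InSector 0 y)
    (hrep : ∀ j, rep y (theta {j}) (Finset.univ.erase j) = 0) (α : Fin 3 → ℕ) :
    (weylIdeal A).mkQ y ∈ F3 (A := A) α := by
  rw [F3, Submodule.mem_iInf]
  intro n
  have hp := hy.even (n := n) (by revert n; decide)
  refine mem_F1_of_even (W1_card n) hp (Or.inl ?_)
  obtain ⟨a, b, hab, hW, hc⟩ := W1_eq_pair n
  refine mem_FTriL_zero_of_deg_two hd hp ?_ ?_ fun j hj k hk => ?_
  · rw [hW]; exact hy.der_eq_zero hab hc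
  · rw [hW]; exact hy.trace_eq_zero hab hc
  · have hne (j m : Fin 4) (h : j ≠ m) : ¬ Compat 0 j m := by revert j m; decide
    obtain rfl | rfl : k = 0 ∨ k = n.succ := by simpa using hk
    · rw [(insert_W1 n).1]
      by_cases h : j = n.succ
      · rw [h]; exact hrep _
      · exact hy.rep_eq_zero (hne _ _ h)
    · rw [(insert_W1 n).2]
      by_cases h : j = 0
      · rw [h]; exact hrep _
      · exact hy.rep_eq_zero (hne _ _ h)

/-- The sector of θ_i is odd for the two other decompositions, where any nonzero index suffices. For
the i-th decomposition it is even and the degree two criterion applies; two of its four Bianchi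
components already vanish by parity. -/
theorem InSector.mem_F3_succ {i : Fin 3} {y : L A} (hd : IsDeg 2 y) (hy : InSector i.succ y)
    (hder : (y (W1 i)).der = 0) (htr : (y (W1 i)).mat.trace = 0)
    (h0 : rep y (theta {0}) (insert 0 (W1 i)) = 0)
    (h1 : rep y (theta {i.succ}) (insert i.succ (W1 i)) = 0) {α : Fin 3 → ℕ}
    (hα : ∀ n, n ≠ i → α n ≠ 0) : (weylIdeal A).mkQ y ∈ F3 (A := A) α := by
  rw [F3, Submodule.mem_iInf]
  intro n
  by_cases hn : n = i
  · subst hn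
    have hp := hy.even (succ_notMem_W1 n)
    refine mem_F1_of_even (W1_card n) hp (Or.inl ?_)
    have hc : ¬ Compat n.succ n.succ n.succ ∧ ¬ Compat n.succ 0 0 := by
      clear * -
      revert n; decide
    refine mem_FTriL_zero_of_deg_two hd hp hder htr fun j hj k hk => ?_
    obtain rfl | rfl : k = 0 ∨ k = n.succ := by simpa using hk
    · obtain rfl | rfl : j = 0 ∨ j = n.succ := by simpa using hj
      · exact h0
      · rw [(insert_W1 n).1]
        exact hy.rep_eq_zero hc.1
    · obtain rfl | rfl : j = 0 ∨ j = n.succ := by simpa using hj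
      · rw [(insert_W1 n).2]
        exact hy.rep_eq_zero hc.2
      · exact h1
  · refine mem_F1_of_odd (W1_card n) (hy.odd ?_) (hα n hn)
    clear * - hn
    revert n i; decide

theorem InSector.mem_F3_deg_one {i : Fin 3} {x : L A} (hd : IsDeg 1 x) (hx : InSector i.succ x)
    (h0 : rep x (theta {0}) (W1 i) = 0) {α : Fin 3 → ℕ}
    (hα : ∀ n, n ≠ i → α n ≠ 0) : (weylIdeal A).mkQ x ∈ F3 (A := A) α := by
  rw [F3, Submodule.mem_iInf]
  intro n
  by_cases hn : n = i
  · subst hn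
    have hp := hx.even (succ_notMem_W1 n)
    refine mem_F1_of_even (W1_card n) hp (Or.inl ?_)
    refine mem_FTriL_zero_of_deg_one hd hp h0 ?_
    obtain ⟨m, hm⟩ : ∃ m, (({n.succ} ∩ W1 m).card + (W1 n ∩ W1 m).card +
        ({n.succ} ∩ W1 m).card) % 2 = 1 := by
      clear * -
      revert n; decide
    exact repFun_of_parity (hx m) hm
  · refine mem_F1_of_odd (W1_card n) (hx.odd ?_) (hα n hn)
    clear * - hn
    revert n i; decide

/-- The alternative 2 ≤ α_n accommodates the rotation terms at s_i², whose action on θ_i need not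
respect F_{◁0} of the i-th decomposition. -/
theorem InSector.mem_F3_deg_one_zero {x : L A} (hd : IsDeg 1 x) (hx : InSector 0 x)
    {α : Fin 3 → ℕ} (h : ∀ n, 2 ≤ α n ∨ rep x (theta {n.succ}) (W1 n) = 0) :
    (weylIdeal A).mkQ x ∈ F3 (A := A) α := by
  rw [F3, Submodule.mem_iInf]
  intro n
  have hp := hx.even (n := n) (by revert n; decide)
  refine mem_F1_of_even (W1_card n) hp ?_
  refine (h n).symm.imp (fun h => ?_) id
  refine mem_FTriL_zero_of_deg_one hd hp ?_ h
  obtain ⟨m, hm⟩ : ∃ m, (({0} ∩ W1 m).card + (W1 n ∩ W1 m).card +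
      ({0} ∩ W1 m).card) % 2 = 1 := by
    clear * -
    revert n; decide
  exact repFun_of_parity (hx m) hm

/-! ### The ideal `(s_1, s_2, s_3)` -/

/-- This coefficientwise consequence is all that necessity uses. For sufficiency it is enough to
place single monomials in the ideal, by `toE_mon_mem_sIdeal`. -/
theorem sIdeal_apply {y : Ser (E A)} (hy : y ∈ sIdeal A) (α : Fin 3 → ℕ) :
    y α ∈ ⨆ i, ⨆ (_ : α i ≠ 0), F3 (A := A) (α - Pi.single i 1) := by
  have h : sIdeal A ≤ (⨆ i, ⨆ (_ : α i ≠ 0), F3 (A := A) (α - Pi.single i 1)).comap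
      (LinearMap.proj (R := A) (φ := fun _ : Fin 3 → ℕ => E A) α) := by
    refine iSup_le fun i => ?_
    rintro _ ⟨z, hz, rfl⟩
    change (if α i = 0 then 0 else z (α - Pi.single i 1)) ∈
      (⨆ i, ⨆ (_ : α i ≠ 0), F3 (A := A) (α - Pi.single i 1))
    split_ifs with hi
    · exact Submodule.zero_mem _
    · exact Submodule.mem_iSup_of_mem i (Submodule.mem_iSup_of_mem hi
        (hz (α - Pi.single i 1) (Set.mem_univ _)))
  exact h hy

theorem toE_mon_mem_PFree {α : Fin 3 → ℕ} {v : L A} (h : (weylIdeal A).mkQ v ∈ F3 (A := A) α) :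
    toE (mon α v) ∈ PFree A := by
  intro κ _
  change (weylIdeal A).mkQ (mon α v κ) ∈ F3 (A := A) κ
  by_cases hκ : κ = α
  · subst hκ
    rw [mon, Pi.single_eq_same]
    exact h
  · rw [mon, Pi.single_eq_of_ne hκ, map_zero]
    exact Submodule.zero_mem _

theorem toE_mon_mem_sIdeal {α : Fin 3 → ℕ} (i : Fin 3) (hi : α i ≠ 0) {v : L A}
    (h : (weylIdeal A).mkQ v ∈ F3 (A := A) (α - Pi.single i 1)) : toE (mon α v) ∈ sIdeal A := by
  refine Submodule.mem_iSup_of_mem i ⟨_, toE_mon_mem_PFree h, ?_⟩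
  funext κ
  change (if κ i = 0 then 0 else (weylIdeal A).mkQ (mon (α - Pi.single i 1) v (κ - Pi.single i 1)))
    = (weylIdeal A).mkQ (mon α v κ)
  split_ifs with hκ
  · have : κ ≠ α := by rintro rfl; exact hi hκ
    rw [mon, Pi.single_eq_of_ne this, map_zero]
  · congr 1
    have hle (β : Fin 3 → ℕ) (hβ : β i ≠ 0) : Pi.single i 1 ≤ β := by
      intro n
      by_cases hn : n = i
      · subst hn; rw [Pi.single_eq_same]; exact Nat.one_le_iff_ne_zero.2 hβ
      · rw [Pi.single_eq_of_ne hn]; exact Nat.zero_le _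
    by_cases h' : κ = α
    · subst h'
      rw [mon, mon, Pi.single_eq_same, Pi.single_eq_same]
    · rw [mon, mon, Pi.single_eq_of_ne h', Pi.single_eq_of_ne]
      intro h2
      apply h'
      rw [← tsub_add_cancel_of_le (hle κ hκ), h2, tsub_add_cancel_of_le (hle α hi)]

theorem toE_mon_of_weyl {α : Fin 3 → ℕ} {v : L A} (h : v ∈ weylIdeal A) :
    toE (mon α v) = 0 := by
  funext κ
  change (weylIdeal A).mkQ (mon α v κ) = 0
  by_cases hκ : κ = α
  · subst hκ
    rw [mon, Pi.single_eq_same, Submodule.mkQ_apply]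
    exact (Submodule.Quotient.mk_eq_zero _).2 h
  · rw [mon, Pi.single_eq_of_ne hκ, map_zero]

theorem mem_weylIdeal {w : L A} (h : IsWeyl w) : w ∈ weylIdeal A :=
  Submodule.subset_span ⟨∅, w, h, (thetaMul_empty w).symm⟩

theorem toE_add (x y : Ser (L A)) : toE (x + y) = toE x + toE y :=
  funext fun _ => map_add _ _ _

theorem toE_sum {ι : Type*} (s : Finset ι) (x : ι → Ser (L A)) :
    toE (∑ i ∈ s, x i) = ∑ i ∈ s, toE (x i) := by
  funext α
  change (weylIdeal A).mkQ ((∑ i ∈ s, x i) α) = _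
  rw [Finset.sum_apply, Finset.sum_apply, map_sum]
  rfl

/-! ### Necessary conditions for membership in the filtration -/

theorem map_le_ker_liftQ {l : L A →ₗ[A] A} (hl : weylIdeal A ≤ LinearMap.ker l)
    {N : Submodule A (L A)} (h : ∀ y ∈ N, l y = 0) :
    N.map (weylIdeal A).mkQ ≤ LinearMap.ker ((weylIdeal A).liftQ l hl) := by
  rintro _ ⟨y, hy, rfl⟩
  exact h y hy

theorem apply_eq_zero_of_sIdeal {l : L A →ₗ[A] A} (hl : weylIdeal A ≤ LinearMap.ker l)
    {x : Ser (L A)} (hx : toE x ∈ sIdeal A) {α : Fin 3 → ℕ}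
    (h : ∀ i, α i ≠ 0 → F3 (A := A) (α - Pi.single i 1) ≤
      LinearMap.ker ((weylIdeal A).liftQ l hl)) : l (x α) = 0 :=
  iSup_le (fun i => iSup_le (h i)) (sIdeal_apply hx α)

/-- A zero index admits only even elements for that decomposition, so every functional of odd parity
vanishes there. -/
theorem F3_le_of_even {l : L A →ₗ[A] A} (hl : weylIdeal A ≤ LinearMap.ker l) {n : Fin 3}
    {α : Fin 3 → ℕ} (hα : α n = 0) (h : ∀ y ∈ parityL (W1 n) 0, l y = 0) :
    F3 (A := A) α ≤ LinearMap.ker ((weylIdeal A).liftQ l hl) := by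
  refine (iInf_le _ n).trans ?_
  rw [hα]
  exact map_le_ker_liftQ hl fun y hy => h y hy.1

theorem F3_le_of_one {l : L A →ₗ[A] A} (hl : weylIdeal A ≤ LinearMap.ker l) {n : Fin 3}
    {α : Fin 3 → ℕ} (hα : α n = 1) (h0 : ∀ y ∈ FTriL (W1 n) 0, l y = 0)
    (h1 : ∀ y ∈ parityL (W1 n) 1, l y = 0) :
    F3 (A := A) α ≤ LinearMap.ker ((weylIdeal A).liftQ l hl) := by
  refine (iInf_le _ n).trans ?_
  rw [hα]
  exact sup_le (map_le_ker_liftQ hl fun y hy => h1 y hy.1) (map_le_ker_liftQ hl h0)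

end Sectors
end BKL
end

/-! ### Normal forms for the degree one coefficients. -/

noncomputable section
namespace BKL
section Forms
variable {A : Type*} [CommRing A] [Algebra ℝ A]

/-- The elements of degree one and even for all three decompositions, without spatial
derivatives. -/
def evenForm (X : Derivation ℝ A A) (a : A) (b r : Fin 3 → A) : Fin 4 → CDer A :=
  Fin.cons (ofDer X + a • sigma0) fun i => b i • boost i + r i • rot i

/-- The elements of degree one with the parities of `θ_i`. -/
def oddForm (i : Fin 3) (X : Derivation ℝ A A) (g r s : A) : Fin 4 → CDer A :=
  Fin.cons (g • boost i) fun n =>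
    if n = i then ofDer X + g • sigma0
    else if n = i + 1 then s • rot (i + 2) else r • rot (i + 1)

theorem form2_comm (Y : Fin 4 → Fin 4 → CDer A) (a b : Fin 4) :
    sgn {a} {b} • form2 Y {a, b} = Y a b - Y b a := by
  rw [sgn_singleton]
  rcases lt_trichotomy a b with h | rfl | h
  · rw [if_neg h.ne, if_neg h.not_gt, one_smul, form2_pair Y h]
  · simp
  · rw [if_neg h.ne', if_pos h, Finset.pair_comm, form2_pair Y h, neg_one_smul, neg_sub]

theorem ricFun_form2 (Y : Fin 4 → Fin 4 → CDer A) (b i : Fin 4) :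
    ricFun b i (form2 Y) = ∑ a, ((Y a b).mat i a - (Y b a).mat i a) := by
  change ∑ a : Fin 4, sgn {a} {b} • (form2 Y {a, b}).mat i a = _
  refine Finset.sum_congr rfl fun a _ => ?_
  have h := congrArg (fun δ : CDer A => δ.mat i a) (form2_comm Y a b)
  rw [mat_sub, Matrix.sub_apply] at h
  rw [← h]
  change _ = (sgn {a} {b} • (form2 Y {a, b}).mat) i a
  rw [Matrix.smul_apply]

theorem rep_form2 (Y : Fin 4 → Fin 4 → CDer A) (j : Fin 4) {a b c : Fin 4} (hab : a < b)
    (hbc : b < c) : rep (form2 Y) (theta {j}) {a, b, c} =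
      (Y b c).mat a j - (Y c b).mat a j - ((Y a c).mat b j - (Y c a).mat b j)
        + ((Y a b).mat c j - (Y b a).mat c j) := by
  rw [rep_theta_triple _ _ hab hbc, form2_pair Y hab, form2_pair Y hbc, form2_pair Y (hab.trans hbc)]
  rfl

theorem trace_form2 (Y : Fin 4 → Fin 4 → CDer A) {a b : Fin 4} (hab : a < b) :
    (form2 Y {a, b}).mat.trace = (Y a b).mat.trace - (Y b a).mat.trace := by
  rw [form2_pair Y hab, mat_sub, Matrix.trace_sub]

theorem der_form2 (Y : Fin 4 → Fin 4 → CDer A) {a b : Fin 4} (hab : a < b) :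
    (form2 Y {a, b}).der = (Y a b).der - (Y b a).der := by
  rw [form2_pair Y hab, der_sub]

theorem bracketCoeff_mat (δ ε : Fin 4 → CDer A) (a b m n : Fin 4) :
    (bracketCoeff δ ε a b).mat m n = (δ a).der ((ε b).mat m n) - (ε b).der ((δ a).mat m n)
      + ∑ k, ((δ a).mat m k * (ε b).mat k n - (ε b).mat m k * (δ a).mat k n)
      + ∑ c, ((δ a).mat b c * (ε c).mat m n + (ε a).mat b c * (δ c).mat m n) := by
  simp only [bracketCoeff, mat_add, mat_sum, mat_bracket, mat_smul, Matrix.add_apply,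
    Matrix.sub_apply, Matrix.map_apply, Matrix.mul_apply, Matrix.sum_apply, Matrix.smul_apply,
    smul_eq_mul, Finset.sum_add_distrib, Finset.sum_sub_distrib, add_assoc]

theorem bracketCoeff_der (δ ε : Fin 4 → CDer A) (a b : Fin 4) :
    (bracketCoeff δ ε a b).der = ⁅(δ a).der, (ε b).der⁆
      + ∑ c, ((δ a).mat b c • (ε c).der + (ε a).mat b c • (δ c).der) := by
  simp only [bracketCoeff, der_add, der_sum, der_bracket, der_smul, Finset.sum_add_distrib,
    add_assoc]

@[simp] theorem der_ofDer (X : Derivation ℝ A A) : (ofDer X).der = X := rfl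
@[simp] theorem mat_ofDer (X : Derivation ℝ A A) : (ofDer X).mat = 0 := rfl
@[simp] theorem der_sigma0 : (sigma0 : CDer A).der = 0 := rfl
@[simp] theorem mat_sigma0 : (sigma0 : CDer A).mat = 1 := rfl
@[simp] theorem der_boost (i : Fin 3) : (boost i : CDer A).der = 0 := rfl
@[simp] theorem mat_boost (i : Fin 3) : (boost i : CDer A).mat =
    Matrix.single i.succ 0 1 + Matrix.single 0 i.succ 1 := rfl
@[simp] theorem der_rot (i : Fin 3) : (rot i : CDer A).der = 0 := rfl
@[simp] theorem mat_rot (i : Fin 3) : (rot i : CDer A).mat =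
    Matrix.single (i + 1).succ (i + 2).succ 1 - Matrix.single (i + 2).succ (i + 1).succ 1 := rfl

variable (X D : Derivation ℝ A A) (a : A) (b r : Fin 3 → A) (g p s : A) (i : Fin 3)

theorem evenForm_der : (fun m => (evenForm X a b r m).der) = ![X, 0, 0, 0] := by
  funext m
  fin_cases m
  · change X + a • 0 = X
    simp
  · change b 0 • 0 + r 0 • 0 = (0 : Derivation ℝ A A)
    simp
  · change b 1 • 0 + r 1 • 0 = (0 : Derivation ℝ A A)
    simp
  · change b 2 • 0 + r 2 • 0 = (0 : Derivation ℝ A A)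
    simp

/-- Explicit matrices, one for each covector θ_0, ..., θ_3, reduce the components of the brackets to
finite polynomial identities. -/
theorem evenForm_mat : (fun m => (evenForm X a b r m).mat) =
    ![!![a, 0, 0, 0; 0, a, 0, 0; 0, 0, a, 0; 0, 0, 0, a],
      !![0, b 0, 0, 0; b 0, 0, 0, 0; 0, 0, 0, r 0; 0, 0, -r 0, 0],
      !![0, 0, b 1, 0; 0, 0, 0, -r 1; b 1, 0, 0, 0; 0, r 1, 0, 0],
      !![0, 0, 0, b 2; 0, 0, r 2, 0; 0, -r 2, 0, 0; b 2, 0, 0, 0]] := by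
  funext m
  fin_cases m
  · change (0 : Matrix _ _ A) + a • 1 = _
    ext m n
    fin_cases m <;> fin_cases n <;> simp
  · change b 0 • (boost 0).mat + r 0 • (rot 0).mat = _
    ext m n
    fin_cases m <;> fin_cases n <;> simp
  · change b 1 • (boost 1).mat + r 1 • (rot 1).mat = _
    ext m n
    fin_cases m <;> fin_cases n <;> simp
  · change b 2 • (boost 2).mat + r 2 • (rot 2).mat = _
    ext m n
    fin_cases m <;> fin_cases n <;> simp

theorem oddForm_eq_0 (g r s : A) : oddForm 0 X g r s =
    ![g • boost 0, ofDer X + g • sigma0, s • rot 2, r • rot 1] := by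
  funext m
  fin_cases m <;> rfl

theorem oddForm_der_0 (g r s : A) : (fun m => (oddForm 0 X g r s m).der) = ![0, X, 0, 0] := by
  rw [oddForm_eq_0]
  funext m
  fin_cases m <;> simp

theorem oddForm_mat_0 (g r s : A) : (fun m => (oddForm 0 X g r s m).mat) =
    ![!![0, g, 0, 0; g, 0, 0, 0; 0, 0, 0, 0; 0, 0, 0, 0],
      !![g, 0, 0, 0; 0, g, 0, 0; 0, 0, g, 0; 0, 0, 0, g],
      !![0, 0, 0, 0; 0, 0, s, 0; 0, -s, 0, 0; 0, 0, 0, 0],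
      !![0, 0, 0, 0; 0, 0, 0, -r; 0, 0, 0, 0; 0, r, 0, 0]] := by
  rw [oddForm_eq_0]
  funext m
  fin_cases m <;> ext m n <;> fin_cases m <;> fin_cases n <;> simp

theorem oddForm_eq_1 (g r s : A) : oddForm 1 X g r s =
    ![g • boost 1, r • rot 2, ofDer X + g • sigma0, s • rot 0] := by
  funext m
  fin_cases m <;> rfl

theorem oddForm_der_1 (g r s : A) : (fun m => (oddForm 1 X g r s m).der) = ![0, 0, X, 0] := by
  rw [oddForm_eq_1]
  funext m
  fin_cases m <;> simp

theorem oddForm_mat_1 (g r s : A) : (fun m => (oddForm 1 X g r s m).mat) =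
    ![!![0, 0, g, 0; 0, 0, 0, 0; g, 0, 0, 0; 0, 0, 0, 0],
      !![0, 0, 0, 0; 0, 0, r, 0; 0, -r, 0, 0; 0, 0, 0, 0],
      !![g, 0, 0, 0; 0, g, 0, 0; 0, 0, g, 0; 0, 0, 0, g],
      !![0, 0, 0, 0; 0, 0, 0, 0; 0, 0, 0, s; 0, 0, -s, 0]] := by
  rw [oddForm_eq_1]
  funext m
  fin_cases m <;> ext m n <;> fin_cases m <;> fin_cases n <;> simp

theorem oddForm_eq_2 (g r s : A) : oddForm 2 X g r s =
    ![g • boost 2, s • rot 1, r • rot 0, ofDer X + g • sigma0] := by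
  funext m
  fin_cases m <;> rfl

theorem oddForm_der_2 (g r s : A) : (fun m => (oddForm 2 X g r s m).der) = ![0, 0, 0, X] := by
  rw [oddForm_eq_2]
  funext m
  fin_cases m <;> simp

theorem oddForm_mat_2 (g r s : A) : (fun m => (oddForm 2 X g r s m).mat) =
    ![!![0, 0, 0, g; 0, 0, 0, 0; 0, 0, 0, 0; g, 0, 0, 0],
      !![0, 0, 0, 0; 0, 0, 0, -s; 0, 0, 0, 0; 0, s, 0, 0],
      !![0, 0, 0, 0; 0, 0, 0, 0; 0, 0, 0, r; 0, 0, -r, 0],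
      !![g, 0, 0, 0; 0, g, 0, 0; 0, 0, g, 0; 0, 0, 0, g]] := by
  rw [oddForm_eq_2]
  funext m
  fin_cases m <;> ext m n <;> fin_cases m <;> fin_cases n <;> simp

end Forms
end BKL
end

/-! ### Ricci, Bianchi, trace and derivation components of the brackets. -/

set_option linter.unusedSimpArgs false
noncomputable section
namespace BKL
section Evaluate
variable {A : Type*} [CommRing A] [Algebra ℝ A]

theorem erase_zero : (Finset.univ : Finset (Fin 4)).erase 0 = {1, 2, 3} := by decide
theorem erase_one : (Finset.univ : Finset (Fin 4)).erase 1 = {0, 2, 3} := by decide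
theorem erase_two : (Finset.univ : Finset (Fin 4)).erase 2 = {0, 1, 3} := by decide
theorem erase_three : (Finset.univ : Finset (Fin 4)).erase 3 = {0, 1, 2} := by decide
theorem W1_zero : W1 0 = {2, 3} := rfl
theorem W1_one : W1 1 = {1, 3} := by decide
theorem W1_two : W1 2 = {1, 2} := rfl

variable (X X' D D' : Derivation ℝ A A) (a a' : A) (b b' r r' : Fin 3 → A) (g p s g' p' s' : A)
  (i : Fin 3)

/-- For equal arguments, b killed by X, and a = b_1 + b_2 + b_3, the value is -4(b_1b_2 + b_2b_3 +
b_3b_1), the source of the algebraic constraint. -/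
theorem ric_zero_even_even :
    ricFun 0 0 (bracket (form1 (evenForm X a b r)) (form1 (evenForm X' a' b' r'))) =
      -∑ i, (X (b' i) + X' (b i) + a * b' i + a' * b i - 2 * b i * b' i) := by
  have h1 (m) := congrFun (evenForm_mat X a b r) m
  have h2 (m) := congrFun (evenForm_der X a b r) m
  have h1' (m) := congrFun (evenForm_mat X' a' b' r') m
  have h2' (m) := congrFun (evenForm_der X' a' b' r') m
  rw [bracket_form1]
  rw [ricFun_form2]
  simp only [bracketCoeff_mat, Fin.sum_univ_four, h1, h2, h1', h2']
  simp [sgn_singleton, Fin.sum_univ_three]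
  try ring

/-- For equal arguments with a = b_1 + b_2 + b_3 and r = 0 the quadratic terms cancel and 2 X(b_i)
is left. -/
theorem ric_succ_even_even :
    ricFun i.succ i.succ (bracket (form1 (evenForm X a b r)) (form1 (evenForm X' a' b' r'))) =
      X (b' i) + X' (b i) + a * b' i + a' * b i - b i * (∑ n, b' n) - b' i * (∑ n, b n)
        - 2 * (r (i + 1) * r' (i + 2) + r' (i + 1) * r (i + 2)) := by
  have h1 (m) := congrFun (evenForm_mat X a b r) m
  have h2 (m) := congrFun (evenForm_der X a b r) m
  have h1' (m) := congrFun (evenForm_mat X' a' b' r') m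
  have h2' (m) := congrFun (evenForm_der X' a' b' r') m
  rw [bracket_form1]
  fin_cases i
  · simp only [Fin.zero_eta, Fin.mk_one, Fin.reduceFinMk, Fin.isValue, Fin.reduceAdd,
      Fin.reduceSucc,
    erase_zero, erase_one, erase_two, erase_three, W1_zero, W1_one, W1_two]
    rw [ricFun_form2]
    simp only [bracketCoeff_mat, Fin.sum_univ_four, h1, h2, h1', h2']
    simp [sgn_singleton, Fin.sum_univ_three]
    try ring
  · simp only [Fin.zero_eta, Fin.mk_one, Fin.reduceFinMk, Fin.isValue, Fin.reduceAdd,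
      Fin.reduceSucc,
    erase_zero, erase_one, erase_two, erase_three, W1_zero, W1_one, W1_two]
    rw [ricFun_form2]
    simp only [bracketCoeff_mat, Fin.sum_univ_four, h1, h2, h1', h2']
    simp [sgn_singleton, Fin.sum_univ_three]
    try ring
  · simp only [Fin.zero_eta, Fin.mk_one, Fin.reduceFinMk, Fin.isValue, Fin.reduceAdd,
      Fin.reduceSucc,
    erase_zero, erase_one, erase_two, erase_three, W1_zero, W1_one, W1_two]
    rw [ricFun_form2]
    simp only [bracketCoeff_mat, Fin.sum_univ_four, h1, h2, h1', h2']
    simp [sgn_singleton, Fin.sum_univ_three]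
    try ring

theorem rep_zero_even_even :
    rep (bracket (form1 (evenForm X a b r)) (form1 (evenForm X' a' b' r')))
        (theta {0}) (Finset.univ.erase 0) =
      0 := by
  have h1 (m) := congrFun (evenForm_mat X a b r) m
  have h2 (m) := congrFun (evenForm_der X a b r) m
  have h1' (m) := congrFun (evenForm_mat X' a' b' r') m
  have h2' (m) := congrFun (evenForm_der X' a' b' r') m
  rw [bracket_form1]
  simp only [Fin.zero_eta, Fin.mk_one, Fin.reduceFinMk, Fin.isValue, Fin.reduceAdd,
      Fin.reduceSucc,
    erase_zero, erase_one, erase_two, erase_three, W1_zero, W1_one, W1_two]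
  rw [rep_form2 _ _ (by decide) (by decide)]
  simp only [bracketCoeff_mat, Fin.sum_univ_four, h1, h2, h1', h2']
  simp [sgn_singleton, Fin.sum_univ_three]
  try ring

/-- When a is the sum of the b_n, the weight a + b_i - b_j - b_k equals 2 b_i, which the factor e_i²
of p_i balances. The sign accounts for the cyclic pair (j,k) being decreasing in the middle case. -/
theorem rep_succ_even_even :
    rep (bracket (form1 (evenForm X a b r)) (form1 (evenForm X' a' b' r')))
        (theta {i.succ}) (Finset.univ.erase i.succ) =
      sgn {(i + 1).succ} {(i + 2).succ} • (X (r' (i + 1) + r' (i + 2)) + X' (r (i + 1) + r (i + 2))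
        + (a + b i - b (i + 1) - b (i + 2)) * (r' (i + 1) + r' (i + 2))
        + (a' + b' i - b' (i + 1) - b' (i + 2)) * (r (i + 1) + r (i + 2))) := by
  have h1 (m) := congrFun (evenForm_mat X a b r) m
  have h2 (m) := congrFun (evenForm_der X a b r) m
  have h1' (m) := congrFun (evenForm_mat X' a' b' r') m
  have h2' (m) := congrFun (evenForm_der X' a' b' r') m
  rw [bracket_form1]
  fin_cases i
  · simp only [Fin.zero_eta, Fin.mk_one, Fin.reduceFinMk, Fin.isValue, Fin.reduceAdd,
      Fin.reduceSucc,
    erase_zero, erase_one, erase_two, erase_three, W1_zero, W1_one, W1_two]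
    rw [rep_form2 _ _ (by decide) (by decide)]
    simp only [bracketCoeff_mat, Fin.sum_univ_four, h1, h2, h1', h2']
    simp [sgn_singleton, Fin.sum_univ_three]
    try ring
  · simp only [Fin.zero_eta, Fin.mk_one, Fin.reduceFinMk, Fin.isValue, Fin.reduceAdd,
      Fin.reduceSucc,
    erase_zero, erase_one, erase_two, erase_three, W1_zero, W1_one, W1_two]
    rw [rep_form2 _ _ (by decide) (by decide)]
    simp only [bracketCoeff_mat, Fin.sum_univ_four, h1, h2, h1', h2']
    simp [sgn_singleton, Fin.sum_univ_three]
    try ring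
  · simp only [Fin.zero_eta, Fin.mk_one, Fin.reduceFinMk, Fin.isValue, Fin.reduceAdd,
      Fin.reduceSucc,
    erase_zero, erase_one, erase_two, erase_three, W1_zero, W1_one, W1_two]
    rw [rep_form2 _ _ (by decide) (by decide)]
    simp only [bracketCoeff_mat, Fin.sum_univ_four, h1, h2, h1', h2']
    simp [sgn_singleton, Fin.sum_univ_three]
    try ring

/-- When a is the sum of the b_n, the weight a - b_i equals b_j + b_k, which the factor e_j e_k of
q_i balances. -/
theorem der_zero_even_odd :
    ((bracket (form1 (evenForm X a b r)) (form1 (oddForm i D g p s))) {0, i.succ}).der =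
      ⁅X, D⁆ + (a - b i) • D := by
  have h1 (m) := congrFun (evenForm_mat X a b r) m
  have h2 (m) := congrFun (evenForm_der X a b r) m
  rw [bracket_form1]
  fin_cases i
  · have h1' (m) := congrFun (oddForm_mat_0 D g p s) m
    have h2' (m) := congrFun (oddForm_der_0 D g p s) m
    simp only [Fin.zero_eta, Fin.mk_one, Fin.reduceFinMk, Fin.isValue, Fin.reduceAdd,
      Fin.reduceSucc,
    erase_zero, erase_one, erase_two, erase_three, W1_zero, W1_one, W1_two]
    rw [der_form2 _ (by decide)]
    simp only [bracketCoeff_der, Fin.sum_univ_four, h1, h2, h1', h2']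
    simp [sgn_singleton, Fin.sum_univ_three]
    try module
  · have h1' (m) := congrFun (oddForm_mat_1 D g p s) m
    have h2' (m) := congrFun (oddForm_der_1 D g p s) m
    simp only [Fin.zero_eta, Fin.mk_one, Fin.reduceFinMk, Fin.isValue, Fin.reduceAdd,
      Fin.reduceSucc,
    erase_zero, erase_one, erase_two, erase_three, W1_zero, W1_one, W1_two]
    rw [der_form2 _ (by decide)]
    simp only [bracketCoeff_der, Fin.sum_univ_four, h1, h2, h1', h2']
    simp [sgn_singleton, Fin.sum_univ_three]
    try module
  · have h1' (m) := congrFun (oddForm_mat_2 D g p s) m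
    have h2' (m) := congrFun (oddForm_der_2 D g p s) m
    simp only [Fin.zero_eta, Fin.mk_one, Fin.reduceFinMk, Fin.isValue, Fin.reduceAdd,
      Fin.reduceSucc,
    erase_zero, erase_one, erase_two, erase_three, W1_zero, W1_one, W1_two]
    rw [der_form2 _ (by decide)]
    simp only [bracketCoeff_der, Fin.sum_univ_four, h1, h2, h1', h2']
    simp [sgn_singleton, Fin.sum_univ_three]
    try module

theorem der_W1_even_odd :
    ((bracket (form1 (evenForm X a b r)) (form1 (oddForm i D g p s))) (W1 i)).der =
      sgn {(i + 1).succ} {(i + 2).succ} • (r (i + 1) + r (i + 2)) • D := by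
  have h1 (m) := congrFun (evenForm_mat X a b r) m
  have h2 (m) := congrFun (evenForm_der X a b r) m
  rw [bracket_form1]
  fin_cases i
  · have h1' (m) := congrFun (oddForm_mat_0 D g p s) m
    have h2' (m) := congrFun (oddForm_der_0 D g p s) m
    simp only [Fin.zero_eta, Fin.mk_one, Fin.reduceFinMk, Fin.isValue, Fin.reduceAdd,
      Fin.reduceSucc,
    erase_zero, erase_one, erase_two, erase_three, W1_zero, W1_one, W1_two]
    rw [der_form2 _ (by decide)]
    simp only [bracketCoeff_der, Fin.sum_univ_four, h1, h2, h1', h2']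
    simp [sgn_singleton, Fin.sum_univ_three]
    try module
  · have h1' (m) := congrFun (oddForm_mat_1 D g p s) m
    have h2' (m) := congrFun (oddForm_der_1 D g p s) m
    simp only [Fin.zero_eta, Fin.mk_one, Fin.reduceFinMk, Fin.isValue, Fin.reduceAdd,
      Fin.reduceSucc,
    erase_zero, erase_one, erase_two, erase_three, W1_zero, W1_one, W1_two]
    rw [der_form2 _ (by decide)]
    simp only [bracketCoeff_der, Fin.sum_univ_four, h1, h2, h1', h2']
    simp [sgn_singleton, Fin.sum_univ_three]
    try module
  · have h1' (m) := congrFun (oddForm_mat_2 D g p s) m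
    have h2' (m) := congrFun (oddForm_der_2 D g p s) m
    simp only [Fin.zero_eta, Fin.mk_one, Fin.reduceFinMk, Fin.isValue, Fin.reduceAdd,
      Fin.reduceSucc,
    erase_zero, erase_one, erase_two, erase_three, W1_zero, W1_one, W1_two]
    rw [der_form2 _ (by decide)]
    simp only [bracketCoeff_der, Fin.sum_univ_four, h1, h2, h1', h2']
    simp [sgn_singleton, Fin.sum_univ_three]
    try module

theorem trace_zero_even_odd :
    ((bracket (form1 (evenForm X a b r)) (form1 (oddForm i D g p s))) {0, i.succ}).mat.trace =
      4 * (X g - D a + (a - b i) * g) := by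
  have h1 (m) := congrFun (evenForm_mat X a b r) m
  have h2 (m) := congrFun (evenForm_der X a b r) m
  rw [bracket_form1]
  fin_cases i
  · have h1' (m) := congrFun (oddForm_mat_0 D g p s) m
    have h2' (m) := congrFun (oddForm_der_0 D g p s) m
    simp only [Fin.zero_eta, Fin.mk_one, Fin.reduceFinMk, Fin.isValue, Fin.reduceAdd,
      Fin.reduceSucc,
    erase_zero, erase_one, erase_two, erase_three, W1_zero, W1_one, W1_two]
    rw [trace_form2 _ (by decide)]
    simp only [Matrix.trace, Matrix.diag_apply, bracketCoeff_mat, Fin.sum_univ_four, h1, h2, h1', h2']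
    simp [sgn_singleton, Fin.sum_univ_three]
    try ring
  · have h1' (m) := congrFun (oddForm_mat_1 D g p s) m
    have h2' (m) := congrFun (oddForm_der_1 D g p s) m
    simp only [Fin.zero_eta, Fin.mk_one, Fin.reduceFinMk, Fin.isValue, Fin.reduceAdd,
      Fin.reduceSucc,
    erase_zero, erase_one, erase_two, erase_three, W1_zero, W1_one, W1_two]
    rw [trace_form2 _ (by decide)]
    simp only [Matrix.trace, Matrix.diag_apply, bracketCoeff_mat, Fin.sum_univ_four, h1, h2, h1', h2']
    simp [sgn_singleton, Fin.sum_univ_three]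
    try ring
  · have h1' (m) := congrFun (oddForm_mat_2 D g p s) m
    have h2' (m) := congrFun (oddForm_der_2 D g p s) m
    simp only [Fin.zero_eta, Fin.mk_one, Fin.reduceFinMk, Fin.isValue, Fin.reduceAdd,
      Fin.reduceSucc,
    erase_zero, erase_one, erase_two, erase_three, W1_zero, W1_one, W1_two]
    rw [trace_form2 _ (by decide)]
    simp only [Matrix.trace, Matrix.diag_apply, bracketCoeff_mat, Fin.sum_univ_four, h1, h2, h1', h2']
    simp [sgn_singleton, Fin.sum_univ_three]
    try ring

theorem trace_W1_even_odd :
    ((bracket (form1 (evenForm X a b r)) (form1 (oddForm i D g p s))) (W1 i)).mat.trace =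
      sgn {(i + 1).succ} {(i + 2).succ} • (4 * ((r (i + 1) + r (i + 2)) * g)) := by
  have h1 (m) := congrFun (evenForm_mat X a b r) m
  have h2 (m) := congrFun (evenForm_der X a b r) m
  rw [bracket_form1]
  fin_cases i
  · have h1' (m) := congrFun (oddForm_mat_0 D g p s) m
    have h2' (m) := congrFun (oddForm_der_0 D g p s) m
    simp only [Fin.zero_eta, Fin.mk_one, Fin.reduceFinMk, Fin.isValue, Fin.reduceAdd,
      Fin.reduceSucc,
    erase_zero, erase_one, erase_two, erase_three, W1_zero, W1_one, W1_two]
    rw [trace_form2 _ (by decide)]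
    simp only [Matrix.trace, Matrix.diag_apply, bracketCoeff_mat, Fin.sum_univ_four, h1, h2, h1', h2']
    simp [sgn_singleton, Fin.sum_univ_three]
    try ring
  · have h1' (m) := congrFun (oddForm_mat_1 D g p s) m
    have h2' (m) := congrFun (oddForm_der_1 D g p s) m
    simp only [Fin.zero_eta, Fin.mk_one, Fin.reduceFinMk, Fin.isValue, Fin.reduceAdd,
      Fin.reduceSucc,
    erase_zero, erase_one, erase_two, erase_three, W1_zero, W1_one, W1_two]
    rw [trace_form2 _ (by decide)]
    simp only [Matrix.trace, Matrix.diag_apply, bracketCoeff_mat, Fin.sum_univ_four, h1, h2, h1', h2']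
    simp [sgn_singleton, Fin.sum_univ_three]
    try ring
  · have h1' (m) := congrFun (oddForm_mat_2 D g p s) m
    have h2' (m) := congrFun (oddForm_der_2 D g p s) m
    simp only [Fin.zero_eta, Fin.mk_one, Fin.reduceFinMk, Fin.isValue, Fin.reduceAdd,
      Fin.reduceSucc,
    erase_zero, erase_one, erase_two, erase_three, W1_zero, W1_one, W1_two]
    rw [trace_form2 _ (by decide)]
    simp only [Matrix.trace, Matrix.diag_apply, bracketCoeff_mat, Fin.sum_univ_four, h1, h2, h1', h2']
    simp [sgn_singleton, Fin.sum_univ_three]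
    try ring

/-- For the bracket of u and q_i this component is the momentum constraint; the transposed component
below repeats it once the parameters are constant in time. -/
theorem ric_zero_succ_even_odd :
    ricFun 0 i.succ (bracket (form1 (evenForm X a b r)) (form1 (oddForm i D g p s))) =
      -X g + X p - X s + D a - a * g + a * p - a * s + b i * g - b (i + 1) * g + b (i + 1) * s
        - b (i + 2) * g - b (i + 2) * p := by
  have h1 (m) := congrFun (evenForm_mat X a b r) m
  have h2 (m) := congrFun (evenForm_der X a b r) m
  rw [bracket_form1]
  fin_cases i
  · have h1' (m) := congrFun (oddForm_mat_0 D g p s) m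
    have h2' (m) := congrFun (oddForm_der_0 D g p s) m
    simp only [Fin.zero_eta, Fin.mk_one, Fin.reduceFinMk, Fin.isValue, Fin.reduceAdd,
      Fin.reduceSucc,
    erase_zero, erase_one, erase_two, erase_three, W1_zero, W1_one, W1_two]
    rw [ricFun_form2]
    simp only [bracketCoeff_mat, Fin.sum_univ_four, h1, h2, h1', h2']
    simp [sgn_singleton, Fin.sum_univ_three]
    try ring
  · have h1' (m) := congrFun (oddForm_mat_1 D g p s) m
    have h2' (m) := congrFun (oddForm_der_1 D g p s) m
    simp only [Fin.zero_eta, Fin.mk_one, Fin.reduceFinMk, Fin.isValue, Fin.reduceAdd,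
      Fin.reduceSucc,
    erase_zero, erase_one, erase_two, erase_three, W1_zero, W1_one, W1_two]
    rw [ricFun_form2]
    simp only [bracketCoeff_mat, Fin.sum_univ_four, h1, h2, h1', h2']
    simp [sgn_singleton, Fin.sum_univ_three]
    try ring
  · have h1' (m) := congrFun (oddForm_mat_2 D g p s) m
    have h2' (m) := congrFun (oddForm_der_2 D g p s) m
    simp only [Fin.zero_eta, Fin.mk_one, Fin.reduceFinMk, Fin.isValue, Fin.reduceAdd,
      Fin.reduceSucc,
    erase_zero, erase_one, erase_two, erase_three, W1_zero, W1_one, W1_two]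
    rw [ricFun_form2]
    simp only [bracketCoeff_mat, Fin.sum_univ_four, h1, h2, h1', h2']
    simp [sgn_singleton, Fin.sum_univ_three]
    try ring

theorem ric_succ_zero_even_odd :
    ricFun i.succ 0 (bracket (form1 (evenForm X a b r)) (form1 (oddForm i D g p s))) =
      X g - D a - D (b (i + 1)) - D (b (i + 2)) + (a - b i - b (i + 1) - b (i + 2)) * g
        + (b i - b (i + 2)) * p + (b (i + 1) - b i) * s := by
  have h1 (m) := congrFun (evenForm_mat X a b r) m
  have h2 (m) := congrFun (evenForm_der X a b r) m
  rw [bracket_form1]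
  fin_cases i
  · have h1' (m) := congrFun (oddForm_mat_0 D g p s) m
    have h2' (m) := congrFun (oddForm_der_0 D g p s) m
    simp only [Fin.zero_eta, Fin.mk_one, Fin.reduceFinMk, Fin.isValue, Fin.reduceAdd,
      Fin.reduceSucc,
    erase_zero, erase_one, erase_two, erase_three, W1_zero, W1_one, W1_two]
    rw [ricFun_form2]
    simp only [bracketCoeff_mat, Fin.sum_univ_four, h1, h2, h1', h2']
    simp [sgn_singleton, Fin.sum_univ_three]
    try ring
  · have h1' (m) := congrFun (oddForm_mat_1 D g p s) m
    have h2' (m) := congrFun (oddForm_der_1 D g p s) m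
    simp only [Fin.zero_eta, Fin.mk_one, Fin.reduceFinMk, Fin.isValue, Fin.reduceAdd,
      Fin.reduceSucc,
    erase_zero, erase_one, erase_two, erase_three, W1_zero, W1_one, W1_two]
    rw [ricFun_form2]
    simp only [bracketCoeff_mat, Fin.sum_univ_four, h1, h2, h1', h2']
    simp [sgn_singleton, Fin.sum_univ_three]
    try ring
  · have h1' (m) := congrFun (oddForm_mat_2 D g p s) m
    have h2' (m) := congrFun (oddForm_der_2 D g p s) m
    simp only [Fin.zero_eta, Fin.mk_one, Fin.reduceFinMk, Fin.isValue, Fin.reduceAdd,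
      Fin.reduceSucc,
    erase_zero, erase_one, erase_two, erase_three, W1_zero, W1_one, W1_two]
    rw [ricFun_form2]
    simp only [bracketCoeff_mat, Fin.sum_univ_four, h1, h2, h1', h2']
    simp [sgn_singleton, Fin.sum_univ_three]
    try ring

theorem ric_succ_succ_even_odd :
    ricFun (i + 1).succ (i + 2).succ
        (bracket (form1 (evenForm X a b r)) (form1 (oddForm i D g p s))) =
      D (r (i + 1)) - (r (i + 1) + r (i + 2)) * g + (r i + r (i + 1)) * p + (r i - r (i + 1)) * s := by
  have h1 (m) := congrFun (evenForm_mat X a b r) m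
  have h2 (m) := congrFun (evenForm_der X a b r) m
  rw [bracket_form1]
  fin_cases i
  · have h1' (m) := congrFun (oddForm_mat_0 D g p s) m
    have h2' (m) := congrFun (oddForm_der_0 D g p s) m
    simp only [Fin.zero_eta, Fin.mk_one, Fin.reduceFinMk, Fin.isValue, Fin.reduceAdd,
      Fin.reduceSucc,
    erase_zero, erase_one, erase_two, erase_three, W1_zero, W1_one, W1_two]
    rw [ricFun_form2]
    simp only [bracketCoeff_mat, Fin.sum_univ_four, h1, h2, h1', h2']
    simp [sgn_singleton, Fin.sum_univ_three]
    try ring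
  · have h1' (m) := congrFun (oddForm_mat_1 D g p s) m
    have h2' (m) := congrFun (oddForm_der_1 D g p s) m
    simp only [Fin.zero_eta, Fin.mk_one, Fin.reduceFinMk, Fin.isValue, Fin.reduceAdd,
      Fin.reduceSucc,
    erase_zero, erase_one, erase_two, erase_three, W1_zero, W1_one, W1_two]
    rw [ricFun_form2]
    simp only [bracketCoeff_mat, Fin.sum_univ_four, h1, h2, h1', h2']
    simp [sgn_singleton, Fin.sum_univ_three]
    try ring
  · have h1' (m) := congrFun (oddForm_mat_2 D g p s) m
    have h2' (m) := congrFun (oddForm_der_2 D g p s) m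
    simp only [Fin.zero_eta, Fin.mk_one, Fin.reduceFinMk, Fin.isValue, Fin.reduceAdd,
      Fin.reduceSucc,
    erase_zero, erase_one, erase_two, erase_three, W1_zero, W1_one, W1_two]
    rw [ricFun_form2]
    simp only [bracketCoeff_mat, Fin.sum_univ_four, h1, h2, h1', h2']
    simp [sgn_singleton, Fin.sum_univ_three]
    try ring

theorem ric_succ_succ_even_odd' :
    ricFun (i + 2).succ (i + 1).succ
        (bracket (form1 (evenForm X a b r)) (form1 (oddForm i D g p s))) =
      -D (r (i + 2)) + (r (i + 1) + r (i + 2)) * g + (r i - r (i + 2)) * p + (r i + r (i + 2)) * s := by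
  have h1 (m) := congrFun (evenForm_mat X a b r) m
  have h2 (m) := congrFun (evenForm_der X a b r) m
  rw [bracket_form1]
  fin_cases i
  · have h1' (m) := congrFun (oddForm_mat_0 D g p s) m
    have h2' (m) := congrFun (oddForm_der_0 D g p s) m
    simp only [Fin.zero_eta, Fin.mk_one, Fin.reduceFinMk, Fin.isValue, Fin.reduceAdd,
      Fin.reduceSucc,
    erase_zero, erase_one, erase_two, erase_three, W1_zero, W1_one, W1_two]
    rw [ricFun_form2]
    simp only [bracketCoeff_mat, Fin.sum_univ_four, h1, h2, h1', h2']
    simp [sgn_singleton, Fin.sum_univ_three]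
    try ring
  · have h1' (m) := congrFun (oddForm_mat_1 D g p s) m
    have h2' (m) := congrFun (oddForm_der_1 D g p s) m
    simp only [Fin.zero_eta, Fin.mk_one, Fin.reduceFinMk, Fin.isValue, Fin.reduceAdd,
      Fin.reduceSucc,
    erase_zero, erase_one, erase_two, erase_three, W1_zero, W1_one, W1_two]
    rw [ricFun_form2]
    simp only [bracketCoeff_mat, Fin.sum_univ_four, h1, h2, h1', h2']
    simp [sgn_singleton, Fin.sum_univ_three]
    try ring
  · have h1' (m) := congrFun (oddForm_mat_2 D g p s) m
    have h2' (m) := congrFun (oddForm_der_2 D g p s) m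
    simp only [Fin.zero_eta, Fin.mk_one, Fin.reduceFinMk, Fin.isValue, Fin.reduceAdd,
      Fin.reduceSucc,
    erase_zero, erase_one, erase_two, erase_three, W1_zero, W1_one, W1_two]
    rw [ricFun_form2]
    simp only [bracketCoeff_mat, Fin.sum_univ_four, h1, h2, h1', h2']
    simp [sgn_singleton, Fin.sum_univ_three]
    try ring

theorem rep_zero_even_odd :
    rep (bracket (form1 (evenForm X a b r)) (form1 (oddForm i D g p s)))
        (theta {0}) (Finset.univ.erase i.succ) =
      0 := by
  have h1 (m) := congrFun (evenForm_mat X a b r) m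
  have h2 (m) := congrFun (evenForm_der X a b r) m
  rw [bracket_form1]
  fin_cases i
  · have h1' (m) := congrFun (oddForm_mat_0 D g p s) m
    have h2' (m) := congrFun (oddForm_der_0 D g p s) m
    simp only [Fin.zero_eta, Fin.mk_one, Fin.reduceFinMk, Fin.isValue, Fin.reduceAdd,
      Fin.reduceSucc,
    erase_zero, erase_one, erase_two, erase_three, W1_zero, W1_one, W1_two]
    rw [rep_form2 _ _ (by decide) (by decide)]
    simp only [bracketCoeff_mat, Fin.sum_univ_four, h1, h2, h1', h2']
    simp [sgn_singleton, Fin.sum_univ_three]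
    try ring
  · have h1' (m) := congrFun (oddForm_mat_1 D g p s) m
    have h2' (m) := congrFun (oddForm_der_1 D g p s) m
    simp only [Fin.zero_eta, Fin.mk_one, Fin.reduceFinMk, Fin.isValue, Fin.reduceAdd,
      Fin.reduceSucc,
    erase_zero, erase_one, erase_two, erase_three, W1_zero, W1_one, W1_two]
    rw [rep_form2 _ _ (by decide) (by decide)]
    simp only [bracketCoeff_mat, Fin.sum_univ_four, h1, h2, h1', h2']
    simp [sgn_singleton, Fin.sum_univ_three]
    try ring
  · have h1' (m) := congrFun (oddForm_mat_2 D g p s) m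
    have h2' (m) := congrFun (oddForm_der_2 D g p s) m
    simp only [Fin.zero_eta, Fin.mk_one, Fin.reduceFinMk, Fin.isValue, Fin.reduceAdd,
      Fin.reduceSucc,
    erase_zero, erase_one, erase_two, erase_three, W1_zero, W1_one, W1_two]
    rw [rep_form2 _ _ (by decide) (by decide)]
    simp only [bracketCoeff_mat, Fin.sum_univ_four, h1, h2, h1', h2']
    simp [sgn_singleton, Fin.sum_univ_three]
    try ring

theorem rep_self_even_odd :
    rep (bracket (form1 (evenForm X a b r)) (form1 (oddForm i D g p s)))
        (theta {i.succ}) (Finset.univ.erase 0) =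
      D (r (i + 1) + r (i + 2)) + (r (i + 1) + r (i + 2)) * (2 * g + p - s) := by
  have h1 (m) := congrFun (evenForm_mat X a b r) m
  have h2 (m) := congrFun (evenForm_der X a b r) m
  rw [bracket_form1]
  fin_cases i
  · have h1' (m) := congrFun (oddForm_mat_0 D g p s) m
    have h2' (m) := congrFun (oddForm_der_0 D g p s) m
    simp only [Fin.zero_eta, Fin.mk_one, Fin.reduceFinMk, Fin.isValue, Fin.reduceAdd,
      Fin.reduceSucc,
    erase_zero, erase_one, erase_two, erase_three, W1_zero, W1_one, W1_two]
    rw [rep_form2 _ _ (by decide) (by decide)]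
    simp only [bracketCoeff_mat, Fin.sum_univ_four, h1, h2, h1', h2']
    simp [sgn_singleton, Fin.sum_univ_three]
    try ring
  · have h1' (m) := congrFun (oddForm_mat_1 D g p s) m
    have h2' (m) := congrFun (oddForm_der_1 D g p s) m
    simp only [Fin.zero_eta, Fin.mk_one, Fin.reduceFinMk, Fin.isValue, Fin.reduceAdd,
      Fin.reduceSucc,
    erase_zero, erase_one, erase_two, erase_three, W1_zero, W1_one, W1_two]
    rw [rep_form2 _ _ (by decide) (by decide)]
    simp only [bracketCoeff_mat, Fin.sum_univ_four, h1, h2, h1', h2']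
    simp [sgn_singleton, Fin.sum_univ_three]
    try ring
  · have h1' (m) := congrFun (oddForm_mat_2 D g p s) m
    have h2' (m) := congrFun (oddForm_der_2 D g p s) m
    simp only [Fin.zero_eta, Fin.mk_one, Fin.reduceFinMk, Fin.isValue, Fin.reduceAdd,
      Fin.reduceSucc,
    erase_zero, erase_one, erase_two, erase_three, W1_zero, W1_one, W1_two]
    rw [rep_form2 _ _ (by decide) (by decide)]
    simp only [bracketCoeff_mat, Fin.sum_univ_four, h1, h2, h1', h2']
    simp [sgn_singleton, Fin.sum_univ_three]
    try ring

theorem rep_succ_even_odd :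
    rep (bracket (form1 (evenForm X a b r)) (form1 (oddForm i D g p s)))
        (theta {(i + 1).succ}) (Finset.univ.erase (i + 2).succ) =
      sgn {i.succ} {(i + 1).succ} • (X g - X s - D a + D (b (i + 1)) + (a - b i) * (g - s)) := by
  have h1 (m) := congrFun (evenForm_mat X a b r) m
  have h2 (m) := congrFun (evenForm_der X a b r) m
  rw [bracket_form1]
  fin_cases i
  · have h1' (m) := congrFun (oddForm_mat_0 D g p s) m
    have h2' (m) := congrFun (oddForm_der_0 D g p s) m
    simp only [Fin.zero_eta, Fin.mk_one, Fin.reduceFinMk, Fin.isValue, Fin.reduceAdd,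
      Fin.reduceSucc,
    erase_zero, erase_one, erase_two, erase_three, W1_zero, W1_one, W1_two]
    rw [rep_form2 _ _ (by decide) (by decide)]
    simp only [bracketCoeff_mat, Fin.sum_univ_four, h1, h2, h1', h2']
    simp [sgn_singleton, Fin.sum_univ_three]
    try ring
  · have h1' (m) := congrFun (oddForm_mat_1 D g p s) m
    have h2' (m) := congrFun (oddForm_der_1 D g p s) m
    simp only [Fin.zero_eta, Fin.mk_one, Fin.reduceFinMk, Fin.isValue, Fin.reduceAdd,
      Fin.reduceSucc,
    erase_zero, erase_one, erase_two, erase_three, W1_zero, W1_one, W1_two]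
    rw [rep_form2 _ _ (by decide) (by decide)]
    simp only [bracketCoeff_mat, Fin.sum_univ_four, h1, h2, h1', h2']
    simp [sgn_singleton, Fin.sum_univ_three]
    try ring
  · have h1' (m) := congrFun (oddForm_mat_2 D g p s) m
    have h2' (m) := congrFun (oddForm_der_2 D g p s) m
    simp only [Fin.zero_eta, Fin.mk_one, Fin.reduceFinMk, Fin.isValue, Fin.reduceAdd,
      Fin.reduceSucc,
    erase_zero, erase_one, erase_two, erase_three, W1_zero, W1_one, W1_two]
    rw [rep_form2 _ _ (by decide) (by decide)]
    simp only [bracketCoeff_mat, Fin.sum_univ_four, h1, h2, h1', h2']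
    simp [sgn_singleton, Fin.sum_univ_three]
    try ring

theorem rep_succ_even_odd' :
    rep (bracket (form1 (evenForm X a b r)) (form1 (oddForm i D g p s)))
        (theta {(i + 2).succ}) (Finset.univ.erase (i + 1).succ) =
      sgn {i.succ} {(i + 2).succ} • (X g + X p - D a + D (b (i + 2)) + (a - b i) * (g + p)) := by
  have h1 (m) := congrFun (evenForm_mat X a b r) m
  have h2 (m) := congrFun (evenForm_der X a b r) m
  rw [bracket_form1]
  fin_cases i
  · have h1' (m) := congrFun (oddForm_mat_0 D g p s) m
    have h2' (m) := congrFun (oddForm_der_0 D g p s) m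
    simp only [Fin.zero_eta, Fin.mk_one, Fin.reduceFinMk, Fin.isValue, Fin.reduceAdd,
      Fin.reduceSucc,
    erase_zero, erase_one, erase_two, erase_three, W1_zero, W1_one, W1_two]
    rw [rep_form2 _ _ (by decide) (by decide)]
    simp only [bracketCoeff_mat, Fin.sum_univ_four, h1, h2, h1', h2']
    simp [sgn_singleton, Fin.sum_univ_three]
    try ring
  · have h1' (m) := congrFun (oddForm_mat_1 D g p s) m
    have h2' (m) := congrFun (oddForm_der_1 D g p s) m
    simp only [Fin.zero_eta, Fin.mk_one, Fin.reduceFinMk, Fin.isValue, Fin.reduceAdd,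
      Fin.reduceSucc,
    erase_zero, erase_one, erase_two, erase_three, W1_zero, W1_one, W1_two]
    rw [rep_form2 _ _ (by decide) (by decide)]
    simp only [bracketCoeff_mat, Fin.sum_univ_four, h1, h2, h1', h2']
    simp [sgn_singleton, Fin.sum_univ_three]
    try ring
  · have h1' (m) := congrFun (oddForm_mat_2 D g p s) m
    have h2' (m) := congrFun (oddForm_der_2 D g p s) m
    simp only [Fin.zero_eta, Fin.mk_one, Fin.reduceFinMk, Fin.isValue, Fin.reduceAdd,
      Fin.reduceSucc,
    erase_zero, erase_one, erase_two, erase_three, W1_zero, W1_one, W1_two]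
    rw [rep_form2 _ _ (by decide) (by decide)]
    simp only [bracketCoeff_mat, Fin.sum_univ_four, h1, h2, h1', h2']
    simp [sgn_singleton, Fin.sum_univ_three]
    try ring

/-- This identity and the three that follow are all the diagonal Bianchi components. They hold
identically, which is why [q_i,q_i] imposes no condition at s_j² s_k². -/
theorem rep_zero_odd_odd :
    rep (bracket (form1 (oddForm i D g p s)) (form1 (oddForm i D' g' p' s')))
        (theta {0}) (Finset.univ.erase 0) =
      0 := by
  rw [bracket_form1]
  fin_cases i
  · have h1 (m) := congrFun (oddForm_mat_0 D g p s) m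
    have h2 (m) := congrFun (oddForm_der_0 D g p s) m
    have h1' (m) := congrFun (oddForm_mat_0 D' g' p' s') m
    have h2' (m) := congrFun (oddForm_der_0 D' g' p' s') m
    simp only [Fin.zero_eta, Fin.mk_one, Fin.reduceFinMk, Fin.isValue, Fin.reduceAdd,
      Fin.reduceSucc,
    erase_zero, erase_one, erase_two, erase_three, W1_zero, W1_one, W1_two]
    rw [rep_form2 _ _ (by decide) (by decide)]
    simp only [bracketCoeff_mat, Fin.sum_univ_four, h1, h2, h1', h2']
    simp [sgn_singleton, Fin.sum_univ_three]
    try ring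
  · have h1 (m) := congrFun (oddForm_mat_1 D g p s) m
    have h2 (m) := congrFun (oddForm_der_1 D g p s) m
    have h1' (m) := congrFun (oddForm_mat_1 D' g' p' s') m
    have h2' (m) := congrFun (oddForm_der_1 D' g' p' s') m
    simp only [Fin.zero_eta, Fin.mk_one, Fin.reduceFinMk, Fin.isValue, Fin.reduceAdd,
      Fin.reduceSucc,
    erase_zero, erase_one, erase_two, erase_three, W1_zero, W1_one, W1_two]
    rw [rep_form2 _ _ (by decide) (by decide)]
    simp only [bracketCoeff_mat, Fin.sum_univ_four, h1, h2, h1', h2']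
    simp [sgn_singleton, Fin.sum_univ_three]
    try ring
  · have h1 (m) := congrFun (oddForm_mat_2 D g p s) m
    have h2 (m) := congrFun (oddForm_der_2 D g p s) m
    have h1' (m) := congrFun (oddForm_mat_2 D' g' p' s') m
    have h2' (m) := congrFun (oddForm_der_2 D' g' p' s') m
    simp only [Fin.zero_eta, Fin.mk_one, Fin.reduceFinMk, Fin.isValue, Fin.reduceAdd,
      Fin.reduceSucc,
    erase_zero, erase_one, erase_two, erase_three, W1_zero, W1_one, W1_two]
    rw [rep_form2 _ _ (by decide) (by decide)]
    simp only [bracketCoeff_mat, Fin.sum_univ_four, h1, h2, h1', h2']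
    simp [sgn_singleton, Fin.sum_univ_three]
    try ring

theorem rep_self_odd_odd :
    rep (bracket (form1 (oddForm i D g p s)) (form1 (oddForm i D' g' p' s')))
        (theta {i.succ}) (Finset.univ.erase i.succ) =
      0 := by
  rw [bracket_form1]
  fin_cases i
  · have h1 (m) := congrFun (oddForm_mat_0 D g p s) m
    have h2 (m) := congrFun (oddForm_der_0 D g p s) m
    have h1' (m) := congrFun (oddForm_mat_0 D' g' p' s') m
    have h2' (m) := congrFun (oddForm_der_0 D' g' p' s') m
    simp only [Fin.zero_eta, Fin.mk_one, Fin.reduceFinMk, Fin.isValue, Fin.reduceAdd,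
      Fin.reduceSucc,
    erase_zero, erase_one, erase_two, erase_three, W1_zero, W1_one, W1_two]
    rw [rep_form2 _ _ (by decide) (by decide)]
    simp only [bracketCoeff_mat, Fin.sum_univ_four, h1, h2, h1', h2']
    simp [sgn_singleton, Fin.sum_univ_three]
    try ring
  · have h1 (m) := congrFun (oddForm_mat_1 D g p s) m
    have h2 (m) := congrFun (oddForm_der_1 D g p s) m
    have h1' (m) := congrFun (oddForm_mat_1 D' g' p' s') m
    have h2' (m) := congrFun (oddForm_der_1 D' g' p' s') m
    simp only [Fin.zero_eta, Fin.mk_one, Fin.reduceFinMk, Fin.isValue, Fin.reduceAdd,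
      Fin.reduceSucc,
    erase_zero, erase_one, erase_two, erase_three, W1_zero, W1_one, W1_two]
    rw [rep_form2 _ _ (by decide) (by decide)]
    simp only [bracketCoeff_mat, Fin.sum_univ_four, h1, h2, h1', h2']
    simp [sgn_singleton, Fin.sum_univ_three]
    try ring
  · have h1 (m) := congrFun (oddForm_mat_2 D g p s) m
    have h2 (m) := congrFun (oddForm_der_2 D g p s) m
    have h1' (m) := congrFun (oddForm_mat_2 D' g' p' s') m
    have h2' (m) := congrFun (oddForm_der_2 D' g' p' s') m
    simp only [Fin.zero_eta, Fin.mk_one, Fin.reduceFinMk, Fin.isValue, Fin.reduceAdd,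
      Fin.reduceSucc,
    erase_zero, erase_one, erase_two, erase_three, W1_zero, W1_one, W1_two]
    rw [rep_form2 _ _ (by decide) (by decide)]
    simp only [bracketCoeff_mat, Fin.sum_univ_four, h1, h2, h1', h2']
    simp [sgn_singleton, Fin.sum_univ_three]
    try ring

theorem rep_succ_odd_odd :
    rep (bracket (form1 (oddForm i D g p s)) (form1 (oddForm i D' g' p' s')))
        (theta {(i + 1).succ}) (Finset.univ.erase (i + 1).succ) =
      0 := by
  rw [bracket_form1]
  fin_cases i
  · have h1 (m) := congrFun (oddForm_mat_0 D g p s) m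
    have h2 (m) := congrFun (oddForm_der_0 D g p s) m
    have h1' (m) := congrFun (oddForm_mat_0 D' g' p' s') m
    have h2' (m) := congrFun (oddForm_der_0 D' g' p' s') m
    simp only [Fin.zero_eta, Fin.mk_one, Fin.reduceFinMk, Fin.isValue, Fin.reduceAdd,
      Fin.reduceSucc,
    erase_zero, erase_one, erase_two, erase_three, W1_zero, W1_one, W1_two]
    rw [rep_form2 _ _ (by decide) (by decide)]
    simp only [bracketCoeff_mat, Fin.sum_univ_four, h1, h2, h1', h2']
    simp [sgn_singleton, Fin.sum_univ_three]
    try ring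
  · have h1 (m) := congrFun (oddForm_mat_1 D g p s) m
    have h2 (m) := congrFun (oddForm_der_1 D g p s) m
    have h1' (m) := congrFun (oddForm_mat_1 D' g' p' s') m
    have h2' (m) := congrFun (oddForm_der_1 D' g' p' s') m
    simp only [Fin.zero_eta, Fin.mk_one, Fin.reduceFinMk, Fin.isValue, Fin.reduceAdd,
      Fin.reduceSucc,
    erase_zero, erase_one, erase_two, erase_three, W1_zero, W1_one, W1_two]
    rw [rep_form2 _ _ (by decide) (by decide)]
    simp only [bracketCoeff_mat, Fin.sum_univ_four, h1, h2, h1', h2']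
    simp [sgn_singleton, Fin.sum_univ_three]
    try ring
  · have h1 (m) := congrFun (oddForm_mat_2 D g p s) m
    have h2 (m) := congrFun (oddForm_der_2 D g p s) m
    have h1' (m) := congrFun (oddForm_mat_2 D' g' p' s') m
    have h2' (m) := congrFun (oddForm_der_2 D' g' p' s') m
    simp only [Fin.zero_eta, Fin.mk_one, Fin.reduceFinMk, Fin.isValue, Fin.reduceAdd,
      Fin.reduceSucc,
    erase_zero, erase_one, erase_two, erase_three, W1_zero, W1_one, W1_two]
    rw [rep_form2 _ _ (by decide) (by decide)]
    simp only [bracketCoeff_mat, Fin.sum_univ_four, h1, h2, h1', h2']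
    simp [sgn_singleton, Fin.sum_univ_three]
    try ring

theorem rep_succ_odd_odd' :
    rep (bracket (form1 (oddForm i D g p s)) (form1 (oddForm i D' g' p' s')))
        (theta {(i + 2).succ}) (Finset.univ.erase (i + 2).succ) =
      0 := by
  rw [bracket_form1]
  fin_cases i
  · have h1 (m) := congrFun (oddForm_mat_0 D g p s) m
    have h2 (m) := congrFun (oddForm_der_0 D g p s) m
    have h1' (m) := congrFun (oddForm_mat_0 D' g' p' s') m
    have h2' (m) := congrFun (oddForm_der_0 D' g' p' s') m
    simp only [Fin.zero_eta, Fin.mk_one, Fin.reduceFinMk, Fin.isValue, Fin.reduceAdd,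
      Fin.reduceSucc,
    erase_zero, erase_one, erase_two, erase_three, W1_zero, W1_one, W1_two]
    rw [rep_form2 _ _ (by decide) (by decide)]
    simp only [bracketCoeff_mat, Fin.sum_univ_four, h1, h2, h1', h2']
    simp [sgn_singleton, Fin.sum_univ_three]
    try ring
  · have h1 (m) := congrFun (oddForm_mat_1 D g p s) m
    have h2 (m) := congrFun (oddForm_der_1 D g p s) m
    have h1' (m) := congrFun (oddForm_mat_1 D' g' p' s') m
    have h2' (m) := congrFun (oddForm_der_1 D' g' p' s') m
    simp only [Fin.zero_eta, Fin.mk_one, Fin.reduceFinMk, Fin.isValue, Fin.reduceAdd,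
      Fin.reduceSucc,
    erase_zero, erase_one, erase_two, erase_three, W1_zero, W1_one, W1_two]
    rw [rep_form2 _ _ (by decide) (by decide)]
    simp only [bracketCoeff_mat, Fin.sum_univ_four, h1, h2, h1', h2']
    simp [sgn_singleton, Fin.sum_univ_three]
    try ring
  · have h1 (m) := congrFun (oddForm_mat_2 D g p s) m
    have h2 (m) := congrFun (oddForm_der_2 D g p s) m
    have h1' (m) := congrFun (oddForm_mat_2 D' g' p' s') m
    have h2' (m) := congrFun (oddForm_der_2 D' g' p' s') m
    simp only [Fin.zero_eta, Fin.mk_one, Fin.reduceFinMk, Fin.isValue, Fin.reduceAdd,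
      Fin.reduceSucc,
    erase_zero, erase_one, erase_two, erase_three, W1_zero, W1_one, W1_two]
    rw [rep_form2 _ _ (by decide) (by decide)]
    simp only [bracketCoeff_mat, Fin.sum_univ_four, h1, h2, h1', h2']
    simp [sgn_singleton, Fin.sum_univ_three]
    try ring

/-- This is where the commutator of the frame enters; together with `der_W1_even_odd` it yields the
structure functions. -/
theorem der_W1_odd_odd :
    ((bracket (form1 (oddForm (i + 1) D g p s)) (form1 (oddForm (i + 2) D' g' p' s'))) (W1 i)).der =
      sgn {(i + 1).succ} {(i + 2).succ} • (⁅D, D'⁆ - (g' + p') • D + (g - s) • D') := by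
  rw [bracket_form1]
  fin_cases i
  · have h1 (m) := congrFun (oddForm_mat_1 D g p s) m
    have h2 (m) := congrFun (oddForm_der_1 D g p s) m
    have h1' (m) := congrFun (oddForm_mat_2 D' g' p' s') m
    have h2' (m) := congrFun (oddForm_der_2 D' g' p' s') m
    simp only [Fin.zero_eta, Fin.mk_one, Fin.reduceFinMk, Fin.isValue, Fin.reduceAdd,
      Fin.reduceSucc,
    erase_zero, erase_one, erase_two, erase_three, W1_zero, W1_one, W1_two]
    rw [der_form2 _ (by decide)]
    simp only [bracketCoeff_der, Fin.sum_univ_four, h1, h2, h1', h2']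
    simp [sgn_singleton, Fin.sum_univ_three]
    try module
  · have h1 (m) := congrFun (oddForm_mat_2 D g p s) m
    have h2 (m) := congrFun (oddForm_der_2 D g p s) m
    have h1' (m) := congrFun (oddForm_mat_0 D' g' p' s') m
    have h2' (m) := congrFun (oddForm_der_0 D' g' p' s') m
    simp only [Fin.zero_eta, Fin.mk_one, Fin.reduceFinMk, Fin.isValue, Fin.reduceAdd,
      Fin.reduceSucc,
    erase_zero, erase_one, erase_two, erase_three, W1_zero, W1_one, W1_two]
    rw [der_form2 _ (by decide)]
    simp only [bracketCoeff_der, Fin.sum_univ_four, h1, h2, h1', h2']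
    simp [sgn_singleton, Fin.sum_univ_three]
    try module
  · have h1 (m) := congrFun (oddForm_mat_0 D g p s) m
    have h2 (m) := congrFun (oddForm_der_0 D g p s) m
    have h1' (m) := congrFun (oddForm_mat_1 D' g' p' s') m
    have h2' (m) := congrFun (oddForm_der_1 D' g' p' s') m
    simp only [Fin.zero_eta, Fin.mk_one, Fin.reduceFinMk, Fin.isValue, Fin.reduceAdd,
      Fin.reduceSucc,
    erase_zero, erase_one, erase_two, erase_three, W1_zero, W1_one, W1_two]
    rw [der_form2 _ (by decide)]
    simp only [bracketCoeff_der, Fin.sum_univ_four, h1, h2, h1', h2']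
    simp [sgn_singleton, Fin.sum_univ_three]
    try module

theorem trace_W1_odd_odd :
    ((bracket (form1 (oddForm (i + 1) D g p s)) (form1 (oddForm (i + 2) D' g' p' s'))) (W1 i)).mat.trace =
      sgn {(i + 1).succ} {(i + 2).succ} • (4 * (D g' - D' g - g * p' - g' * s)) := by
  rw [bracket_form1]
  fin_cases i
  · have h1 (m) := congrFun (oddForm_mat_1 D g p s) m
    have h2 (m) := congrFun (oddForm_der_1 D g p s) m
    have h1' (m) := congrFun (oddForm_mat_2 D' g' p' s') m
    have h2' (m) := congrFun (oddForm_der_2 D' g' p' s') m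
    simp only [Fin.zero_eta, Fin.mk_one, Fin.reduceFinMk, Fin.isValue, Fin.reduceAdd,
      Fin.reduceSucc,
    erase_zero, erase_one, erase_two, erase_three, W1_zero, W1_one, W1_two]
    rw [trace_form2 _ (by decide)]
    simp only [Matrix.trace, Matrix.diag_apply, bracketCoeff_mat, Fin.sum_univ_four, h1, h2, h1', h2']
    simp [sgn_singleton, Fin.sum_univ_three]
    try ring
  · have h1 (m) := congrFun (oddForm_mat_2 D g p s) m
    have h2 (m) := congrFun (oddForm_der_2 D g p s) m
    have h1' (m) := congrFun (oddForm_mat_0 D' g' p' s') m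
    have h2' (m) := congrFun (oddForm_der_0 D' g' p' s') m
    simp only [Fin.zero_eta, Fin.mk_one, Fin.reduceFinMk, Fin.isValue, Fin.reduceAdd,
      Fin.reduceSucc,
    erase_zero, erase_one, erase_two, erase_three, W1_zero, W1_one, W1_two]
    rw [trace_form2 _ (by decide)]
    simp only [Matrix.trace, Matrix.diag_apply, bracketCoeff_mat, Fin.sum_univ_four, h1, h2, h1', h2']
    simp [sgn_singleton, Fin.sum_univ_three]
    try ring
  · have h1 (m) := congrFun (oddForm_mat_0 D g p s) m
    have h2 (m) := congrFun (oddForm_der_0 D g p s) m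
    have h1' (m) := congrFun (oddForm_mat_1 D' g' p' s') m
    have h2' (m) := congrFun (oddForm_der_1 D' g' p' s') m
    simp only [Fin.zero_eta, Fin.mk_one, Fin.reduceFinMk, Fin.isValue, Fin.reduceAdd,
      Fin.reduceSucc,
    erase_zero, erase_one, erase_two, erase_three, W1_zero, W1_one, W1_two]
    rw [trace_form2 _ (by decide)]
    simp only [Matrix.trace, Matrix.diag_apply, bracketCoeff_mat, Fin.sum_univ_four, h1, h2, h1', h2']
    simp [sgn_singleton, Fin.sum_univ_three]
    try ring

theorem rep_zero_W1_odd_odd :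
    rep (bracket (form1 (oddForm (i + 1) D g p s)) (form1 (oddForm (i + 2) D' g' p' s')))
        (theta {0}) (Finset.univ.erase i.succ) =
      0 := by
  rw [bracket_form1]
  fin_cases i
  · have h1 (m) := congrFun (oddForm_mat_1 D g p s) m
    have h2 (m) := congrFun (oddForm_der_1 D g p s) m
    have h1' (m) := congrFun (oddForm_mat_2 D' g' p' s') m
    have h2' (m) := congrFun (oddForm_der_2 D' g' p' s') m
    simp only [Fin.zero_eta, Fin.mk_one, Fin.reduceFinMk, Fin.isValue, Fin.reduceAdd,
      Fin.reduceSucc,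
    erase_zero, erase_one, erase_two, erase_three, W1_zero, W1_one, W1_two]
    rw [rep_form2 _ _ (by decide) (by decide)]
    simp only [bracketCoeff_mat, Fin.sum_univ_four, h1, h2, h1', h2']
    simp [sgn_singleton, Fin.sum_univ_three]
    try ring
  · have h1 (m) := congrFun (oddForm_mat_2 D g p s) m
    have h2 (m) := congrFun (oddForm_der_2 D g p s) m
    have h1' (m) := congrFun (oddForm_mat_0 D' g' p' s') m
    have h2' (m) := congrFun (oddForm_der_0 D' g' p' s') m
    simp only [Fin.zero_eta, Fin.mk_one, Fin.reduceFinMk, Fin.isValue, Fin.reduceAdd,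
      Fin.reduceSucc,
    erase_zero, erase_one, erase_two, erase_three, W1_zero, W1_one, W1_two]
    rw [rep_form2 _ _ (by decide) (by decide)]
    simp only [bracketCoeff_mat, Fin.sum_univ_four, h1, h2, h1', h2']
    simp [sgn_singleton, Fin.sum_univ_three]
    try ring
  · have h1 (m) := congrFun (oddForm_mat_0 D g p s) m
    have h2 (m) := congrFun (oddForm_der_0 D g p s) m
    have h1' (m) := congrFun (oddForm_mat_1 D' g' p' s') m
    have h2' (m) := congrFun (oddForm_der_1 D' g' p' s') m
    simp only [Fin.zero_eta, Fin.mk_one, Fin.reduceFinMk, Fin.isValue, Fin.reduceAdd,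
      Fin.reduceSucc,
    erase_zero, erase_one, erase_two, erase_three, W1_zero, W1_one, W1_two]
    rw [rep_form2 _ _ (by decide) (by decide)]
    simp only [bracketCoeff_mat, Fin.sum_univ_four, h1, h2, h1', h2']
    simp [sgn_singleton, Fin.sum_univ_three]
    try ring

/-- Combined with `rep_self_even_odd` this becomes, up to multiples of t, the Jacobi identity of the
frame. -/
theorem rep_self_W1_odd_odd :
    rep (bracket (form1 (oddForm (i + 1) D g p s)) (form1 (oddForm (i + 2) D' g' p' s')))
        (theta {i.succ}) (Finset.univ.erase 0) =
      D g' - D s' - D' g - D' p - g * (p' + s') - g' * (p + s) - p * p' + s * s' := by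
  rw [bracket_form1]
  fin_cases i
  · have h1 (m) := congrFun (oddForm_mat_1 D g p s) m
    have h2 (m) := congrFun (oddForm_der_1 D g p s) m
    have h1' (m) := congrFun (oddForm_mat_2 D' g' p' s') m
    have h2' (m) := congrFun (oddForm_der_2 D' g' p' s') m
    simp only [Fin.zero_eta, Fin.mk_one, Fin.reduceFinMk, Fin.isValue, Fin.reduceAdd,
      Fin.reduceSucc,
    erase_zero, erase_one, erase_two, erase_three, W1_zero, W1_one, W1_two]
    rw [rep_form2 _ _ (by decide) (by decide)]
    simp only [bracketCoeff_mat, Fin.sum_univ_four, h1, h2, h1', h2']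
    simp [sgn_singleton, Fin.sum_univ_three]
    try ring
  · have h1 (m) := congrFun (oddForm_mat_2 D g p s) m
    have h2 (m) := congrFun (oddForm_der_2 D g p s) m
    have h1' (m) := congrFun (oddForm_mat_0 D' g' p' s') m
    have h2' (m) := congrFun (oddForm_der_0 D' g' p' s') m
    simp only [Fin.zero_eta, Fin.mk_one, Fin.reduceFinMk, Fin.isValue, Fin.reduceAdd,
      Fin.reduceSucc,
    erase_zero, erase_one, erase_two, erase_three, W1_zero, W1_one, W1_two]
    rw [rep_form2 _ _ (by decide) (by decide)]
    simp only [bracketCoeff_mat, Fin.sum_univ_four, h1, h2, h1', h2']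
    simp [sgn_singleton, Fin.sum_univ_three]
    try ring
  · have h1 (m) := congrFun (oddForm_mat_0 D g p s) m
    have h2 (m) := congrFun (oddForm_der_0 D g p s) m
    have h1' (m) := congrFun (oddForm_mat_1 D' g' p' s') m
    have h2' (m) := congrFun (oddForm_der_1 D' g' p' s') m
    simp only [Fin.zero_eta, Fin.mk_one, Fin.reduceFinMk, Fin.isValue, Fin.reduceAdd,
      Fin.reduceSucc,
    erase_zero, erase_one, erase_two, erase_three, W1_zero, W1_one, W1_two]
    rw [rep_form2 _ _ (by decide) (by decide)]
    simp only [bracketCoeff_mat, Fin.sum_univ_four, h1, h2, h1', h2']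
    simp [sgn_singleton, Fin.sum_univ_three]
    try ring

end Evaluate
end BKL
end

/-! ### Sectors of the coefficients and expansion of the bracket [x,x]. -/

noncomputable section
namespace BKL
section Expansion
variable {A : Type*} [CommRing A] [Algebra ℝ A]

/-! ### Parities of the degree one elements -/

/-- The coefficients of a degree one element with the parities of `θ_c`. -/
def FormSector (c : Fin 4) (δ : Fin 4 → CDer A) : Prop :=
  ∀ n m, δ m ∈ parCDer (W1 n) (({m} ∩ W1 n).card + ({c} ∩ W1 n).card)

theorem zero_inter_W1 (n : Fin 3) : ({0} ∩ W1 n).card = 0 := by revert n; decide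

theorem succ_inter_W1 (i n : Fin 3) : (({(i + 1).succ} ∩ W1 n).card +
    ({(i + 2).succ} ∩ W1 n).card + ({i.succ} ∩ W1 n).card) % 2 = 0 := by
  revert i n; decide

theorem ofDer_mem_parCDer (X : Derivation ℝ A A) (T : Finset (Fin 4)) {k : ℕ} (hk : k % 2 = 0) :
    ofDer X ∈ parCDer T k :=
  mem_parCDer.2 ⟨fun h => by omega, fun _ _ _ => rfl⟩

theorem sigma0_mem_parCDer (T : Finset (Fin 4)) {k : ℕ} (hk : k % 2 = 0) :
    (sigma0 : CDer A) ∈ parCDer T k := by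
  refine mem_parCDer.2 ⟨fun h => by omega, fun i j h => ?_⟩
  rw [mat_sigma0, Matrix.one_apply_ne]
  rintro rfl
  omega

theorem single_apply_eq_zero {i j i' j' : Fin 4} (h : ¬ (i = i' ∧ j = j')) :
    Matrix.single i j (1 : A) i' j' = 0 := by
  rw [Matrix.single_apply, if_neg h]

theorem boost_mem_parCDer (i n : Fin 3) {k : ℕ} (hk : (k + ({i.succ} ∩ W1 n).card) % 2 = 0) :
    (boost i : CDer A) ∈ parCDer (W1 n) k := by
  have h0 := zero_inter_W1 n
  refine mem_parCDer.2 ⟨fun _ => rfl, fun a b h => ?_⟩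
  rw [mat_boost, Matrix.add_apply, single_apply_eq_zero, single_apply_eq_zero, add_zero]
  · rintro ⟨rfl, rfl⟩; omega
  · rintro ⟨rfl, rfl⟩; omega

theorem rot_mem_parCDer (i n : Fin 3) {k : ℕ} (hk : (k + ({i.succ} ∩ W1 n).card) % 2 = 0) :
    (rot i : CDer A) ∈ parCDer (W1 n) k := by
  have h0 := succ_inter_W1 i n
  refine mem_parCDer.2 ⟨fun _ => rfl, fun a b h => ?_⟩
  rw [mat_rot, Matrix.sub_apply, single_apply_eq_zero, single_apply_eq_zero, sub_zero]
  · rintro ⟨rfl, rfl⟩; omega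
  · rintro ⟨rfl, rfl⟩; omega

theorem evenForm_sector (X : Derivation ℝ A A) (a : A) (b r : Fin 3 → A) :
    FormSector 0 (evenForm X a b r) := by
  intro n m
  have h0 := zero_inter_W1 n
  refine Fin.cases ?_ (fun i => ?_) m
  · exact Submodule.add_mem _ (ofDer_mem_parCDer _ _ (by omega))
      (Submodule.smul_mem _ _ (sigma0_mem_parCDer _ (by omega)))
  · exact Submodule.add_mem _ (Submodule.smul_mem _ _ (boost_mem_parCDer i _ (by omega)))
      (Submodule.smul_mem _ _ (rot_mem_parCDer i _ (by omega)))

theorem oddForm_sector (i : Fin 3) (X : Derivation ℝ A A) (g r s : A) :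
    FormSector i.succ (oddForm i X g r s) := by
  intro n m
  have h0 := zero_inter_W1 n
  refine Fin.cases ?_ (fun l => ?_) m
  · exact Submodule.smul_mem _ _ (boost_mem_parCDer _ _ (by omega))
  · change (if l = i then ofDer X + g • sigma0
      else if l = i + 1 then s • rot (i + 2) else r • rot (i + 1)) ∈ _
    split_ifs with h1 h2
    · subst h1
      exact Submodule.add_mem _ (ofDer_mem_parCDer _ _ (by omega))
        (Submodule.smul_mem _ _ (sigma0_mem_parCDer _ (by omega)))
    · subst h2
      have := succ_inter_W1 i n
      exact Submodule.smul_mem _ _ (rot_mem_parCDer _ _ (by omega))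
    · obtain rfl : l = i + 2 := by revert i l; decide
      have := succ_inter_W1 i n
      exact Submodule.smul_mem _ _ (rot_mem_parCDer _ _ (by omega))

theorem parityL_congr {T : Finset (Fin 4)} {p q : ℕ} (h : p % 2 = q % 2) :
    parityL (A := A) T p = parityL T q := by rw [parityL, parityL, h]

theorem FormSector.inSector {c : Fin 4} {δ : Fin 4 → CDer A} (h : FormSector c δ) :
    InSector c (form1 δ) :=
  fun n => form1_mem_parityL (h n)

theorem FormSector.bracket {c c' c'' : Fin 4} {δ ε : Fin 4 → CDer A} (hδ : FormSector c δ)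
    (hε : FormSector c' ε) (h : Compat c'' c c') :
    InSector c'' (bracket (form1 δ) (form1 ε)) := by
  intro n
  have := h n
  rw [parityL_congr (q := ({c} ∩ W1 n).card + ({c'} ∩ W1 n).card) (by omega)]
  exact bracket_mem_parityL (hδ n) (hε n)

/-! ### Biadditivity and symmetry of the bracket -/

theorem bracketCDer_add (δ ε ε' : CDer A) :
    δ.bracket (ε + ε') = δ.bracket ε + δ.bracket ε' := by
  apply CDer.ext'
  · rw [der_add, der_bracket, der_bracket, der_bracket, der_add, lie_add]
  · ext i j
    simp [Matrix.mul_add, Matrix.add_mul]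
    ring

theorem add_bracketCDer (δ δ' ε : CDer A) :
    (δ + δ').bracket ε = δ.bracket ε + δ'.bracket ε := by
  apply CDer.ext'
  · rw [der_add, der_bracket, der_bracket, der_bracket, der_add, add_lie]
  · ext i j
    simp [Matrix.mul_add, Matrix.add_mul]
    ring

theorem bracketCDer_comm (δ ε : CDer A) : δ.bracket ε = -ε.bracket δ := by
  apply CDer.ext'
  · rw [der_neg, der_bracket, der_bracket, lie_skew]
  · ext i j
    simp
    ring

theorem add_tens (u v : ExtW A) (δ : CDer A) : tens (u + v) δ = tens u δ + tens v δ :=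
  funext fun _ => add_smul _ _ _

theorem bracket_add (x y y' : L A) : bracket x (y + y') = bracket x y + bracket x y' := by
  simp only [bracket, ← Finset.sum_add_distrib, Pi.add_apply, act_add, wedge_add, tens_add,
    add_tens, bracketCDer_add, smul_add]
  refine Finset.sum_congr rfl fun J _ => Finset.sum_congr rfl fun K _ => ?_
  abel

theorem add_bracket (x x' y : L A) : bracket (x + x') y = bracket x y + bracket x' y := by
  simp only [bracket, ← Finset.sum_add_distrib, Pi.add_apply, act_add, wedge_add, tens_add,
    add_tens, add_bracketCDer, smul_add]
  refine Finset.sum_congr rfl fun J _ => Finset.sum_congr rfl fun K _ => ?_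
  abel

/-- The graded bracket is symmetric in degree one. The coefficients Y_{ab} are symmetric in the two
arguments only after antisymmetrization in a and b. -/
theorem bracket_comm (δ ε : Fin 4 → CDer A) :
    bracket (form1 ε) (form1 δ) = bracket (form1 δ) (form1 ε) := by
  have h (a b) : bracketCoeff ε δ a b - bracketCoeff ε δ b a =
      bracketCoeff δ ε a b - bracketCoeff δ ε b a := by
    simp only [bracketCoeff]
    rw [bracketCDer_comm (ε a), bracketCDer_comm (ε b)]
    abel
  funext J
  rw [bracket_form1, bracket_form1]
  by_cases hJ : J.card = 2
  · obtain ⟨a, b, hab, rfl⟩ := Finset.card_eq_two.1 hJ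
    rcases hab.lt_or_gt with h' | h'
    · rw [form2_pair _ h', form2_pair _ h', h]
    · rw [Finset.pair_comm, form2_pair _ h', form2_pair _ h', h]
  · rw [form2_isDeg _ J hJ, form2_isDeg _ J hJ]

theorem mon_add (α : Fin 3 → ℕ) (v w : L A) : mon α (v + w) = mon α v + mon α w :=
  Pi.single_add _ _ _

theorem mon_zero (α : Fin 3 → ℕ) : mon α (0 : L A) = 0 := Pi.single_zero _

theorem serBracket_add (x y y' : Ser (L A)) :
    serBracket x (y + y') = serBracket x y + serBracket x y' := by
  funext α
  simp only [serBracket, Pi.add_apply (f := y), bracket_add, Finset.sum_add_distrib]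
  rfl

theorem add_serBracket (x x' y : Ser (L A)) :
    serBracket (x + x') y = serBracket x y + serBracket x' y := by
  funext α
  simp only [serBracket, Pi.add_apply (f := x), add_bracket, Finset.sum_add_distrib]
  rfl

theorem bracket_zero_right (x : L A) : bracket x 0 = 0 := by
  simpa using bracket_add x 0 0

theorem bracket_zero_left (x : L A) : bracket 0 x = 0 := by
  simpa using add_bracket 0 0 x

theorem serBracket_mon (α β : Fin 3 → ℕ) (u v : L A) :
    serBracket (mon α u) (mon β v) = mon (α + β) (bracket u v) := by
  funext κ
  rw [serBracket]
  by_cases h : α ≤ κ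
  · rw [Finset.sum_eq_single α]
    · by_cases h' : κ = α + β
      · subst h'
        simp [mon]
      · rw [mon, mon, mon, Pi.single_eq_of_ne h', Pi.single_eq_of_ne (i := β), bracket_zero_right]
        rintro rfl
        exact h' (add_tsub_cancel_of_le h).symm
    · intro γ _ hγ
      rw [mon, Pi.single_eq_of_ne hγ, bracket_zero_left]
    · simp [h]
  · rw [mon, mon, mon, Pi.single_eq_of_ne (i := α + β), Finset.sum_eq_zero]
    · intro γ hγ
      rw [Pi.single_eq_of_ne, bracket_zero_left]
      rintro rfl
      exact h (Finset.mem_Iic.1 hγ)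
    · rintro rfl
      exact h le_self_add

/-- The elements of `L[[s_1,s_2,s_3]]` that occur in the affine gauge subspace. -/
def gaugeSer (u : L A) (p q : Fin 3 → L A) : Ser (L A) :=
  mon 0 u + ∑ i, (mon (expSq i) (p i) + mon (expCross i) (q i))

theorem expSq_add_expSq (i : Fin 3) :
    expSq (i + 1) + expSq (i + 2) = expCross i + expCross i := by
  revert i; decide

theorem expCross_add_expCross (i : Fin 3) :
    expCross (i + 1) + expCross (i + 2) = expSq i + expCross i := by
  revert i; decide

/-- Two coincidences of exponents govern the grouping: s_j² · s_k² = (s_j s_k)², which joins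
[q_i,q_i] with [p_j,p_k], and (s_k s_i)(s_i s_j) = s_i² s_j s_k, which joins [q_j,q_k] with
[p_i,q_i]. -/
theorem serBracket_gaugeSer {u : Fin 4 → CDer A} {p q : Fin 3 → Fin 4 → CDer A} :
    serBracket (gaugeSer (form1 u) (fun i => form1 (p i)) fun i => form1 (q i))
      (gaugeSer (form1 u) (fun i => form1 (p i)) fun i => form1 (q i)) =
    mon 0 (bracket (form1 u) (form1 u)) + ∑ i,
      (mon (expSq i) (bracket (form1 u) (form1 (p i)) + bracket (form1 u) (form1 (p i))) +
      mon (expCross i) (bracket (form1 u) (form1 (q i)) + bracket (form1 u) (form1 (q i))) +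
      (mon (expSq i + expCross i)
        ((bracket (form1 (p i)) (form1 (q i)) + bracket (form1 (q (i + 1))) (form1 (q (i + 2)))) +
        (bracket (form1 (p i)) (form1 (q i)) + bracket (form1 (q (i + 1))) (form1 (q (i + 2))))) +
      mon (expCross i + expCross i) (bracket (form1 (q i)) (form1 (q i)) +
        (bracket (form1 (p (i + 1))) (form1 (p (i + 2))) +
          bracket (form1 (p (i + 1))) (form1 (p (i + 2)))))) +
      (mon (expSq i + expSq i) (bracket (form1 (p i)) (form1 (p i))) +
      mon (expSq i + expCross (i + 1))
        (bracket (form1 (p i)) (form1 (q (i + 1))) + bracket (form1 (p i)) (form1 (q (i + 1)))) +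
      mon (expSq i + expCross (i + 2))
        (bracket (form1 (p i)) (form1 (q (i + 2))) +
          bracket (form1 (p i)) (form1 (q (i + 2)))))) := by
  have s0 := expSq_add_expSq 0
  have s1 := expSq_add_expSq 1
  have s2 := expSq_add_expSq 2
  have c0 := expCross_add_expCross 0
  have c1 := expCross_add_expCross 1
  have c2 := expCross_add_expCross 2
  simp only [Fin.isValue, Fin.reduceAdd, zero_add] at s0 s1 s2 c0 c1 c2
  simp only [gaugeSer, Fin.sum_univ_three, serBracket_add, add_serBracket, serBracket_mon,
    zero_add, add_zero, Fin.isValue, Fin.reduceAdd, mon_add]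
  have comm (α β : Fin 3 → ℕ) (δ ε : Fin 4 → CDer A) :
      mon (α + β) (bracket (form1 δ) (form1 ε)) = mon (β + α) (bracket (form1 ε) (form1 δ)) := by
    rw [add_comm, bracket_comm]
  have comm0 (α : Fin 3 → ℕ) (δ : Fin 4 → CDer A) :
      mon α (bracket (form1 δ) (form1 u)) = mon α (bracket (form1 u) (form1 δ)) := by
    rw [bracket_comm]
  -- Each mixed bracket occurs in both orders; one order is chosen so that equal terms combine into
  -- doubled ones.
  rw [comm0 _ (p 0), comm0 _ (p 1), comm0 _ (p 2), comm0 _ (q 0), comm0 _ (q 1), comm0 _ (q 2),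
    comm (expSq 1) (expSq 0), comm (expSq 2) (expSq 1), comm (expSq 0) (expSq 2),
    comm (expCross 1) (expCross 0), comm (expCross 2) (expCross 1),
    comm (expCross 0) (expCross 2)]
  simp only [comm (expCross _) (expSq _), s0, s1, s2, c0, c1, c2]
  abel

end Expansion
end BKL
end

/-! ### Necessary and sufficient conditions for the Maurer-Cartan equation. -/

noncomputable section
namespace BKL
section MaurerCartan
variable {A : Type*} [CommRing A] [Algebra ℝ A]

theorem mon_self (α : Fin 3 → ℕ) (v : L A) : mon α v α = v := Pi.single_eq_same _ _

theorem mon_of_ne {α κ : Fin 3 → ℕ} (h : α ≠ κ) (v : L A) : mon κ v α = 0 :=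
  Pi.single_eq_of_ne h _

section Coefficients

variable {u : Fin 4 → CDer A} {p q : Fin 3 → Fin 4 → CDer A} {x : Ser (L A)}
  (hx : x = gaugeSer (form1 u) (fun i => form1 (p i)) fun i => form1 (q i))
include hx

theorem serBracket_coeff_zero : serBracket x x 0 = bracket (form1 u) (form1 u) := by
  rw [hx, serBracket_gaugeSer, Fin.sum_univ_three]
  simp only [Pi.add_apply, Fin.isValue, Fin.reduceAdd, zero_add]
  simp (disch := decide) only [mon_self, mon_of_ne, add_zero]

theorem serBracket_coeff_expSq (i : Fin 3) : serBracket x x (expSq i) =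
    bracket (form1 u) (form1 (p i)) + bracket (form1 u) (form1 (p i)) := by
  rw [hx, serBracket_gaugeSer, Fin.sum_univ_three]
  fin_cases i <;>
  · simp only [Pi.add_apply, Fin.isValue, Fin.reduceAdd, zero_add, Fin.zero_eta, Fin.mk_one,
      Fin.reduceFinMk]
    simp (disch := decide) only [mon_self, mon_of_ne, add_zero, zero_add]

theorem serBracket_coeff_expCross (i : Fin 3) : serBracket x x (expCross i) =
    bracket (form1 u) (form1 (q i)) + bracket (form1 u) (form1 (q i)) := by
  rw [hx, serBracket_gaugeSer, Fin.sum_univ_three]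
  fin_cases i <;>
  · simp only [Pi.add_apply, Fin.isValue, Fin.reduceAdd, zero_add, Fin.zero_eta, Fin.mk_one,
      Fin.reduceFinMk]
    simp (disch := decide) only [mon_self, mon_of_ne, add_zero, zero_add]

theorem serBracket_coeff_mixed (i : Fin 3) : serBracket x x (expSq i + expCross i) =
    (bracket (form1 (p i)) (form1 (q i)) + bracket (form1 (q (i + 1))) (form1 (q (i + 2)))) +
    (bracket (form1 (p i)) (form1 (q i)) + bracket (form1 (q (i + 1))) (form1 (q (i + 2)))) := by
  rw [hx, serBracket_gaugeSer, Fin.sum_univ_three]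
  fin_cases i <;>
  · simp only [Pi.add_apply, Fin.isValue, Fin.reduceAdd, zero_add, Fin.zero_eta, Fin.mk_one,
      Fin.reduceFinMk]
    simp (disch := decide) only [mon_self, mon_of_ne, add_zero, zero_add]

end Coefficients

theorem isUnit_ofNat (n : ℕ) (hn : n ≠ 0) : IsUnit (n : A) := by
  have := (IsUnit.mk0 (n : ℝ) (by exact_mod_cast hn)).map (algebraMap ℝ A)
  simpa using this

theorem eq_zero_of_add_self {a : A} (h : a + a = 0) : a = 0 := by
  have h2 := isUnit_ofNat (A := A) 2 (by norm_num)
  rw [← two_mul] at h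
  exact (h2.mul_right_eq_zero).1 (by exact_mod_cast h)

theorem W1_inter_W1 : ∀ i n : Fin 3, i ≠ n → (W1 i ∩ W1 n).card = 1 := by decide

theorem succ_mem_W1 : ∀ i n : Fin 3, i ≠ n → (({i.succ} : Finset (Fin 4)) ∩ W1 n).card = 1 := by
  decide

theorem W1_inter_self (n : Fin 3) : (W1 n ∩ W1 n).card = 2 := by
  rw [Finset.inter_self, W1_card]

theorem W1_ne_empty (i : Fin 3) : W1 i ≠ ∅ := by revert i; decide

section Necessary

variable {x : Ser (L A)} (hx : toE x ∈ sIdeal A)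
include hx

theorem apply_zero_of_sIdeal {l : L A →ₗ[A] A} (hl : weylIdeal A ≤ LinearMap.ker l) :
    l (x 0) = 0 :=
  apply_eq_zero_of_sIdeal hl hx fun _ hi => absurd rfl hi

/-- Dividing s_i² by s_i leaves index 1 in the i-th decomposition. The even part of F_1 lies in
F_{◁0}, which kills this component, and the odd part has the wrong parity. -/
theorem rep_expSq_of_sIdeal (i : Fin 3) :
    rep (x (expSq i)) (theta {i.succ}) (Finset.univ.erase i.succ) = 0 := by
  have hl := weylIdeal_le_repFun (A := A) i.succ (M := Finset.univ.erase i.succ)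
    (by rw [Finset.card_erase_of_mem (Finset.mem_univ _)]; rfl)
  have hc := card_erase_inter_W1 i.succ i
  have hs : (({i.succ} : Finset (Fin 4)) ∩ W1 i).card = 0 := by
    rw [Finset.singleton_inter_of_notMem (succ_notMem_W1 i), Finset.card_empty]
  refine apply_eq_zero_of_sIdeal hl hx fun n hn => ?_
  obtain rfl : n = i := by
    by_contra h
    exact hn (by simp [expSq, Pi.single_eq_of_ne h])
  refine F3_le_of_one hl (n := n) (by simp [expSq]) (fun y hy => ?_) fun y hy => ?_
  · exact FTriL_zero_rep (Finset.card_pos.1 (by omega)) (succ_notMem_W1 n) hy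
  · exact repFun_of_parity hy (by omega)

/-- Dividing s_j s_k by one of its symbols leaves index 0 in that decomposition, hence even
elements, whereas the components of interest are odd there. -/
theorem expCross_of_sIdeal (i : Fin 3) {l : L A →ₗ[A] A} (hl : weylIdeal A ≤ LinearMap.ker l)
    (h : ∀ n, i ≠ n → ∀ y ∈ parityL (W1 n) 0, l y = 0) : l (x (expCross i)) = 0 := by
  refine apply_eq_zero_of_sIdeal hl hx fun n hn => ?_
  have h1 : expCross i n = 1 ∧ i ≠ n := by
    clear * - hn
    revert i n; decide
  exact F3_le_of_even hl (n := n) (by simp [h1.1]) (h n h1.2)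

/-- Division by s_j or s_k leaves index 0 and is excluded by parity, as at s_j s_k. Division by s_i
leaves index 1 in the i-th decomposition, so the functional must also vanish on F_{◁0} and on the
odd elements there. -/
theorem mixed_of_sIdeal (i : Fin 3) {l : L A →ₗ[A] A} (hl : weylIdeal A ≤ LinearMap.ker l)
    (h : ∀ n, i ≠ n → ∀ y ∈ parityL (W1 n) 0, l y = 0)
    (h0 : ∀ y ∈ FTriL (W1 i) 0, l y = 0) (h1 : ∀ y ∈ parityL (W1 i) 1, l y = 0) :
    l (x (expSq i + expCross i)) = 0 := by
  refine apply_eq_zero_of_sIdeal hl hx fun n hn => ?_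
  by_cases hni : i = n
  · subst hni
    refine F3_le_of_one hl (n := i) ?_ h0 h1
    clear * -
    revert i; decide
  · refine F3_le_of_even hl (n := n) ?_ (h n hni)
    clear * - hni
    revert i n; decide

theorem trace_mixed_of_sIdeal (i : Fin 3) :
    (x (expSq i + expCross i) (W1 i)).mat.trace = 0 := by
  refine mixed_of_sIdeal hx i (weylIdeal_le_trFun (W1_card i)) (fun n hn y hy => ?_)
    (fun y hy => ?_) fun y hy => ?_
  · exact trace_of_odd (mem_parityL.1 hy (W1 i)) (by rw [W1_inter_W1 i n hn])
  · exact FTriL_zero_trace (W1_ne_empty i) hy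
  · exact trace_of_odd (mem_parityL.1 hy (W1 i)) (by rw [W1_inter_self])

theorem der_mixed_of_sIdeal (i : Fin 3) (f : A) :
    (x (expSq i + expCross i) (W1 i)).der f = 0 := by
  refine mixed_of_sIdeal hx i (weylIdeal_le_derFun (W1_card i) f) (fun n hn y hy => ?_)
    (fun y hy => ?_) fun y hy => ?_
  · change (y (W1 i)).der f = 0
    rw [(mem_parCDer.1 (mem_parityL.1 hy (W1 i))).1 (by rw [W1_inter_W1 i n hn])]
    rfl
  · change (y (W1 i)).der f = 0
    rw [FTriL_zero_der (W1_ne_empty i) hy]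
    rfl
  · change (y (W1 i)).der f = 0
    rw [(mem_parCDer.1 (mem_parityL.1 hy (W1 i))).1 (by rw [W1_inter_self])]
    rfl

theorem trace_expCross_of_sIdeal (i : Fin 3) :
    (x (expCross i) {0, i.succ}).mat.trace = 0 := by
  have hne : (0 : Fin 4) ≠ i.succ := (Fin.succ_ne_zero i).symm
  refine expCross_of_sIdeal hx i (weylIdeal_le_trFun (Finset.card_pair hne)) fun n hn y hy => ?_
  refine trace_of_odd (mem_parityL.1 hy {0, i.succ}) ?_
  rw [card_insert_inter (by simpa using hne), succ_mem_W1 i n hn, zero_inter_W1]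

theorem ric_expCross_of_sIdeal (i : Fin 3) : ricFun 0 i.succ (x (expCross i)) = 0 := by
  refine expCross_of_sIdeal hx i (weylIdeal_le_ricFun _ _) fun n hn y hy => ?_
  exact ricFun_of_parity hy (by rw [succ_mem_W1 i n hn, zero_inter_W1])

theorem rep_expCross_of_sIdeal (i : Fin 3) {j m : Fin 4} (h : Compat i.succ j m) :
    rep (x (expCross i)) (theta {j}) (Finset.univ.erase m) = 0 := by
  refine expCross_of_sIdeal hx i (weylIdeal_le_repFun j
    (by rw [Finset.card_erase_of_mem (Finset.mem_univ _)]; rfl)) fun n hn y hy => ?_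
  have h1 := h n
  rw [succ_mem_W1 i n hn] at h1
  have h2 := card_erase_inter_W1 m n
  exact repFun_of_parity hy (by omega)

end Necessary

/-! ### Sufficient conditions -/

theorem compat_zero {j m : Fin 4} (h : Compat 0 j m) : j = m := by revert j m; decide

theorem card_singleton_inter_W1 : ∀ (a : Fin 4) (n : Fin 3), (({a} : Finset (Fin 4)) ∩ W1 n).card =
    if a = 0 ∨ a = n.succ then 0 else 1 := by decide

theorem compat_succ {i : Fin 3} {a b : Fin 4} (h : Compat i.succ a b) :
    (a = 0 ∧ b = i.succ) ∨ (a = i.succ ∧ b = 0) ∨ (a = (i + 1).succ ∧ b = (i + 2).succ) ∨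
      (a = (i + 2).succ ∧ b = (i + 1).succ) := by
  have h0 := h 0
  have h1 := h 1
  have h2 := h 2
  simp only [card_singleton_inter_W1] at h0 h1 h2
  clear h
  revert i a b; decide

theorem compat_succ_W1 {i : Fin 3} {a b : Fin 4} (hab : a < b) (h : Compat i.succ a b) :
    ({a, b} : Finset (Fin 4)) = {0, i.succ} ∨ ({a, b} : Finset (Fin 4)) = W1 i := by
  rcases compat_succ h with ⟨rfl, rfl⟩ | ⟨rfl, rfl⟩ | ⟨rfl, rfl⟩ | ⟨rfl, rfl⟩
  · exact Or.inl rfl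
  · exact absurd hab (Fin.not_lt_zero _)
  · right; clear * -; revert i; decide
  · right; clear * -; revert i; decide

theorem bracket_isDeg (δ ε : Fin 4 → CDer A) : IsDeg 2 (bracket (form1 δ) (form1 ε)) := by
  rw [bracket_form1]
  exact form2_isDeg _

theorem isWeyl_of_sector_zero {y : L A} (hd : IsDeg 2 y) (hy : InSector 0 y)
    (hric : ∀ b, ricFun b b y = 0) (hrep : ∀ j, rep y (theta {j}) (Finset.univ.erase j) = 0) :
    IsWeyl y := by
  refine isWeyl_of_inSector hd hy (fun a b hab h => ?_) (fun a b hab h => ?_) (fun b i h => ?_)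
    fun j m h => ?_
  · exact absurd (compat_zero h) hab.ne
  · exact absurd (compat_zero h) hab.ne
  · rw [compat_zero h]; exact hric _
  · rw [compat_zero h]; exact hrep _

/-- The compatible pairs are {0, i} and {j, k}. They leave two derivations, two traces, and, with
the pairs ordered, four Ricci and four Bianchi components. -/
theorem isWeyl_of_sector_succ {i : Fin 3} {y : L A} (hd : IsDeg 2 y) (hy : InSector i.succ y)
    (hder0 : (y {0, i.succ}).der = 0) (hder1 : (y (W1 i)).der = 0)
    (htr0 : (y {0, i.succ}).mat.trace = 0) (htr1 : (y (W1 i)).mat.trace = 0)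
    (hric0 : ricFun 0 i.succ y = 0) (hric1 : ricFun i.succ 0 y = 0)
    (hric2 : ricFun (i + 1).succ (i + 2).succ y = 0)
    (hric3 : ricFun (i + 2).succ (i + 1).succ y = 0)
    (hrep0 : rep y (theta {0}) (Finset.univ.erase i.succ) = 0)
    (hrep1 : rep y (theta {i.succ}) (Finset.univ.erase 0) = 0)
    (hrep2 : rep y (theta {(i + 1).succ}) (Finset.univ.erase (i + 2).succ) = 0)
    (hrep3 : rep y (theta {(i + 2).succ}) (Finset.univ.erase (i + 1).succ) = 0) : IsWeyl y := by
  refine isWeyl_of_inSector hd hy (fun a b hab h => ?_) (fun a b hab h => ?_) (fun b i h => ?_)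
    fun j m h => ?_
  · rcases compat_succ_W1 hab h with h | h <;> rw [h]
    exacts [hder0, hder1]
  · rcases compat_succ_W1 hab h with h | h <;> rw [h]
    exacts [htr0, htr1]
  · rcases compat_succ h with ⟨rfl, rfl⟩ | ⟨rfl, rfl⟩ | ⟨rfl, rfl⟩ | ⟨rfl, rfl⟩
    exacts [hric0, hric1, hric2, hric3]
  · rcases compat_succ h with ⟨rfl, rfl⟩ | ⟨rfl, rfl⟩ | ⟨rfl, rfl⟩ | ⟨rfl, rfl⟩
    exacts [hrep0, hrep1, hrep2, hrep3]

theorem expSq_self (i : Fin 3) : expSq i i ≠ 0 := by simp [expSq]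

theorem toE_gauge_mem_PFree {u : L A} {p q : Fin 3 → L A}
    (hu : (weylIdeal A).mkQ u ∈ F3 (A := A) 0)
    (hp : ∀ i, (weylIdeal A).mkQ (p i) ∈ F3 (A := A) (expSq i))
    (hq : ∀ i, (weylIdeal A).mkQ (q i) ∈ F3 (A := A) (expCross i)) :
    toE (gaugeSer u p q) ∈ PFree A := by
  rw [gaugeSer, toE_add, toE_sum]
  refine Submodule.add_mem _ (toE_mon_mem_PFree hu) (Submodule.sum_mem _ fun i _ => ?_)
  rw [toE_add]
  exact Submodule.add_mem _ (toE_mon_mem_PFree (hp i)) (toE_mon_mem_PFree (hq i))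

/-- Only at s⁰ and s_j s_k are the brackets required to vanish in E. At every other monomial one
symbol can be split off with the coefficient still in the filtration. -/
theorem toE_serBracket_mem_sIdeal {u : Fin 4 → CDer A} {p q : Fin 3 → Fin 4 → CDer A}
    (huu : bracket (form1 u) (form1 u) ∈ weylIdeal A)
    (huq : ∀ i, bracket (form1 u) (form1 (q i)) ∈ weylIdeal A)
    (hup : ∀ i α, (weylIdeal A).mkQ (bracket (form1 u) (form1 (p i))) ∈ F3 (A := A) α)
    (hpp : ∀ i j α, (weylIdeal A).mkQ (bracket (form1 (p i)) (form1 (p j))) ∈ F3 (A := A) α)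
    (hqq : ∀ i α, (weylIdeal A).mkQ (bracket (form1 (q i)) (form1 (q i))) ∈ F3 (A := A) α)
    (hpq : ∀ i j (α : Fin 3 → ℕ), i ≠ j → (∀ n, n ≠ j → α n ≠ 0) →
      (weylIdeal A).mkQ (bracket (form1 (p i)) (form1 (q j))) ∈ F3 (A := A) α)
    (hmix : ∀ i (α : Fin 3 → ℕ), (∀ n, n ≠ i → α n ≠ 0) →
      (weylIdeal A).mkQ (bracket (form1 (p i)) (form1 (q i)) +
        bracket (form1 (q (i + 1))) (form1 (q (i + 2)))) ∈ F3 (A := A) α) :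
    toE (serBracket (gaugeSer (form1 u) (fun i => form1 (p i)) fun i => form1 (q i))
      (gaugeSer (form1 u) (fun i => form1 (p i)) fun i => form1 (q i))) ∈ sIdeal A := by
  have dbl {α : Fin 3 → ℕ} {v : L A} (h : (weylIdeal A).mkQ v ∈ F3 (A := A) α) :
      (weylIdeal A).mkQ (v + v) ∈ F3 (A := A) α := by
    rw [map_add]; exact Submodule.add_mem _ h h
  rw [serBracket_gaugeSer, toE_add, toE_sum, toE_mon_of_weyl huu]
  refine Submodule.add_mem _ (Submodule.zero_mem _) (Submodule.sum_mem _ fun i _ => ?_)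
  simp only [toE_add]
  refine Submodule.add_mem _ (Submodule.add_mem _ (Submodule.add_mem _ ?_ ?_)
    (Submodule.add_mem _ ?_ ?_)) (Submodule.add_mem _ (Submodule.add_mem _ ?_ ?_) ?_)
  · exact toE_mon_mem_sIdeal i (expSq_self i) (dbl (hup i _))
  · rw [toE_mon_of_weyl (Submodule.add_mem _ (huq i) (huq i))]
    exact Submodule.zero_mem _
  -- Splitting s_i off s_i² s_j s_k leaves s_i s_j s_k, whose indices in the two odd decompositions
  -- are nonzero.
  · refine toE_mon_mem_sIdeal i ?_ (dbl (hmix i _ ?_)) <;> revert i <;> decide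
  · refine toE_mon_mem_sIdeal (i + 1) ?_ ?_
    · revert i; decide
    · rw [map_add]
      exact Submodule.add_mem _ (hqq _ _) (dbl (hpp _ _ _))
  · refine toE_mon_mem_sIdeal i ?_ (hpp _ _ _)
    revert i; decide
  · refine toE_mon_mem_sIdeal i ?_ (dbl (hpq _ _ _ ?_ ?_)) <;> revert i <;> decide
  · refine toE_mon_mem_sIdeal i ?_ (dbl (hpq _ _ _ ?_ ?_)) <;> revert i <;> decide

end MaurerCartan
end BKL
end

/-! ### From the Maurer-Cartan equation to equations for the parameters. -/

noncomputable section
namespace BKL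
section Reduction
variable {A : Type*} [CommRing A] [Algebra ℝ A]

theorem th_add (i : Fin 3) (δ ε : CDer A) : th i (δ + ε) = th i δ + th i ε := tens_add _ _ _

theorem th_smul (i : Fin 3) (a : A) (δ : CDer A) : th i (a • δ) = a • th i δ := tens_smul _ _ _

theorem th0_add (δ ε : CDer A) : th0 (δ + ε) = th0 δ + th0 ε := tens_add _ _ _

theorem th0_smul (a : A) (δ : CDer A) : th0 (a • δ) = a • th0 δ := tens_smul _ _ _

theorem form1_eq (δ : Fin 4 → CDer A) : form1 δ = th0 (δ 0) + ∑ i : Fin 3, th i (δ i.succ) := by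
  rw [form1, Fin.sum_univ_succ]
  rfl

theorem ofDer_zero : (ofDer 0 : CDer A) = 0 := rfl

theorem ofDer_smul (a : A) (X : Derivation ℝ A A) : ofDer (a • X) = a • ofDer X := by
  apply CDer.ext'
  · rfl
  · rw [mat_smul, mat_ofDer, mat_ofDer, smul_zero]

theorem sum_cyclic {M : Type*} [AddCommMonoid M] (f : Fin 3 → M) (i : Fin 3) :
    ∑ n, f n = f i + f (i + 1) + f (i + 2) := by
  rw [Fin.sum_univ_three]
  fin_cases i
  · rfl
  · change _ = f 1 + f 2 + f 0; abel
  · change _ = f 2 + f 0 + f 1; abel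

theorem add_one_add_one (i : Fin 3) : i + 1 + 1 = i + 2 := by revert i; decide
theorem add_one_add_two (i : Fin 3) : i + 1 + 2 = i := by revert i; decide
theorem add_two_add_one (i : Fin 3) : i + 2 + 1 = i := by revert i; decide
theorem add_two_add_two (i : Fin 3) : i + 2 + 2 = i + 1 := by revert i; decide

/-- The coefficients of the rotations in the gauge subspace, at `s_i²`. -/
def rotCoeff (i : Fin 3) (a : A) (n : Fin 3) : A := if n = i then -a else a

/-- In the sign pattern (-,+,+) the sums of two coefficients vanish except for the pair opposite to
i. Hence p_i is constrained by the i-th filtration alone, and its brackets with q_n, n ≠ i, lose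
their leading components. -/
theorem rotCoeff_add (i n : Fin 3) (a : A) :
    rotCoeff i a (n + 1) + rotCoeff i a (n + 2) = if n = i then 2 * a else 0 := by
  fin_cases i <;> fin_cases n <;> simp [rotCoeff, two_mul]

section Data

variable (D0 : Derivation ℝ A A) (D : Fin 3 → Derivation ℝ A A) (t : A) (e : Fin 3 → A)
  (γ : Fin 3 → Fin 5 → A)

/-- The coefficient at `s⁰` of the over-parametrized element. -/
def kasnerForm : Fin 4 → CDer A := evenForm D0 (-∑ n, γ n 0) (fun n => -γ n 0) 0

/-- The coefficient at `s_i²` of the over-parametrized element. -/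
def squareForm (i : Fin 3) : Fin 4 → CDer A := evenForm 0 0 0 (rotCoeff i (e i ^ 2 * γ i 1))

/-- The coefficient at `s_j s_k` of the over-parametrized element. -/
def crossForm (i : Fin 3) : Fin 4 → CDer A :=
  oddForm i ((e (i + 1) * e (i + 2)) • D i)
    (-(e (i + 1) * e (i + 2) * (γ i 2 + t * D i (∑ n, γ n 0))))
    (-(e (i + 1) * e (i + 2) * (γ i 3 - t * D i (γ (i + 2) 0))))
    (-(e (i + 1) * e (i + 2) * (γ i 4 + t * D i (γ (i + 1) 0))))

/-- The over-parametrized element with `γ_i⁵ = γ_i⁶ = 0`. -/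
def gaugeElement : Ser (L A) :=
  gaugeSer (form1 (kasnerForm D0 γ)) (fun i => form1 (squareForm e γ i))
    fun i => form1 (crossForm D t e γ i)

/-- The relations satisfied by `∂/∂t`, the extension of vector fields by `D_i(t) = 0`, and
`e_i = exp(t γ_i⁰)`. -/
structure Comoving : Prop where
  apply_time : D0 t = 1
  apply_time' : ∀ i, D i t = 0
  comm : ∀ i, ⁅D0, D i⁆ = 0
  apply_exp : ∀ i, D0 (e i) = e i * D0 (t * γ i 0)
  apply_exp' : ∀ n i, D n (e i) = e i * D n (t * γ i 0)
  isUnit : ∀ i, IsUnit (e i)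

/-- The equations for the parameters that are equivalent to the Maurer-Cartan equation, for frames
that satisfy the Jacobi identity. -/
structure ReducedEquations : Prop where
  const : ∀ i a, D0 (γ i a) = 0
  alg : γ 1 0 * γ 2 0 + γ 2 0 * γ 0 0 + γ 0 0 * γ 1 0 = 0
  constraint : ∀ i, D i (γ (i + 1) 0 + γ (i + 2) 0) + γ i 0 * (γ i 3 - γ i 4)
    - γ i 2 * (γ (i + 1) 0 + γ (i + 2) 0) - γ i 3 * γ (i + 2) 0 + γ i 4 * γ (i + 1) 0 = 0
  lie : ∀ i, ⁅D (i + 1), D (i + 2)⁆ = (-2 * γ i 1) • D i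
    - (γ (i + 2) 2 + γ (i + 2) 3) • D (i + 1) - (γ (i + 1) 4 - γ (i + 1) 2) • D (i + 2)
  closed : ∀ i, D (i + 1) (γ (i + 2) 2) - D (i + 2) (γ (i + 1) 2) + 2 * γ i 1 * γ i 2
    + γ (i + 1) 2 * γ (i + 2) 3 + γ (i + 1) 4 * γ (i + 2) 2 = 0

/-- The Jacobi identity for the frame, in terms of the parameters. -/
def JacobiEquation : Prop :=
  ∀ i, 2 * D i (γ i 1) - D (i + 1) (γ (i + 2) 2) + D (i + 1) (γ (i + 2) 4) + D (i + 2) (γ (i + 1) 2)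
    + D (i + 2) (γ (i + 1) 3) - 4 * γ i 1 * γ i 2 - 2 * γ i 1 * γ i 3 + 2 * γ i 1 * γ i 4
    - γ (i + 1) 2 * γ (i + 2) 3 - γ (i + 1) 2 * γ (i + 2) 4 - γ (i + 1) 3 * γ (i + 2) 2
    - γ (i + 1) 3 * γ (i + 2) 3 - γ (i + 1) 4 * γ (i + 2) 2 + γ (i + 1) 4 * γ (i + 2) 4 = 0

variable {D0 D t e γ}

theorem overparam_eq_gaugeElement (h : ∀ i, D i t = 0) :
    overparam D0 e (fun i => t * γ i 0) D (fun i => ![γ i 0, γ i 1, γ i 2, γ i 3, γ i 4, 0, 0]) =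
      gaugeElement D0 D t e γ := by
  have hμ (i : Fin 3) (a : A) : D i (t * a) = t * D i a := by
    rw [Derivation.leibniz, h, smul_zero, add_zero, smul_eq_mul]
  -- The terms θ_0σ_0 of the three summands collect into the coefficient -∑ γ_n⁰ of `kasnerForm`.
  have h0 : form1 (kasnerForm D0 γ) =
      th0 (ofDer D0) + ∑ i : Fin 3, -(γ i 0 • (th i (boost i) + th0 sigma0)) := by
    rw [form1_eq, kasnerForm]
    simp only [evenForm, Fin.cons_zero, Fin.cons_succ, Pi.zero_apply, zero_smul, add_zero, th_smul,
      th0_add, th0_smul, Fin.sum_univ_three]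
    module
  have h1 (i : Fin 3) : form1 (squareForm e γ i) =
      -((e i ^ 2 * γ i 1) • (th i (rot i) - th (i + 1) (rot (i + 1)) - th (i + 2) (rot (i + 2)))) := by
    rw [form1_eq, squareForm, sum_cyclic _ i]
    have hi1 : i + 1 ≠ i := by revert i; decide
    have hi2 : i + 2 ≠ i := by revert i; decide
    simp only [evenForm, Fin.cons_zero, Fin.cons_succ, Pi.zero_apply, zero_smul, add_zero, zero_add,
      th_smul, ofDer_zero, rotCoeff, if_pos, if_neg hi1, if_neg hi2]
    have : th0 (0 : CDer A) = 0 := tens_zero _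
    rw [this]
    module
  have h2 (i : Fin 3) : form1 (crossForm D t e γ i) = (e (i + 1) * e (i + 2)) •
      (th i (ofDer (D i)) - (γ i 2 + D i (t * γ 0 0 + t * γ 1 0 + t * γ 2 0)) •
          (th0 (boost i) + th i sigma0)
        - (γ i 3 - D i (t * γ (i + 2) 0)) • th (i + 2) (rot (i + 1))
        - (γ i 4 + D i (t * γ (i + 1) 0)) • th (i + 1) (rot (i + 2))) := by
    rw [form1_eq, crossForm, sum_cyclic (fun n => th n _) i, Fin.sum_univ_three, ← mul_add,
      ← mul_add, hμ, hμ, hμ]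
    have hi1 : i + 1 ≠ i := by revert i; decide
    have hi2 : i + 2 ≠ i := by revert i; decide
    have hi3 : i + 2 ≠ i + 1 := by revert i; decide
    simp only [oddForm, Fin.cons_zero, Fin.cons_succ, th_smul, th_add, th0_smul, ofDer_smul, if_pos,
      if_neg hi1, if_neg hi2, if_neg hi3]
    module
  have hc : ∀ (a b c d f g k : A), (![a, b, c, d, f, g, k] : Fin 7 → A) 0 = a ∧
      (![a, b, c, d, f, g, k] : Fin 7 → A) 1 = b ∧ (![a, b, c, d, f, g, k] : Fin 7 → A) 2 = c ∧
      (![a, b, c, d, f, g, k] : Fin 7 → A) 3 = d ∧ (![a, b, c, d, f, g, k] : Fin 7 → A) 4 = f ∧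
      (![a, b, c, d, f, g, k] : Fin 7 → A) 5 = g ∧ (![a, b, c, d, f, g, k] : Fin 7 → A) 6 = k :=
    fun _ _ _ _ _ _ _ => ⟨rfl, rfl, rfl, rfl, rfl, rfl, rfl⟩
  have hmon : ∀ v : Fin 3 → L A, mon 0 (∑ i, v i) = ∑ i, mon 0 (v i) := fun v => by
    rw [Fin.sum_univ_three, Fin.sum_univ_three, mon_add, mon_add]
  rw [overparam, gaugeElement, gaugeSer, h0, mon_add, hmon, add_assoc (mon 0 _),
    ← Finset.sum_add_distrib]
  congr 1
  refine Finset.sum_congr rfl fun i _ => ?_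
  obtain ⟨c0, c1, c2, c3, c4, c5, c6⟩ := hc (γ i 0) (γ i 1) (γ i 2) (γ i 3) (γ i 4) 0 0
  simp only [c0, c1, c2, c3, c4, c5, c6]
  rw [mul_zero, zero_smul, zero_smul, sub_zero, mon_zero, add_zero, h1, h2, add_assoc]

theorem gaugeElement_eq : gaugeElement D0 D t e γ = gaugeSer (form1 (kasnerForm D0 γ))
    (fun i => form1 (squareForm e γ i)) fun i => form1 (crossForm D t e γ i) := rfl

theorem Comoving.comm_apply (h : Comoving D0 D t e γ) (i : Fin 3) (a : A) :
    D0 (D i a) = D i (D0 a) := by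
  have := congrArg (fun X => X a) (h.comm i)
  simpa [Derivation.commutator_apply, sub_eq_zero] using this

theorem Comoving.exp_time (h : Comoving D0 D t e γ) (h0 : ∀ i, D0 (γ i 0) = 0) (i : Fin 3) :
    D0 (e i) = e i * γ i 0 := by
  rw [h.apply_exp, Derivation.leibniz, h0, h.apply_time, smul_zero, zero_add, smul_eq_mul, mul_one]

theorem Comoving.exp_space (h : Comoving D0 D t e γ) (n i : Fin 3) :
    D n (e i) = e i * (t * D n (γ i 0)) := by
  rw [h.apply_exp', Derivation.leibniz, h.apply_time', smul_zero, add_zero, smul_eq_mul]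

theorem smul_sgn_eq_zero {M : Type*} [AddCommGroup M] {a b : Fin 4} (hab : a ≠ b) {x : M} :
    sgn {a} {b} • x = 0 ↔ x = 0 := by
  rw [sgn_singleton, if_neg hab]
  split_ifs <;> simp

theorem mul_ofNat_eq_zero (n : ℕ) (hn : n ≠ 0) {a : A} : (n : A) * a = 0 ↔ a = 0 :=
  (isUnit_ofNat n hn).mul_right_eq_zero

/-- In the diagonal spatial Ricci component the quadratic terms cancel because the coefficient of
σ_0 is the sum of those of the boosts. This has to come first: the weights D0(e_i) = e_i γ_i⁰ are
available only once γ_i⁰ is constant in time. -/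
theorem const_zero_of_MC
    (hx : toE (serBracket (gaugeElement D0 D t e γ) (gaugeElement D0 D t e γ)) ∈ sIdeal A)
    (i : Fin 3) : D0 (γ i 0) = 0 := by
  have h1 := apply_zero_of_sIdeal hx (weylIdeal_le_ricFun i.succ i.succ)
  rw [serBracket_coeff_zero gaugeElement_eq, kasnerForm, ric_succ_even_even] at h1
  simp only [map_neg, Finset.sum_neg_distrib, Pi.zero_apply] at h1
  refine (mul_ofNat_eq_zero 2 two_ne_zero).1 ?_
  push_cast
  linear_combination -h1

/-- The equations are triangular in the powers of the symbols: time independence of the lower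
coefficients is used to simplify the higher ones. Each equation appears multiplied by a product of
the e_n, which is a unit. -/
theorem reducedEquations_of_MC (h : Comoving D0 D t e γ)
    (hx : toE (serBracket (gaugeElement D0 D t e γ) (gaugeElement D0 D t e γ)) ∈ sIdeal A) :
    ReducedEquations D0 D γ := by
  have hc0 := const_zero_of_MC hx
  have hu0 (i : Fin 3) := h.exp_time hc0 i
  have hD0 (i n : Fin 3) : D0 (D i (γ n 0)) = 0 := by rw [h.comm_apply, hc0, map_zero]
  have hf (i : Fin 3) : IsUnit (e (i + 1) * e (i + 2)) := (h.isUnit _).mul (h.isUnit _)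
  have hne0 (i : Fin 3) : i.succ ≠ (i + 1).succ := by revert i; decide
  have hne1 (i : Fin 3) : i.succ ≠ (i + 2).succ := by revert i; decide
  have hne2 (i : Fin 3) : (i + 1).succ ≠ (i + 2).succ := by revert i; decide
  have hsum0 (i : Fin 3) : D0 (D i (∑ n, γ n 0)) = 0 := by
    rw [h.comm_apply, map_sum, Finset.sum_congr rfl fun n _ => hc0 n, Finset.sum_const_zero, map_zero]
  have alg (i : Fin 3) :
      γ (i + 1) 0 * γ (i + 2) 0 + γ (i + 2) 0 * γ i 0 + γ i 0 * γ (i + 1) 0 = 0 := by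
    have h1 := apply_zero_of_sIdeal hx (weylIdeal_le_ricFun 0 0)
    rw [serBracket_coeff_zero gaugeElement_eq, kasnerForm, ric_zero_even_even, sum_cyclic _ i,
      sum_cyclic _ i] at h1
    simp only [map_neg, hc0] at h1
    refine (mul_ofNat_eq_zero 4 four_ne_zero).1 ?_
    push_cast
    linear_combination -h1
  -- The spatial derivative of the quadratic relation later cancels the terms of the constraint that
  -- are proportional to t.
  have hDalg (i : Fin 3) : D i (γ (i + 1) 0) * (γ (i + 2) 0 + γ i 0) +
      D i (γ (i + 2) 0) * (γ i 0 + γ (i + 1) 0) + D i (γ i 0) * (γ (i + 1) 0 + γ (i + 2) 0) = 0 := by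
    have h1 := congrArg (D i) (alg i)
    simp only [map_add, Derivation.leibniz, smul_eq_mul, map_zero] at h1
    linear_combination h1
  -- the coefficient of `s_i²`
  have c1 (i : Fin 3) : D0 (γ i 1) = 0 := by
    have h1 := rep_expSq_of_sIdeal hx i
    rw [serBracket_coeff_expSq gaugeElement_eq, rep_add, Pi.add_apply] at h1
    replace h1 := eq_zero_of_add_self h1
    rw [kasnerForm, squareForm, rep_succ_even_even, smul_sgn_eq_zero (hne2 i)] at h1
    rw [rotCoeff_add, if_pos rfl, sum_cyclic _ i] at h1
    simp only [Pi.zero_apply, add_zero, map_zero, mul_zero, Derivation.leibniz,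
      Derivation.leibniz_pow, hu0, smul_eq_mul, nsmul_eq_mul, Nat.cast_ofNat, two_mul, map_add] at h1
    refine ((h.isUnit i).pow 2).mul_right_eq_zero.1 ((mul_ofNat_eq_zero 2 two_ne_zero).1 ?_)
    push_cast
    linear_combination h1
  -- the coefficient of `s_j s_k`
  have cross (i : Fin 3) {l : L A →ₗ[A] A}
      (hl : l (serBracket (gaugeElement D0 D t e γ) (gaugeElement D0 D t e γ) (expCross i)) = 0) :
      l (bracket (form1 (kasnerForm D0 γ)) (form1 (crossForm D t e γ i))) = 0 := by
    rw [serBracket_coeff_expCross gaugeElement_eq, map_add] at hl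
    exact eq_zero_of_add_self hl
  have c2 (i : Fin 3) : D0 (γ i 2) = 0 := by
    have h1 := trace_expCross_of_sIdeal hx i
    replace h1 := cross i (l := trFun {0, i.succ}) h1
    change (CDer.mat (bracket _ _ _)).trace = 0 at h1
    rw [kasnerForm, crossForm, trace_zero_even_odd] at h1
    replace h1 := (mul_ofNat_eq_zero 4 four_ne_zero).1 h1
    simp only [map_neg, Derivation.leibniz, map_add, hu0, hsum0, h.apply_time, smul_eq_mul,
      Derivation.smul_apply] at h1
    rw [sum_cyclic _ i] at h1
    refine (hf i).mul_right_eq_zero.1 ?_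
    linear_combination -h1
  -- The trace has isolated γ_i², as only σ_0 has a trace. The Bianchi components contain γ_i²
  -- together with γ_i⁴ or γ_i³, so they determine the remaining two time derivatives.
  have c4 (i : Fin 3) : D0 (γ i 4) = 0 := by
    have h1 := rep_expCross_of_sIdeal hx i (j := (i + 1).succ) (m := (i + 2).succ)
      (by revert i; decide)
    replace h1 := cross i (l := repFun (i + 1).succ (Finset.univ.erase (i + 2).succ)) h1
    change rep _ _ _ = 0 at h1
    rw [kasnerForm, crossForm, rep_succ_even_odd, smul_sgn_eq_zero (hne0 i)] at h1
    simp only [map_neg, Derivation.leibniz, map_add, hu0, hsum0, h.apply_time, smul_eq_mul,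
      Derivation.smul_apply, c2, hD0] at h1
    rw [sum_cyclic _ i] at h1
    simp only [map_add] at h1
    refine (hf i).mul_right_eq_zero.1 ?_
    linear_combination h1
  have c3 (i : Fin 3) : D0 (γ i 3) = 0 := by
    have h1 := rep_expCross_of_sIdeal hx i (j := (i + 2).succ) (m := (i + 1).succ)
      (by revert i; decide)
    replace h1 := cross i (l := repFun (i + 2).succ (Finset.univ.erase (i + 1).succ)) h1
    change rep _ _ _ = 0 at h1
    rw [kasnerForm, crossForm, rep_succ_even_odd', smul_sgn_eq_zero (hne1 i)] at h1
    simp only [map_neg, Derivation.leibniz, map_add, map_sub, hu0, hsum0, h.apply_time, smul_eq_mul,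
      Derivation.smul_apply, c2, hD0] at h1
    rw [sum_cyclic _ i] at h1
    simp only [map_add] at h1
    refine (hf i).mul_right_eq_zero.1 ?_
    linear_combination -h1
  -- the coefficient of `s_i² s_j s_k`
  have mixed (i : Fin 3) {l : L A →ₗ[A] A} (hl : l (serBracket (gaugeElement D0 D t e γ)
      (gaugeElement D0 D t e γ) (expSq i + expCross i)) = 0) :
      l (bracket (form1 (squareForm e γ i)) (form1 (crossForm D t e γ i)) +
        bracket (form1 (crossForm D t e γ (i + 1))) (form1 (crossForm D t e γ (i + 2)))) = 0 := by
    rw [serBracket_coeff_mixed gaugeElement_eq, map_add] at hl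
    exact eq_zero_of_add_self hl
  have hfe (i : Fin 3) : IsUnit (e i ^ 2 * (e (i + 1) * e (i + 2))) :=
    ((h.isUnit _).pow 2).mul (hf i)
  -- The relation is kept for arbitrary functions, because the trace equation needs it for f = γ_n⁰.
  have lie (i : Fin 3) (f : A) : D (i + 1) (D (i + 2) f) - D (i + 2) (D (i + 1) f)
      + 2 * γ i 1 * D i f + (γ (i + 2) 2 + γ (i + 2) 3) * D (i + 1) f
      + (γ (i + 1) 4 - γ (i + 1) 2) * D (i + 2) f = 0 := by
    have h1 := der_mixed_of_sIdeal hx i f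
    replace h1 := mixed i (l := derFun (W1 i) f) h1
    rw [map_add] at h1
    change (CDer.der (bracket _ _ _)) f + (CDer.der (bracket _ _ _)) f = 0 at h1
    rw [squareForm, crossForm, der_W1_even_odd, crossForm, crossForm, der_W1_odd_odd,
      ← Derivation.add_apply, ← smul_add, Derivation.smul_apply, smul_sgn_eq_zero (hne2 i),
      rotCoeff_add, if_pos rfl] at h1
    simp only [add_one_add_one, add_one_add_two, add_two_add_one, add_two_add_two] at h1
    rw [sum_cyclic _ i] at h1
    simp only [Derivation.add_apply, Derivation.sub_apply, Derivation.smul_apply,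
      Derivation.commutator_apply, Derivation.leibniz, smul_eq_mul, h.exp_space, map_add] at h1
    refine (hfe i).mul_right_eq_zero.1 ?_
    linear_combination h1
  refine ⟨fun i a => ?_, ?_, fun i => ?_, fun i => ?_, fun i => ?_⟩
  · fin_cases a
    exacts [hc0 i, c1 i, c2 i, c3 i, c4 i]
  · exact alg 0
  · have h1 := ric_expCross_of_sIdeal hx i
    replace h1 := cross i h1
    rw [kasnerForm, crossForm, ric_zero_succ_even_odd] at h1
    rw [sum_cyclic _ i] at h1
    simp only [map_neg, Derivation.leibniz, map_add, map_sub, hu0, hD0, h.apply_time, smul_eq_mul,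
      Derivation.smul_apply, c2, c3, c4] at h1
    refine (hf i).mul_right_eq_zero.1 ?_
    rw [map_add]
    linear_combination h1 + (e (i + 1) * e (i + 2)) * t * hDalg i
  · refine Derivation.ext fun f => ?_
    rw [← sub_eq_zero, ← lie i f]
    simp only [Derivation.commutator_apply, Derivation.sub_apply, Derivation.smul_apply, smul_eq_mul]
    ring
  · have h1 := trace_mixed_of_sIdeal hx i
    replace h1 := mixed i (l := trFun (W1 i)) h1
    rw [map_add] at h1
    change (CDer.mat (bracket _ _ _)).trace + (CDer.mat (bracket _ _ _)).trace = 0 at h1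
    rw [squareForm, crossForm, trace_W1_even_odd, crossForm, crossForm, trace_W1_odd_odd,
      ← smul_add, smul_sgn_eq_zero (hne2 i), ← mul_add, rotCoeff_add, if_pos rfl] at h1
    replace h1 := (mul_ofNat_eq_zero 4 four_ne_zero).1 h1
    simp only [add_one_add_one, add_one_add_two, add_two_add_one, add_two_add_two] at h1
    rw [sum_cyclic _ i] at h1
    simp only [Derivation.smul_apply, Derivation.leibniz, smul_eq_mul, h.exp_space, map_add, 
      map_neg, h.apply_time'] at h1 ⊢
    refine (hfe i).mul_right_eq_zero.1 ?_
    -- The shifts t D_n(∑ γ_m⁰) form an exact one-form up to the factor t, so their contribution to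
    -- closedness is t times the bracket relation applied to the three γ_m⁰.
    linear_combination -h1 - e i ^ 2 * (e (i + 1) * e (i + 2)) * t *
      (lie i (γ i 0) + lie i (γ (i + 1) 0) + lie i (γ (i + 2) 0))

end Data
end Reduction
end BKL
end

/-! ### From the equations for the parameters back to the Maurer-Cartan equation. -/

noncomputable section
namespace BKL
section Sufficiency
variable {A : Type*} [CommRing A] [Algebra ℝ A] {D0 : Derivation ℝ A A}
  {D : Fin 3 → Derivation ℝ A A} {t : A} {e : Fin 3 → A} {γ : Fin 3 → Fin 5 → A}

theorem rep_evenForm_W1 (X : Derivation ℝ A A) (a : A) (b r : Fin 3 → A) (n : Fin 3)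
    (h : r (n + 1) + r (n + 2) = 0) :
    rep (form1 (evenForm X a b r)) (theta {n.succ}) (W1 n) = 0 := by
  have h1 (m) := congrFun (evenForm_mat X a b r) m
  fin_cases n
  · have h' : r 1 + r 2 = 0 := h
    change rep _ (theta {1}) {2, 3} = 0
    rw [rep_theta_pair _ _ (by decide), form1_singleton, form1_singleton, h1, h1]
    simp
    linear_combination h'
  · have h' : r 2 + r 0 = 0 := h
    change rep _ (theta {2}) (W1 1) = 0
    rw [W1_one, rep_theta_pair _ _ (by decide), form1_singleton, form1_singleton, h1, h1]
    simp
    linear_combination -h'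
  · have h' : r 0 + r 1 = 0 := h
    change rep _ (theta {3}) {1, 2} = 0
    rw [rep_theta_pair _ _ (by decide), form1_singleton, form1_singleton, h1, h1]
    simp
    linear_combination h'

theorem rep_oddForm_W1 (i : Fin 3) (X : Derivation ℝ A A) (g r s : A) :
    rep (form1 (oddForm i X g r s)) (theta {0}) (W1 i) = 0 := by
  fin_cases i
  · have h1 (m) := congrFun (oddForm_mat_0 X g r s) m
    change rep (form1 (oddForm 0 X g r s)) (theta {0}) {2, 3} = 0
    rw [rep_theta_pair _ _ (by decide), form1_singleton, form1_singleton, h1, h1]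
    simp
  · have h1 (m) := congrFun (oddForm_mat_1 X g r s) m
    change rep (form1 (oddForm 1 X g r s)) (theta {0}) (W1 1) = 0
    rw [W1_one, rep_theta_pair _ _ (by decide), form1_singleton, form1_singleton, h1, h1]
    simp
  · have h1 (m) := congrFun (oddForm_mat_2 X g r s) m
    change rep (form1 (oddForm 2 X g r s)) (theta {0}) {1, 2} = 0
    rw [rep_theta_pair _ _ (by decide), form1_singleton, form1_singleton, h1, h1]
    simp

/-- No equation for the parameters enters: parity and the sign pattern of the rotations suffice,
with the exponent 2 of s_i needed exactly for p_i in its own decomposition. -/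
theorem toE_gaugeElement_mem_PFree : toE (gaugeElement D0 D t e γ) ∈ PFree A := by
  refine toE_gauge_mem_PFree ?_ (fun i => ?_) fun i => ?_
  · refine InSector.mem_F3_deg_one_zero (form1_isDeg _) (evenForm_sector _ _ _ _).inSector
      fun n => Or.inr (rep_evenForm_W1 _ _ _ _ n ?_)
    simp
  · refine InSector.mem_F3_deg_one_zero (form1_isDeg _) (evenForm_sector _ _ _ _).inSector
      fun n => ?_
    by_cases hn : n = i
    · left; simp [expSq, hn]
    · right
      refine rep_evenForm_W1 _ _ _ _ n ?_
      rw [rotCoeff_add, if_neg hn]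
  · refine InSector.mem_F3_deg_one (form1_isDeg _) (oddForm_sector _ _ _ _ _).inSector
      (rep_oddForm_W1 _ _ _ _ _) ?_
    revert i; decide

theorem gaugeElement_isDeg (α : Fin 3 → ℕ) : IsDeg 1 (gaugeElement D0 D t e γ α) := by
  have hmon (κ : Fin 3 → ℕ) {v : L A} (hv : IsDeg 1 v) : IsDeg 1 (mon κ v α) := by
    by_cases h : α = κ
    · rw [h, mon_self]; exact hv
    · rw [mon_of_ne h]; exact fun _ _ => rfl
  intro J hJ
  rw [gaugeElement_eq, gaugeSer, Pi.add_apply, Pi.add_apply, hmon _ (form1_isDeg _) J hJ, zero_add,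
    Finset.sum_apply, Finset.sum_apply]
  refine Finset.sum_eq_zero fun i _ => ?_
  rw [Pi.add_apply, Pi.add_apply, hmon _ (form1_isDeg _) J hJ, hmon _ (form1_isDeg _) J hJ, add_zero]

theorem compat_self (a : Fin 4) : Compat 0 a a := by revert a; decide

theorem compat_zero_right (a : Fin 4) : Compat a 0 a := by revert a; decide

theorem compat_cyclic (i : Fin 3) : Compat i.succ (i + 1).succ (i + 2).succ := by
  revert i; decide

theorem forall_fin_four_cyclic (i : Fin 3) {p : Fin 4 → Prop} (h0 : p 0) (h1 : p i.succ)
    (h2 : p (i + 1).succ) (h3 : p (i + 2).succ) (j : Fin 4) : p j := by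
  fin_cases i <;> fin_cases j <;> assumption

theorem kasnerForm_sector : FormSector 0 (kasnerForm D0 γ) := evenForm_sector _ _ _ _

theorem squareForm_sector (i : Fin 3) : FormSector 0 (squareForm e γ i) := evenForm_sector _ _ _ _

theorem crossForm_sector (i : Fin 3) : FormSector i.succ (crossForm D t e γ i) :=
  oddForm_sector _ _ _ _ _

theorem squareForm_bracket_squareForm (i j : Fin 3) (α : Fin 3 → ℕ) :
    (weylIdeal A).mkQ (bracket (form1 (squareForm e γ i)) (form1 (squareForm e γ j))) ∈
      F3 (A := A) α := by
  refine InSector.mem_F3_zero (bracket_isDeg _ _)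
    ((squareForm_sector _).bracket (squareForm_sector _) (compat_self 0)) ?_ α
  refine Fin.cases ?_ fun n => ?_
  · rw [squareForm, squareForm, rep_zero_even_even]
  · rw [squareForm, squareForm, rep_succ_even_even]
    simp

theorem crossForm_bracket_crossForm (i : Fin 3) (α : Fin 3 → ℕ) :
    (weylIdeal A).mkQ (bracket (form1 (crossForm D t e γ i)) (form1 (crossForm D t e γ i))) ∈
      F3 (A := A) α := by
  refine InSector.mem_F3_zero (bracket_isDeg _ _)
    ((crossForm_sector _).bracket (crossForm_sector _) (compat_self i.succ)) ?_ α
  exact forall_fin_four_cyclic i (rep_zero_odd_odd ..) (rep_self_odd_odd ..) (rep_succ_odd_odd ..)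
    (rep_succ_odd_odd' ..)

/-- Every component that could obstruct membership contains the sum of the two rotation coefficients
opposite to j, or its derivative, or is identically zero; the sum vanishes for j ≠ i. -/
theorem squareForm_bracket_crossForm {i j : Fin 3} (hij : i ≠ j) {α : Fin 3 → ℕ}
    (hα : ∀ n, n ≠ j → α n ≠ 0) :
    (weylIdeal A).mkQ (bracket (form1 (squareForm e γ i)) (form1 (crossForm D t e γ j))) ∈
      F3 (A := A) α := by
  have hr (a : A) : rotCoeff i a (j + 1) + rotCoeff i a (j + 2) = 0 := by
    rw [rotCoeff_add, if_neg hij.symm]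
  refine InSector.mem_F3_succ (bracket_isDeg _ _)
    ((squareForm_sector _).bracket (crossForm_sector _) (compat_zero_right _))
    ?_ ?_ ?_ ?_ hα
  · rw [squareForm, crossForm, der_W1_even_odd, hr, zero_smul, smul_zero]
  · rw [squareForm, crossForm, trace_W1_even_odd, hr, zero_mul, mul_zero, smul_zero]
  · rw [(insert_W1 j).1, squareForm, crossForm, rep_zero_even_odd]
  · rw [(insert_W1 j).2, squareForm, crossForm, rep_self_even_odd, hr, map_zero, zero_mul, add_zero]

section Equations

variable (h : Comoving D0 D t e γ) (hr : ReducedEquations D0 D γ)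
include h hr

theorem kasnerForm_bracket_kasnerForm :
    bracket (form1 (kasnerForm D0 γ)) (form1 (kasnerForm D0 γ)) ∈ weylIdeal A := by
  have halg := hr.alg
  refine mem_weylIdeal (isWeyl_of_sector_zero (bracket_isDeg _ _)
    (kasnerForm_sector.bracket kasnerForm_sector (compat_self 0)) ?_ ?_)
  · refine Fin.cases ?_ fun n => ?_
    · rw [kasnerForm, ric_zero_even_even]
      simp only [map_neg, hr.const, Fin.sum_univ_three]
      linear_combination -4 * halg
    · rw [kasnerForm, ric_succ_even_even]
      simp only [map_neg, hr.const, Finset.sum_neg_distrib, Pi.zero_apply]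
      ring
  · refine Fin.cases ?_ fun n => ?_
    · rw [kasnerForm, rep_zero_even_even]
    · rw [kasnerForm, rep_succ_even_even]
      simp

/-- The filtration asks only for the diagonal Bianchi components; the Ricci components play no role.
The one that is not identically zero vanishes because e_i² has exactly the weight of the rotations
and γ_i¹ is constant in time. -/
theorem kasnerForm_bracket_squareForm (i : Fin 3) (α : Fin 3 → ℕ) :
    (weylIdeal A).mkQ (bracket (form1 (kasnerForm D0 γ)) (form1 (squareForm e γ i))) ∈
      F3 (A := A) α := by
  have hu := h.exp_time fun i => hr.const i 0
  refine InSector.mem_F3_zero (bracket_isDeg _ _)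
    (kasnerForm_sector.bracket (squareForm_sector _) (compat_self 0)) ?_ α
  refine Fin.cases ?_ fun n => ?_
  · rw [kasnerForm, squareForm, rep_zero_even_even]
  · rw [kasnerForm, squareForm, rep_succ_even_even, rotCoeff_add]
    split_ifs with hn
    · subst hn
      rw [sum_cyclic _ n]
      simp only [Pi.zero_apply, add_zero, map_zero, mul_zero, Derivation.leibniz,
        Derivation.leibniz_pow, hu, hr.const, smul_eq_mul, nsmul_eq_mul, Nat.cast_ofNat, two_mul,
        map_add, sub_zero]
      convert smul_zero _
      ring
    · simp

theorem kasnerForm_bracket_crossForm (i : Fin 3) :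
    bracket (form1 (kasnerForm D0 γ)) (form1 (crossForm D t e γ i)) ∈ weylIdeal A := by
  have hu := h.exp_time fun i => hr.const i 0
  have hD0 (i n : Fin 3) : D0 (D i (γ n 0)) = 0 := by rw [h.comm_apply, hr.const, map_zero]
  have halg : γ (i + 1) 0 * γ (i + 2) 0 + γ (i + 2) 0 * γ i 0 + γ i 0 * γ (i + 1) 0 = 0 := by
    have := hr.alg
    fin_cases i
    · exact this
    · change γ 2 0 * γ 0 0 + γ 0 0 * γ 1 0 + γ 1 0 * γ 2 0 = 0
      linear_combination this
    · change γ 0 0 * γ 1 0 + γ 1 0 * γ 2 0 + γ 2 0 * γ 0 0 = 0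
      linear_combination this
  have hDalg := congrArg (D i) halg
  simp only [map_add, Derivation.leibniz, smul_eq_mul, map_zero] at hDalg
  have hcon := hr.constraint i
  rw [map_add] at hcon
  refine mem_weylIdeal (isWeyl_of_sector_succ (i := i) (bracket_isDeg _ _)
    (kasnerForm_sector.bracket (crossForm_sector _) (compat_zero_right _))
    ?_ ?_ ?_ ?_ ?_ ?_ ?_ ?_ ?_ ?_ ?_ ?_)
  · rw [kasnerForm, crossForm, der_zero_even_odd]
    ext f
    rw [sum_cyclic _ i]
    simp only [Derivation.add_apply, Derivation.commutator_apply, Derivation.smul_apply,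
      Derivation.leibniz, smul_eq_mul, hu, h.comm_apply, Derivation.zero_apply]
    ring
  · rw [kasnerForm, crossForm, der_W1_even_odd]
    simp
  · rw [kasnerForm, crossForm, trace_zero_even_odd, sum_cyclic _ i]
    simp only [map_neg, Derivation.leibniz, map_add, hu, hD0, h.apply_time, smul_eq_mul,
      Derivation.smul_apply, hr.const]
    ring
  · rw [kasnerForm, crossForm, trace_W1_even_odd]
    simp
  · rw [kasnerForm, crossForm, ric_zero_succ_even_odd, sum_cyclic _ i]
    simp only [map_neg, Derivation.leibniz, map_add, map_sub, hu, hD0, h.apply_time, smul_eq_mul,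
      Derivation.smul_apply, hr.const]
    linear_combination e (i + 1) * e (i + 2) * hcon - e (i + 1) * e (i + 2) * t * hDalg
  · rw [kasnerForm, crossForm, ric_succ_zero_even_odd, sum_cyclic _ i]
    simp only [map_neg, Derivation.leibniz, map_add, hu, hD0, h.apply_time, smul_eq_mul,
      Derivation.smul_apply, hr.const]
    -- Both off-diagonal Ricci components reduce to the same constraint, and the terms proportional
    -- to t to the derivative of the quadratic relation.
    linear_combination e (i + 1) * e (i + 2) * hcon - e (i + 1) * e (i + 2) * t * hDalg
  · rw [kasnerForm, crossForm, ric_succ_succ_even_odd]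
    simp
  · rw [kasnerForm, crossForm, ric_succ_succ_even_odd']
    simp
  · rw [kasnerForm, crossForm, rep_zero_even_odd]
  · rw [kasnerForm, crossForm, rep_self_even_odd]
    simp
  · rw [kasnerForm, crossForm, rep_succ_even_odd, sum_cyclic _ i]
    simp only [map_neg, Derivation.leibniz, map_add, hu, hD0, h.apply_time, smul_eq_mul,
      Derivation.smul_apply, hr.const]
    convert smul_zero _
    ring
  · rw [kasnerForm, crossForm, rep_succ_even_odd', sum_cyclic _ i]
    simp only [map_neg, Derivation.leibniz, map_add, map_sub, hu, hD0, h.apply_time, smul_eq_mul,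
      Derivation.smul_apply, hr.const]
    convert smul_zero _
    ring

/-- The derivation vanishes by the bracket relation, the trace by closedness, and the remaining
Bianchi component by the Jacobi identity. In the last two the terms proportional to t are the
bracket relation applied to the γ_n⁰. -/
theorem mixed_bracket (hj : JacobiEquation D γ) (i : Fin 3) {α : Fin 3 → ℕ}
    (hα : ∀ n, n ≠ i → α n ≠ 0) :
    (weylIdeal A).mkQ (bracket (form1 (squareForm e γ i)) (form1 (crossForm D t e γ i)) +
      bracket (form1 (crossForm D t e γ (i + 1))) (form1 (crossForm D t e γ (i + 2)))) ∈
        F3 (A := A) α := by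
  have hlie (f : A) : D (i + 1) (D (i + 2) f) - D (i + 2) (D (i + 1) f)
      + 2 * γ i 1 * D i f + (γ (i + 2) 2 + γ (i + 2) 3) * D (i + 1) f
      + (γ (i + 1) 4 - γ (i + 1) 2) * D (i + 2) f = 0 := by
    have := congrArg (fun X => X f) (hr.lie i)
    simp only [Derivation.commutator_apply, Derivation.sub_apply, Derivation.smul_apply,
      smul_eq_mul] at this
    linear_combination this
  have hcl := hr.closed i
  have hji := hj i
  have hsec : InSector i.succ (bracket (form1 (squareForm e γ i)) (form1 (crossForm D t e γ i)) +
      bracket (form1 (crossForm D t e γ (i + 1))) (form1 (crossForm D t e γ (i + 2)))) := by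
    have h1 := (squareForm_sector (e := e) (γ := γ) i).bracket
      (crossForm_sector (D := D) (t := t) (e := e) (γ := γ) i) (compat_zero_right i.succ)
    have h2 := (crossForm_sector (D := D) (t := t) (e := e) (γ := γ) (i + 1)).bracket
      (crossForm_sector (D := D) (t := t) (e := e) (γ := γ) (i + 2)) (compat_cyclic i)
    exact fun n => Submodule.add_mem _ (h1 n) (h2 n)
  refine InSector.mem_F3_succ ?_ hsec ?_ ?_ ?_ ?_ hα
  · intro J hJ
    rw [Pi.add_apply, bracket_isDeg _ _ J hJ, bracket_isDeg _ _ J hJ, add_zero]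
  · rw [Pi.add_apply, der_add, squareForm, crossForm, der_W1_even_odd, crossForm, crossForm,
      der_W1_odd_odd, ← smul_add, rotCoeff_add, if_pos rfl]
    convert smul_zero _
    ext f
    have hlf := hlie f
    simp only [add_one_add_one, add_one_add_two, add_two_add_one, add_two_add_two]
    rw [sum_cyclic _ i]
    simp only [Derivation.add_apply, Derivation.sub_apply, Derivation.smul_apply,
      Derivation.commutator_apply, Derivation.leibniz, smul_eq_mul, h.exp_space, map_add,
      Derivation.zero_apply]
    linear_combination e i ^ 2 * (e (i + 1) * e (i + 2)) * hlf
  · rw [Pi.add_apply, mat_add, Matrix.trace_add, squareForm, crossForm, trace_W1_even_odd,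
      crossForm, crossForm, trace_W1_odd_odd, ← smul_add, rotCoeff_add, if_pos rfl]
    convert smul_zero _
    simp only [add_one_add_one, add_one_add_two, add_two_add_one, add_two_add_two]
    rw [sum_cyclic _ i]
    simp only [Derivation.smul_apply, Derivation.leibniz, smul_eq_mul, h.exp_space, map_add,
      map_neg, h.apply_time']
    linear_combination -4 * e i ^ 2 * (e (i + 1) * e (i + 2)) *
      (hcl + t * (hlie (γ i 0) + hlie (γ (i + 1) 0) + hlie (γ (i + 2) 0)))
  · rw [(insert_W1 i).1, rep_add, Pi.add_apply, squareForm, crossForm, rep_zero_even_odd, crossForm,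
      crossForm, rep_zero_W1_odd_odd, add_zero]
  · rw [(insert_W1 i).2, rep_add, Pi.add_apply, squareForm, crossForm, rep_self_even_odd, crossForm,
      crossForm, rep_self_W1_odd_odd, rotCoeff_add, if_pos rfl]
    simp only [add_one_add_one, add_one_add_two, add_two_add_one, add_two_add_two]
    rw [sum_cyclic _ i]
    simp only [Derivation.smul_apply, Derivation.leibniz, smul_eq_mul, h.exp_space, map_add,
      map_sub, map_neg, h.apply_time', Derivation.leibniz_pow, nsmul_eq_mul, Nat.cast_ofNat,
      two_mul]
    have h2 := hlie (γ (i + 1) 0)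
    have h3 := hlie (γ (i + 2) 0)
    linear_combination e i ^ 2 * (e (i + 1) * e (i + 2)) * (hji - t * (h2 + h3))

theorem gaugeElement_mem_MCFree (hj : JacobiEquation D γ) :
    gaugeElement D0 D t e γ ∈ MCFree A :=
  ⟨gaugeElement_isDeg, toE_gaugeElement_mem_PFree,
    toE_serBracket_mem_sIdeal (kasnerForm_bracket_kasnerForm h hr)
      (kasnerForm_bracket_crossForm h hr) (kasnerForm_bracket_squareForm h hr)
      squareForm_bracket_squareForm crossForm_bracket_crossForm
      (fun _ _ _ hij hα => squareForm_bracket_crossForm hij hα)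
      fun i _ hα => mixed_bracket h hr hj i hα⟩

end Equations

theorem mon_mem_gaugePart {κ : Fin 3 → ℕ} {v : L A} (hv : v ∈ gaugePart κ) (α : Fin 3 → ℕ) :
    mon κ v α ∈ gaugePart α := by
  by_cases h : α = κ
  · rw [h, mon_self]; exact hv
  · rw [mon_of_ne h]; exact Submodule.zero_mem _

theorem overparam_mem_affineGauge (D0 : Derivation ℝ A A) (e μ : Fin 3 → A)
    (β : Fin 3 → Derivation ℝ A A) (γ : Fin 3 → Fin 7 → A) :
    overparam D0 e μ β γ ∈ affineGauge D0 := by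
  refine ⟨_, fun α => ?_, rfl⟩
  rw [Finset.sum_apply]
  refine Submodule.sum_mem _ fun i _ => Submodule.add_mem _ (Submodule.add_mem _
    (Submodule.add_mem _ ?_ ?_) ?_) ?_ <;> refine mon_mem_gaugePart ?_ α
  · refine Submodule.neg_mem _ (Submodule.smul_mem _ _ (Submodule.subset_span ?_))
    exact Or.inl (Or.inl (Or.inl ⟨rfl, i, add_comm _ _⟩))
  · have : (-((e i ^ 2 * γ i 1) •
        (th i (rot i) - th (i + 1) (rot (i + 1)) - th (i + 2) (rot (i + 2)))) : L A) =
        (e i ^ 2 * γ i 1) •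
          (-th i (rot i) + th (i + 1) (rot (i + 1)) + th (i + 2) (rot (i + 2))) := by module
    rw [this]
    refine Submodule.smul_mem _ _ (Submodule.subset_span ?_)
    exact Or.inl (Or.inl (Or.inr ⟨i, rfl, rfl⟩))
  · refine Submodule.smul_mem _ _ (Submodule.sub_mem _ (Submodule.sub_mem _ (Submodule.sub_mem _
      (Submodule.sub_mem _ (Submodule.subset_span ?_) ?_) ?_) ?_) ?_)
    · exact Or.inl (Or.inr ⟨i, rfl, Or.inl ⟨β i, rfl⟩⟩)
    all_goals refine Submodule.smul_mem _ _ (Submodule.subset_span ?_)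
    · exact Or.inl (Or.inr ⟨i, rfl, Or.inr (Or.inl rfl)⟩)
    · exact Or.inl (Or.inr ⟨i, rfl, Or.inr (Or.inr (Or.inr (Or.inl rfl)))⟩)
    · exact Or.inl (Or.inr ⟨i, rfl, Or.inr (Or.inr (Or.inr (Or.inr rfl)))⟩)
    · exact Or.inl (Or.inr ⟨i, rfl, Or.inr (Or.inr (Or.inl (add_comm _ _)))⟩)
  · refine Submodule.smul_mem _ _ (Submodule.subset_span ?_)
    exact Or.inr ⟨i, rfl, rfl⟩

end Sufficiency
end BKL
end

/-! ### Calculus on ℝ × S. -/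

noncomputable section
namespace BKL
section Fields

variable {S : Type*} [TopologicalSpace S] [ChartedSpace (EuclideanSpace ℝ (Fin 3)) S]
  [IsManifold (𝓡 3) ∞ S]

/-- The restriction of a smooth function on `ℝ × S` to `{t} × S`. -/
def restr (t : ℝ) (f : CM S) : CS S :=
  ⟨fun x => f (t, x), f.contMDiff.comp (contMDiff_const.prodMk contMDiff_id)⟩

theorem restr_pull (t : ℝ) (f : CS S) : restr t (pull f) = f := rfl

theorem ext_restr {f g : CM S} (h : ∀ t, restr t f = restr t g) : f = g := by
  ext ⟨t, x⟩
  exact congrArg (fun k : CS S => k x) (h t)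

theorem prodDer_apply (c : ℝ) (X : VF S) (f : CM S) (t : ℝ) (x : S) :
    prodDer c X f (t, x) = c * deriv (fun s => f (s, x)) t + X.der (restr t f) x := by
  have h := mfderiv_prod_eq_add_apply (I := 𝓘(ℝ, ℝ)) (I' := 𝓡 3) (p := (t, x))
    (v := ((c, X x) : TangentSpace (𝓘(ℝ, ℝ).prod (𝓡 3)) (t, x))) f.mdifferentiableAt
  refine h.trans (congrArg₂ (· + ·) ?_ rfl)
  change (mfderiv 𝓘(ℝ, ℝ) 𝓘(ℝ, ℝ) (fun s => f (s, x)) t : ℝ →L[ℝ] ℝ) c = _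
  rw [mfderiv_eq_fderiv]
  exact fderiv_eq_smul_deriv (𝕜 := ℝ) (f := fun s => f (s, x)) (x := t) c

theorem der_zero_field : (0 : VF S).der = 0 := by
  ext f x
  change (mfderiv (𝓡 3) 𝓘(ℝ, ℝ) f x : EuclideanSpace ℝ (Fin 3) →L[ℝ] ℝ) 0 = 0
  exact map_zero _

theorem D0_apply (f : CM S) (t : ℝ) (x : S) : D0 S f (t, x) = deriv (fun s => f (s, x)) t := by
  rw [D0, prodDer_apply, der_zero_field, one_mul]
  exact add_zero _

theorem restr_ext (X : VF S) (f : CM S) (t : ℝ) : restr t (X.ext f) = X.der (restr t f) := by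
  ext x
  change prodDer 0 X f (t, x) = _
  rw [prodDer_apply, zero_mul, zero_add]

theorem ext_pull (X : VF S) (f : CS S) : X.ext (pull f) = pull (X.der f) :=
  ext_restr fun t => by rw [restr_ext, restr_pull, restr_pull]

theorem restr_lie_ext (X Y : VF S) (f : CM S) (t : ℝ) :
    restr t (⁅X.ext, Y.ext⁆ f) = ⁅X.der, Y.der⁆ (restr t f) := by
  rw [Derivation.commutator_apply, Derivation.commutator_apply, ← restr_ext, ← restr_ext,
    ← restr_ext, ← restr_ext]
  rfl

theorem differentiable_time (f : CM S) (x : S) : Differentiable ℝ fun s => f (s, x) := by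
  have h : ContMDiff 𝓘(ℝ, ℝ) 𝓘(ℝ, ℝ) ∞ fun s => f (s, x) :=
    f.contMDiff.comp (contMDiff_id.prodMk contMDiff_const)
  exact (contMDiff_iff_contDiff.1 h).differentiable (by simp)

theorem eq_pull_of_D0_eq_zero {f : CM S} (h : D0 S f = 0) : f = pull (restr 0 f) := by
  ext ⟨t, x⟩
  refine is_const_of_deriv_eq_zero (differentiable_time f x) (fun s => ?_) t 0
  rw [← D0_apply, h]
  rfl

theorem D0_pull (f : CS S) : D0 S (pull f) = 0 := by
  ext ⟨t, x⟩
  rw [D0_apply]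
  exact deriv_const t (f x)

theorem D0_time : D0 S (time S) = 1 := by
  ext ⟨t, x⟩
  rw [D0_apply]
  exact deriv_id t

theorem ext_time (X : VF S) : X.ext (time S) = 0 :=
  ext_restr fun t => by
    rw [restr_ext]
    -- On the slice {t} × S the time function is the constant t, which every derivation annihilates.
    exact Derivation.map_algebraMap X.der t

theorem D0_exp (f : CM S) : D0 S (expCM f) = expCM f * D0 S f := by
  ext ⟨t, x⟩
  change D0 S (expCM f) (t, x) = expCM f (t, x) * D0 S f (t, x)
  rw [D0_apply, D0_apply]
  exact deriv_exp (differentiable_time f x t)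

theorem isUnit_expCM (f : CM S) : IsUnit (expCM f) := by
  refine IsUnit.of_mul_eq_one (expCM (-f)) ?_
  ext p
  change Real.exp (f p) * Real.exp (-f p) = 1
  rw [← Real.exp_add, add_neg_cancel, Real.exp_zero]

section Diffeo

variable (φ : S ≃ₘ⟮𝓡 3, 𝓡 3⟯ EuclideanSpace ℝ (Fin 3))

/-- The image of a vector field under the differential of a diffeomorphism. -/
def pushVec (X : VF S) (x : S) : EuclideanSpace ℝ (Fin 3) :=
  (mfderiv (𝓡 3) (𝓡 3) φ x : EuclideanSpace ℝ (Fin 3) →L[ℝ] EuclideanSpace ℝ (Fin 3)) (X x)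

theorem contDiff_comp_symm (f : CS S) : ContDiff ℝ ∞ fun y => f (φ.symm y) :=
  contMDiff_iff_contDiff.1 (f.contMDiff.comp φ.symm.contMDiff)

/-- Transport to ℝ³ makes the calculus of normed spaces available, notably symmetry of second
derivatives and the chain rule for the exponential. -/
theorem der_apply (X : VF S) (f : CS S) (x : S) :
    X.der f x = fderiv ℝ (fun y => f (φ.symm y)) (φ x) (pushVec φ X x) := by
  have h1 : (f : S → ℝ) = (fun y => f (φ.symm y)) ∘ φ := by
    funext z
    simp
  have h2 : MDifferentiableAt (𝓡 3) 𝓘(ℝ, ℝ) (fun y => f (φ.symm y)) (φ x) :=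
    (contMDiff_iff_contDiff.2 (contDiff_comp_symm φ f)).mdifferentiable (by simp) _
  have h3 : MDifferentiableAt (𝓡 3) (𝓡 3) φ x := φ.contMDiff.mdifferentiable (by simp) x
  change mfderiv (𝓡 3) 𝓘(ℝ, ℝ) f x (X x) = _
  have h4 := mfderiv_comp x h2 h3
  rw [← h1, mfderiv_eq_fderiv] at h4
  rw [h4]
  rfl

theorem contDiff_of_contMDiff_prod {V : Type*} [NormedAddCommGroup V] [NormedSpace ℝ V]
    {g : ℝ × V → ℝ} (h : ContMDiff (𝓘(ℝ, ℝ).prod 𝓘(ℝ, V)) 𝓘(ℝ, ℝ) ∞ g) : ContDiff ℝ ∞ g := by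
  rw [← modelWithCornersSelf_prod, chartedSpaceSelf_prod] at h
  exact contMDiff_iff_contDiff.1 h

theorem contDiff_prod_comp_symm (f : CM S) :
    ContDiff ℝ ∞ fun p : ℝ × EuclideanSpace ℝ (Fin 3) => f (p.1, φ.symm p.2) := by
  refine contDiff_of_contMDiff_prod ?_
  exact f.contMDiff.comp (contMDiff_fst.prodMk (φ.symm.contMDiff.comp contMDiff_snd))

theorem fderiv_slice {E F : Type*} [NormedAddCommGroup E] [NormedSpace ℝ E] [NormedAddCommGroup F]
    [NormedSpace ℝ F] {g : E × F → ℝ} (hg : Differentiable ℝ g) (a : E) (b v : F) :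
    fderiv ℝ (fun y => g (a, y)) b v = fderiv ℝ g (a, b) (0, v) := by
  have h := (hg (a, b)).hasFDerivAt.comp b ((hasFDerivAt_const a b).prodMk (hasFDerivAt_id b))
  have h' : fderiv ℝ (fun y => g (a, y)) b = _ := h.fderiv
  rw [h']
  rfl

theorem deriv_slice {F : Type*} [NormedAddCommGroup F]
    [NormedSpace ℝ F] {g : ℝ × F → ℝ} (hg : Differentiable ℝ g) (a : ℝ) (b : F) :
    deriv (fun s => g (s, b)) a = fderiv ℝ g (a, b) (1, 0) := by
  have h := (hg (a, b)).hasFDerivAt.comp_hasDerivAt a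
    ((hasDerivAt_id a).prodMk (hasDerivAt_const a b))
  exact h.deriv

include φ in
-- The coefficients of X do not depend on t. In coordinates both orders therefore give the second
-- derivative in the directions (1, 0) and (0, X), which is symmetric.
theorem D0_lie_ext (X : VF S) : ⁅D0 S, X.ext⁆ = 0 := by
  ext f ⟨t, x⟩
  set g : ℝ × EuclideanSpace ℝ (Fin 3) → ℝ := fun p => f (p.1, φ.symm p.2) with hg
  have hgs : ContDiff ℝ ∞ g := contDiff_prod_comp_symm φ f
  have hgd : Differentiable ℝ g := hgs.differentiable (by simp)
  have hg' : Differentiable ℝ (fderiv ℝ g) :=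
    (contDiff_infty_iff_fderiv.1 hgs).2.differentiable (by simp)
  have happ (w : ℝ × EuclideanSpace ℝ (Fin 3)) : Differentiable ℝ fun p => fderiv ℝ g p w :=
    fun p => (hg' p).clm_apply (differentiableAt_const w)
  have hfd (w : ℝ × EuclideanSpace ℝ (Fin 3)) (p : ℝ × EuclideanSpace ℝ (Fin 3)) :
      fderiv ℝ (fun p => fderiv ℝ g p w) p = (fderiv ℝ (fderiv ℝ g) p).flip w := by
    have := ((hg' p).hasFDerivAt.clm_apply (hasFDerivAt_const w p)).fderiv
    rw [this, ContinuousLinearMap.comp_zero, zero_add]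
  have hX (s : ℝ) (z : S) : X.ext f (s, z) = fderiv ℝ g (s, φ z) (0, pushVec φ X z) := by
    have h1 := congrArg (fun k : CS S => k z) (restr_ext X f s)
    refine h1.trans ((der_apply φ X _ z).trans ?_)
    rw [← fderiv_slice hgd]
    rfl
  have h0 (s : ℝ) (y : EuclideanSpace ℝ (Fin 3)) :
      D0 S f (s, φ.symm y) = fderiv ℝ g (s, y) (1, 0) := by
    rw [D0_apply, ← deriv_slice hgd]
  have e1 : D0 S (X.ext f) (t, x) =
      fderiv ℝ (fderiv ℝ g) (t, φ x) (1, 0) (0, pushVec φ X x) := by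
    rw [D0_apply]
    simp only [hX]
    rw [deriv_slice (g := fun p => fderiv ℝ g p (0, pushVec φ X x)) (happ _), hfd]
    rfl
  have e2 : X.ext (D0 S f) (t, x) =
      fderiv ℝ (fderiv ℝ g) (t, φ x) (0, pushVec φ X x) (1, 0) := by
    have h1 := congrArg (fun k : CS S => k x) (restr_ext X (D0 S f) t)
    refine h1.trans ((der_apply φ X _ x).trans ?_)
    have h2 : (fun y => restr t (D0 S f) (φ.symm y)) = fun y => fderiv ℝ g (t, y) (1, 0) :=
      funext fun y => h0 t y
    rw [h2, fderiv_slice (g := fun p => fderiv ℝ g p (1, 0)) (happ _), hfd]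
    rfl
  have hsymm := hgs.contDiffAt.isSymmSndFDerivAt (x := (t, φ x))
    (by rw [minSmoothness_of_isRCLikeNormedField]; exact WithTop.coe_le_coe.2 (le_top : (2 : ℕ∞) ≤ ⊤))
  rw [Derivation.commutator_apply]
  change D0 S (X.ext f) (t, x) - X.ext (D0 S f) (t, x) = 0
  rw [e1, e2, hsymm, sub_self]

include φ in
theorem ext_exp (X : VF S) (f : CM S) : X.ext (expCM f) = expCM f * X.ext f := by
  refine ext_restr fun t => ?_
  have h : restr t (expCM f * X.ext f) = restr t (expCM f) * restr t (X.ext f) := rfl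
  rw [h, restr_ext, restr_ext]
  ext x
  change X.der (restr t (expCM f)) x = Real.exp (f (t, x)) * X.der (restr t f) x
  rw [der_apply φ, der_apply φ]
  have h2 : Differentiable ℝ fun y => restr t f (φ.symm y) :=
    (contDiff_comp_symm φ _).differentiable (by simp)
  have h3 := (h2 (φ x)).hasFDerivAt.exp.fderiv
  change fderiv ℝ (fun y => Real.exp (restr t f (φ.symm y))) (φ x) _ = _
  rw [h3, φ.symm_apply_apply]
  rfl

include φ in
theorem comoving_of_frame (F : Frame S) (γ : Fin 3 → Fin 5 → CM S) :
    Comoving (D0 S) (fun i => (F.D i).ext) (time S) (fun i => expCM (time S * γ i 0)) γ where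
  apply_time := D0_time
  apply_time' _ := ext_time _
  comm _ := D0_lie_ext φ _
  apply_exp _ := D0_exp _
  apply_exp' _ _ := ext_exp φ _ _
  isUnit _ := isUnit_expCM _

end Diffeo
end Fields
end BKL
end

/-! ### The Jacobi identity and linear independence of frames. -/

noncomputable section
namespace BKL

section FreeFrames

variable {A : Type*} [CommRing A] [Algebra ℝ A] {D : Fin 3 → Derivation ℝ A A}

theorem structure_antisymm (hD : ∀ a : Fin 3 → A, ∑ i, a i • D i = 0 → a = 0)
    {c : Fin 3 → Fin 3 → Fin 3 → A} (hc : ∀ j k, ⁅D j, D k⁆ = ∑ i, c j k i • D i)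
    (j k i : Fin 3) : c j k i = -c k j i := by
  have h := hD (fun i => c j k i + c k j i) (by
    simp only [add_smul, Finset.sum_add_distrib, ← hc]
    rw [← lie_skew, neg_add_cancel])
  exact eq_neg_of_add_eq_zero_left (congrFun h i)

/-- The Jacobi identity for D_1, D_2, D_3, expanded with the bracket relations, is a linear relation
among the D_n. For a free frame its coefficients vanish, and the one of D_i is the claim. -/
theorem jacobiEquation_of_lie (hD : ∀ a : Fin 3 → A, ∑ i, a i • D i = 0 → a = 0)
    {γ : Fin 3 → Fin 5 → A}
    (hlie : ∀ i, ⁅D (i + 1), D (i + 2)⁆ = (-2 * γ i 1) • D i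
      - (γ (i + 2) 2 + γ (i + 2) 3) • D (i + 1) - (γ (i + 1) 4 - γ (i + 1) 2) • D (i + 2)) :
    JacobiEquation D γ := by
  intro i
  have hj := hlie (i + 1)
  have hk := hlie (i + 2)
  have hi := hlie i
  simp only [add_one_add_one, add_one_add_two, add_two_add_one, add_two_add_two] at hj hk
  have hne1 : i + 1 ≠ i := by clear * -; revert i; decide
  have hne2 : i + 2 ≠ i := by clear * -; revert i; decide
  have hne3 : i + 2 ≠ i + 1 := by clear * -; revert i; decide
  have hjac (f : A) :
      ⁅D i, ⁅D (i + 1), D (i + 2)⁆⁆ f + ⁅D (i + 1), ⁅D (i + 2), D i⁆⁆ f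
        + ⁅D (i + 2), ⁅D i, D (i + 1)⁆⁆ f = 0 := by
    simp only [Derivation.commutator_apply, map_sub]
    ring
  have hi' (f : A) := congrArg (fun X => X f) hi
  have hj' (f : A) := congrArg (fun X => X f) hj
  have hk' (f : A) := congrArg (fun X => X f) hk
  simp only [Derivation.commutator_apply, Derivation.sub_apply, Derivation.smul_apply,
    smul_eq_mul] at hi' hj' hk'
  -- The three coefficients of the expanded cyclic sum; each is a cyclic shift of the first.
  have key := hD (fun m => if m = i then
      -2 * D i (γ i 1) + D (i + 1) (γ (i + 2) 2 - γ (i + 2) 4) - D (i + 2) (γ (i + 1) 2 + γ (i + 1) 3)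
        + (γ (i + 2) 2 + γ (i + 2) 3) * (γ (i + 1) 2 + γ (i + 1) 3)
        - (γ (i + 1) 2 - γ (i + 1) 4) * (γ (i + 2) 2 - γ (i + 2) 4)
        - 2 * γ i 1 * (-2 * γ i 2 - γ i 3 + γ i 4)
    else if m = i + 1 then
      -2 * D (i + 1) (γ (i + 1) 1) + D (i + 2) (γ i 2 - γ i 4) - D i (γ (i + 2) 2 + γ (i + 2) 3)
        + (γ i 2 + γ i 3) * (γ (i + 2) 2 + γ (i + 2) 3)
        - (γ (i + 2) 2 - γ (i + 2) 4) * (γ i 2 - γ i 4)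
        - 2 * γ (i + 1) 1 * (-2 * γ (i + 1) 2 - γ (i + 1) 3 + γ (i + 1) 4)
    else
      -2 * D (i + 2) (γ (i + 2) 1) + D i (γ (i + 1) 2 - γ (i + 1) 4) - D (i + 1) (γ i 2 + γ i 3)
        + (γ (i + 1) 2 + γ (i + 1) 3) * (γ i 2 + γ i 3)
        - (γ i 2 - γ i 4) * (γ (i + 1) 2 - γ (i + 1) 4)
        - 2 * γ (i + 2) 1 * (-2 * γ (i + 2) 2 - γ (i + 2) 3 + γ (i + 2) 4)) (by
    ext f
    have h1 := hjac f
    rw [hi, hj, hk] at h1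
    rw [sum_cyclic _ i]
    simp only [if_true, if_neg hne1, if_neg hne2, if_neg hne3, Derivation.commutator_apply,
      Derivation.add_apply, Derivation.sub_apply, Derivation.smul_apply, Derivation.leibniz,
      smul_eq_mul, map_add, map_sub, Derivation.zero_apply, neg_mul, map_neg, two_mul] at h1 ⊢
    -- Differentiating the structure functions leaves commutators [D_n, D_m] with these
    -- coefficients, which the bracket relations express once more in the frame.
    linear_combination h1 + (2 * γ i 2 + γ i 3 - γ i 4) * hi' f
      + (2 * γ (i + 1) 2 + γ (i + 1) 3 - γ (i + 1) 4) * hj' f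
      + (2 * γ (i + 2) 2 + γ (i + 2) 3 - γ (i + 2) 4) * hk' f)
  have h := congrFun key i
  simp only [if_true, Pi.zero_apply, map_add, map_sub] at h
  linear_combination -h

/-- A one-form that is closed in terms of a frame has symmetric derivatives in terms of
coordinates `h`. -/
theorem closed_of_frame {D : Fin 3 → Derivation ℝ A A} {h w a : Fin 3 → A}
    (ha : ∀ m, a m = ∑ l, D m (h l) * w l) {j k : Fin 3} {b : Fin 3 → A}
    (hlie : ⁅D j, D k⁆ = ∑ m, b m • D m)
    (hcl : D j (a k) - D k (a j) = ∑ m, b m * a m) :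
    ∑ l, D k (h l) * D j (w l) = ∑ l, D j (h l) * D k (w l) := by
  have h0 := congrArg (fun X => X (h 0)) hlie
  have h1 := congrArg (fun X => X (h 1)) hlie
  have h2 := congrArg (fun X => X (h 2)) hlie
  simp only [ha, Fin.sum_univ_three, Derivation.commutator_apply, Derivation.add_apply,
    Derivation.smul_apply, smul_eq_mul, map_add, Derivation.leibniz] at h0 h1 h2 hcl ⊢
  linear_combination hcl - w 0 * h0 - w 1 * h1 - w 2 * h2

end FreeFrames

section Frames

variable {S : Type*} [TopologicalSpace S] [ChartedSpace (EuclideanSpace ℝ (Fin 3)) S]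
  [IsManifold (𝓡 3) ∞ S] (φ : S ≃ₘ⟮𝓡 3, 𝓡 3⟯ EuclideanSpace ℝ (Fin 3))

theorem pushVec_linearIndependent (F : Frame S) (x : S) :
    LinearIndependent ℝ fun i => pushVec φ (F.D i) x := by
  have h := (F.linearIndependent x).map' (φ.mfderivToContinuousLinearEquiv (by simp) x).toLinearMap
    (LinearEquiv.ker _)
  exact h

/-- The coordinate functions given by a diffeomorphism to `ℝ³`. -/
def coord (l : Fin 3) : CS S :=
  ⟨fun x => φ x l, (contMDiff_iff_contDiff.2
    (EuclideanSpace.proj (𝕜 := ℝ) l : EuclideanSpace ℝ (Fin 3) →L[ℝ] ℝ).contDiff).comp φ.contMDiff⟩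

theorem der_coord (X : VF S) (l : Fin 3) (x : S) : X.der (coord φ l) x = pushVec φ X x l := by
  rw [der_apply φ]
  have : (fun y => coord φ l (φ.symm y)) =
      (EuclideanSpace.proj (𝕜 := ℝ) l : EuclideanSpace ℝ (Fin 3) →L[ℝ] ℝ) := by
    funext y
    change φ (φ.symm y) l = y l
    rw [φ.apply_symm_apply]
  rw [this, ContinuousLinearMap.fderiv]
  rfl

include φ in
-- Applying the relation to the three coordinate functions recovers a linear relation among the
-- tangent vectors at each point.
theorem frame_free (F : Frame S) (a : Fin 3 → CS S) (h : ∑ i, a i • (F.D i).der = 0) : a = 0 := by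
  funext i
  ext x
  have hli := Fintype.linearIndependent_iff.1 (pushVec_linearIndependent φ F x) (fun i => a i x)
  refine hli ?_ i
  ext l
  have h1 := congrArg (fun X : Derivation ℝ (CS S) (CS S) => X (coord φ l) x) h
  simp only [Fin.sum_univ_three] at h1 ⊢
  change a 0 x * (F.D 0).der (coord φ l) x + a 1 x * (F.D 1).der (coord φ l) x +
    a 2 x * (F.D 2).der (coord φ l) x = 0 at h1
  rw [der_coord, der_coord, der_coord] at h1
  exact h1

end Frames
end BKL
end

/-! ### The Poincaré lemma in terms of a frame. -/

noncomputable section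
namespace BKL
section Potential

variable {S : Type*} [TopologicalSpace S] [ChartedSpace (EuclideanSpace ℝ (Fin 3)) S]
  [IsManifold (𝓡 3) ∞ S] (φ : S ≃ₘ⟮𝓡 3, 𝓡 3⟯ EuclideanSpace ℝ (Fin 3))

theorem isUnit_of_forall_ne_zero {f : CS S} (h : ∀ x, f x ≠ 0) : IsUnit f := by
  refine IsUnit.of_mul_eq_one ⟨fun x => (f x)⁻¹, f.contMDiff.inv₀ h⟩ ?_
  ext x
  exact mul_inv_cancel₀ (h x)

/-- The components of a frame in the coordinates given by a diffeomorphism to `ℝ³`. -/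
def frameMatrix (F : Frame S) : Matrix (Fin 3) (Fin 3) (CS S) :=
  Matrix.of fun m l => (F.D m).der (coord φ l)

theorem isUnit_det_frameMatrix (F : Frame S) : IsUnit (frameMatrix φ F).det := by
  refine isUnit_of_forall_ne_zero fun x => ?_
  have h1 : (frameMatrix φ F).det x =
      (Matrix.of fun m l => pushVec φ (F.D m) x l : Matrix (Fin 3) (Fin 3) ℝ).det := by
    rw [Matrix.det_fin_three, Matrix.det_fin_three]
    simp only [Matrix.of_apply, ← der_coord]
    rfl
  rw [h1]
  have h2 := (pushVec_linearIndependent φ F x).map'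
    (WithLp.linearEquiv 2 ℝ (Fin 3 → ℝ)).toLinearMap (LinearEquiv.ker _)
  exact ((Matrix.isUnit_iff_isUnit_det _).1 (Matrix.linearIndependent_rows_iff_isUnit.1 h2)).ne_zero

/-- By bilinearity symmetry may be tested on basis vectors, and up to order there are only three
pairs of distinct ones. -/
theorem symmetric_of_frame {V : Type*} [NormedAddCommGroup V] [NormedSpace ℝ V]
    (L : V →L[ℝ] V →L[ℝ] ℝ) (v : Module.Basis (Fin 3) ℝ V)
    (h : ∀ i : Fin 3, L (v (i + 1)) (v (i + 2)) = L (v (i + 2)) (v (i + 1))) (x y : V) :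
    L x y = L y x := by
  have hb (m n : Fin 3) : L (v m) (v n) = L (v n) (v m) := by
    have h0 := h 0
    have h1 := h 1
    have h2 := h 2
    change L (v 1) (v 2) = L (v 2) (v 1) at h0
    change L (v 2) (v 0) = L (v 0) (v 2) at h1
    change L (v 0) (v 1) = L (v 1) (v 0) at h2
    fin_cases m <;> fin_cases n <;>
      first | rfl | assumption | exact h0.symm | exact h1.symm | exact h2.symm
  have h1 (m : Fin 3) : (L (v m) : V →ₗ[ℝ] ℝ) = L.flip (v m) := v.ext fun n => hb m n
  have h2 : (L.flip y : V →ₗ[ℝ] ℝ) = L y :=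
    v.ext fun m => congrArg (fun T : V →ₗ[ℝ] ℝ => T y) (h1 m)
  exact congrArg (fun T : V →ₗ[ℝ] ℝ => T x) h2

include φ in
/-- The Poincaré lemma for one-forms on `S`, in terms of a frame. -/
theorem exists_potential (F : Frame S) (a : Fin 3 → CS S) (b : Fin 3 → Fin 3 → CS S)
    (hlie : ∀ i, ⁅(F.D (i + 1)).der, (F.D (i + 2)).der⁆ = ∑ m, b i m • (F.D m).der)
    (hcl : ∀ i, (F.D (i + 1)).der (a (i + 2)) - (F.D (i + 2)).der (a (i + 1)) =
      ∑ m, b i m * a m) : ∃ ξ : CS S, ∀ m, (F.D m).der ξ = a m := by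
  -- The coordinate components w of the one-form whose frame components are a: the frame matrix
  -- times w is a, and its determinant is a unit.
  set w : Fin 3 → CS S := (frameMatrix φ F)⁻¹.mulVec a with hw
  have ha (m) : a m = ∑ l, (F.D m).der (coord φ l) * w l := by
    have : (frameMatrix φ F).mulVec w = a := by
      rw [hw, Matrix.mulVec_mulVec, Matrix.mul_nonsing_inv _ (isUnit_det_frameMatrix φ F),
        Matrix.one_mulVec]
    exact (congrFun this m).symm
  set g : Fin 3 → EuclideanSpace ℝ (Fin 3) → ℝ := fun l y => w l (φ.symm y) with hg
  have hgs (l) : ContDiff ℝ ∞ (g l) := contDiff_comp_symm φ (w l)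
  set pr : Fin 3 → EuclideanSpace ℝ (Fin 3) →L[ℝ] ℝ := fun l => EuclideanSpace.proj l with hpr
  set η : EuclideanSpace ℝ (Fin 3) → EuclideanSpace ℝ (Fin 3) →L[ℝ] ℝ :=
    fun y => ∑ l, g l y • pr l with hη
  have hηs : ContDiff ℝ ∞ η := ContDiff.sum fun l _ => (hgs l).smul contDiff_const
  have hηd (y u v : EuclideanSpace ℝ (Fin 3)) :
      fderiv ℝ η y u v = ∑ l, fderiv ℝ (g l) y u * v l := by
    have h1 : HasFDerivAt η (∑ l, (fderiv ℝ (g l) y).smulRight (pr l)) y :=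
      HasFDerivAt.fun_sum fun l _ =>
        (((hgs l).differentiable (by simp) y).hasFDerivAt.smul_const (pr l))
    rw [h1.fderiv]
    simp [hpr]
  -- Symmetry of the derivative of η is its closedness; it is tested on the image of the frame,
  -- where it is the hypothesis on a.
  have hsymm (y u v : EuclideanSpace ℝ (Fin 3)) : fderiv ℝ η y u v = fderiv ℝ η y v u := by
    set x := φ.symm y with hx
    have hy : φ x = y := φ.apply_symm_apply y
    refine symmetric_of_frame (fderiv ℝ η y) (basisOfLinearIndependentOfCardEqFinrank
      (pushVec_linearIndependent φ F x) (by simp)) (fun i => ?_) u v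
    simp only [coe_basisOfLinearIndependentOfCardEqFinrank, hηd]
    have h1 := congrArg (fun k : CS S => k x) (closed_of_frame (h := coord φ) (w := w) ha
      (hlie i) (hcl i))
    simp only [Fin.sum_univ_three] at h1 ⊢
    have hd (m l : Fin 3) : fderiv ℝ (g l) y (pushVec φ (F.D m) x) = (F.D m).der (w l) x := by
      rw [der_apply φ, hy]
    simp only [hd, ← der_coord φ]
    have h2 : (F.D (i + 2)).der (coord φ 0) x * (F.D (i + 1)).der (w 0) x +
        (F.D (i + 2)).der (coord φ 1) x * (F.D (i + 1)).der (w 1) x +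
        (F.D (i + 2)).der (coord φ 2) x * (F.D (i + 1)).der (w 2) x =
        (F.D (i + 1)).der (coord φ 0) x * (F.D (i + 2)).der (w 0) x +
        (F.D (i + 1)).der (coord φ 1) x * (F.D (i + 2)).der (w 1) x +
        (F.D (i + 1)).der (coord φ 2) x * (F.D (i + 2)).der (w 2) x := h1
    linear_combination h2
  obtain ⟨ξ, hξ⟩ := convex_univ.exists_forall_hasFDerivAt_of_fderiv_symmetric (𝕜 := ℝ) isOpen_univ
    (hηs.differentiable (by simp)).differentiableOn fun y _ => hsymm y
  have hξs : ContDiff ℝ ∞ ξ := by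
    refine contDiff_infty_iff_fderiv.2 ⟨fun y => (hξ y trivial).differentiableAt, ?_⟩
    rw [funext fun y => (hξ y trivial).fderiv]
    exact hηs
  let Ξ : CS S := ⟨fun x => ξ (φ x), (contMDiff_iff_contDiff.2 hξs).comp φ.contMDiff⟩
  refine ⟨Ξ, fun m => ?_⟩
  ext x
  rw [der_apply φ]
  have h1 : (fun y => ξ (φ (φ.symm y))) = ξ := funext fun y => by rw [φ.apply_symm_apply]
  change fderiv ℝ (fun y => ξ (φ (φ.symm y))) (φ x) _ = _
  rw [h1, (hξ _ trivial).fderiv, ha]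
  simp only [hη, hg, hpr, Fin.sum_univ_three, φ.symm_apply_apply]
  change w 0 x * pushVec φ (F.D m) x 0 + w 1 x * pushVec φ (F.D m) x 1 +
    w 2 x * pushVec φ (F.D m) x 2 = (F.D m).der (coord φ 0) x * w 0 x +
    (F.D m).der (coord φ 1) x * w 1 x + (F.D m).der (coord φ 2) x * w 2 x
  rw [der_coord, der_coord, der_coord]
  ring

end Potential
end BKL
end

/-! ### Comparison with MC_pre and the main theorem. -/

noncomputable section
namespace BKL
section MainTheorem

variable {S : Type*} [TopologicalSpace S] [ChartedSpace (EuclideanSpace ℝ (Fin 3)) S]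
  [IsManifold (𝓡 3) ∞ S] (φ : S ≃ₘ⟮𝓡 3, 𝓡 3⟯ EuclideanSpace ℝ (Fin 3))

theorem normalElement_eq_gaugeElement (F : Frame S) (γ : Fin 3 → Fin 5 → CM S) :
    normalElement F γ = gaugeElement (D0 S) (fun i => (F.D i).ext) (time S)
      (fun i => expCM (time S * γ i 0)) γ :=
  overparam_eq_gaugeElement (D := fun i => (F.D i).ext) fun _ => ext_time _

theorem pull_injective : Function.Injective (pull : CS S → CM S) := fun _ _ h =>
  congrArg (restr 0) h

theorem MCPre.lie (T : MCPre S) (i : Fin 3) :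
    ⁅(T.frame.D (i + 1)).der, (T.frame.D (i + 2)).der⁆ = (-2 * T.g i 1) • (T.frame.D i).der
      - (T.g (i + 2) 2 + T.g (i + 2) 3) • (T.frame.D (i + 1)).der
      - (T.g (i + 1) 4 - T.g (i + 1) 2) • (T.frame.D (i + 2)).der := by
  have h1 : -2 * T.g i 1 = T.c (i + 1) (i + 2) i := by
    change -2 * ((-1 / 2 : ℝ) • T.c (i + 1) (i + 2) i) = _
    rw [mul_smul_comm, neg_mul, smul_neg, ← neg_smul, two_mul, ← two_smul ℝ, smul_smul]
    norm_num
  have h2 : T.g (i + 2) 2 + T.g (i + 2) 3 = -T.c (i + 1) (i + 2) (i + 1) := by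
    change T.g (i + 2) 2 + (-T.c (i + 2 + 2) (i + 2) (i + 2 + 2) - T.g (i + 2) 2) = _
    rw [add_two_add_two]
    ring
  have h3 : T.g (i + 1) 4 - T.g (i + 1) 2 = -T.c (i + 1) (i + 2) (i + 2) := by
    change (-T.c (i + 1) (i + 1 + 1) (i + 1 + 1) + T.g (i + 1) 2) - T.g (i + 1) 2 = _
    rw [add_one_add_one]
    ring
  rw [T.lie_eq, sum_cyclic _ i, h1, h2, h3]
  module

include φ in
theorem MCPre.reducedEquations (T : MCPre S) :
    ReducedEquations (D0 S) (fun i => (T.frame.D i).ext) fun i a => pull (T.g i a) where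
  const _ _ := D0_pull _
  alg := congrArg pull (T.constraint_alg.symm)
  constraint i := by
    -- The constraint contains c_{ik}^k but g_i³ contains c_{ki}^k. Antisymmetry is not a field of
    -- the structure and comes from freeness of the frame.
    have hc := structure_antisymm (frame_free φ T.frame) T.lie_eq i (i + 2) (i + 2)
    have h := T.constraint_diff i
    have h3 : T.g i 3 = -T.c (i + 2) i (i + 2) - T.g i 2 := rfl
    have h4 : T.g i 4 = -T.c i (i + 1) (i + 1) + T.g i 2 := rfl
    have h2 : (T.frame.D i).der T.ξ = T.g i 2 := rfl
    have h0 (n : Fin 3) : T.g0 n = T.g n 0 := rfl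
    simp only [h2, h0] at h
    have key : (T.frame.D i).der (T.g (i + 1) 0 + T.g (i + 2) 0) + T.g i 0 * (T.g i 3 - T.g i 4)
        - T.g i 2 * (T.g (i + 1) 0 + T.g (i + 2) 0) - T.g i 3 * T.g (i + 2) 0
        + T.g i 4 * T.g (i + 1) 0 = 0 := by
      rw [hc] at h
      rw [h3, h4]
      linear_combination -h
    have hp := congrArg pull key
    refine Eq.trans ?_ hp
    change (T.frame.D i).ext (pull (T.g (i + 1) 0 + T.g (i + 2) 0)) + _ - _ - _ + _ = _
    rw [ext_pull]
    rfl
  lie i := by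
    refine Derivation.ext fun f => ext_restr fun t => ?_
    rw [restr_lie_ext, T.lie i]
    simp only [Derivation.sub_apply, Derivation.smul_apply, ← restr_ext]
    rfl
  closed i := by
    -- As g_i² = D_i(ξ), closedness is the bracket relation applied to ξ.
    have h := congrArg (fun X => X T.ξ) (T.lie i)
    have key : (T.frame.D (i + 1)).der (T.g (i + 2) 2) - (T.frame.D (i + 2)).der (T.g (i + 1) 2)
        + 2 * T.g i 1 * T.g i 2 + T.g (i + 1) 2 * T.g (i + 2) 3
        + T.g (i + 1) 4 * T.g (i + 2) 2 = 0 := by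
      have h2 (n : Fin 3) : (T.frame.D n).der T.ξ = T.g n 2 := rfl
      simp only [Derivation.commutator_apply, Derivation.sub_apply, Derivation.smul_apply,
        smul_eq_mul, h2] at h
      linear_combination h
    simp only [ext_pull]
    exact congrArg pull key

include φ in
theorem MCPre.jacobiEquation (T : MCPre S) :
    JacobiEquation (fun i => (T.frame.D i).ext) fun i a => pull (T.g i a) := by
  intro i
  have h := jacobiEquation_of_lie (frame_free φ T.frame) T.lie i
  simp only [ext_pull]
  exact congrArg pull h

include φ in
-- The bracket relations determine all structure functions from the γ_i¹, ..., γ_i⁴, and ξ is a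
-- potential of the closed one-form with frame components γ_i². The formulas for g_i¹, g_i³, g_i⁴
-- are then solved identically.
theorem exists_MCPre (F : Frame S) (γ : Fin 3 → Fin 5 → CS S)
    (h : ReducedEquations (D0 S) (fun i => (F.D i).ext) fun i a => pull (γ i a)) :
    ∃ T : MCPre S, T.frame = F ∧ ∀ i a, γ i a = T.g i a := by
  have hlie (i : Fin 3) : ⁅(F.D (i + 1)).der, (F.D (i + 2)).der⁆ = (-2 * γ i 1) • (F.D i).der
      - (γ (i + 2) 2 + γ (i + 2) 3) • (F.D (i + 1)).der
      - (γ (i + 1) 4 - γ (i + 1) 2) • (F.D (i + 2)).der := by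
    refine Derivation.ext fun f => ?_
    have h1 := congrArg (fun X => restr 0 (X (pull f))) (h.lie i)
    simp only [restr_lie_ext, restr_pull] at h1
    rw [h1]
    simp only [Derivation.sub_apply, Derivation.smul_apply, ext_pull]
    rfl
  have hclosed (i : Fin 3) : (F.D (i + 1)).der (γ (i + 2) 2) - (F.D (i + 2)).der (γ (i + 1) 2)
      + 2 * γ i 1 * γ i 2 + γ (i + 1) 2 * γ (i + 2) 3 + γ (i + 1) 4 * γ (i + 2) 2 = 0 := by
    have h1 := h.closed i
    simp only [ext_pull] at h1
    exact pull_injective h1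
  have hcon (i : Fin 3) : (F.D i).der (γ (i + 1) 0 + γ (i + 2) 0) + γ i 0 * (γ i 3 - γ i 4)
      - γ i 2 * (γ (i + 1) 0 + γ (i + 2) 0) - γ i 3 * γ (i + 2) 0 + γ i 4 * γ (i + 1) 0 = 0 := by
    have h1 := h.constraint i
    change (F.D i).ext (pull (γ (i + 1) 0 + γ (i + 2) 0)) + _ - _ - _ + _ = _ at h1
    rw [ext_pull] at h1
    exact pull_injective h1
  have halg : γ 1 0 * γ 2 0 + γ 2 0 * γ 0 0 + γ 0 0 * γ 1 0 = 0 := pull_injective h.alg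
  have hn (i : Fin 3) : i + 1 ≠ i ∧ i + 2 ≠ i ∧ i + 2 ≠ i + 1 := by clear * -; revert i; decide
  let b : Fin 3 → Fin 3 → CS S := fun i m =>
    if m = i then -2 * γ i 1 else if m = i + 1 then -(γ (i + 2) 2 + γ (i + 2) 3)
    else γ (i + 1) 2 - γ (i + 1) 4
  have b0 (i : Fin 3) : b i i = -2 * γ i 1 := if_pos rfl
  have b1 (i : Fin 3) : b i (i + 1) = -(γ (i + 2) 2 + γ (i + 2) 3) := by
    simp only [b, if_neg (hn i).1, if_true]
  have b2 (i : Fin 3) : b i (i + 2) = γ (i + 1) 2 - γ (i + 1) 4 := by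
    simp only [b, if_neg (hn i).2.1, if_neg (hn i).2.2]
  have hb (i : Fin 3) : ⁅(F.D (i + 1)).der, (F.D (i + 2)).der⁆ = ∑ m, b i m • (F.D m).der := by
    rw [hlie, sum_cyclic _ i, b0, b1, b2]
    module
  obtain ⟨ξ, hξ⟩ := exists_potential φ F (fun i => γ i 2) b hb fun i => by
    rw [sum_cyclic _ i, b0, b1, b2]
    linear_combination hclosed i
  -- The structure functions of the cyclic pairs, extended antisymmetrically: (j, j+1) is the cyclic
  -- pair opposite to j+2, and (j, j+2) is the reverse of the one opposite to j+1.
  let c : Fin 3 → Fin 3 → Fin 3 → CS S := fun j k m =>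
    if k = j + 1 then b (j + 2) m else if k = j + 2 then -b (j + 1) m else 0
  have c1 (j m : Fin 3) : c j (j + 1) m = b (j + 2) m := if_pos rfl
  have c2 (j m : Fin 3) : c j (j + 2) m = -b (j + 1) m := by
    simp only [c, if_neg (hn j).2.2, if_true]
  have c0 (j m : Fin 3) : c j j m = 0 := by
    simp only [c, if_neg (hn j).1.symm, if_neg (hn j).2.1.symm]
  have hc (j k : Fin 3) : ⁅(F.D j).der, (F.D k).der⁆ = ∑ m, c j k m • (F.D m).der := by
    have hk : k = j ∨ k = j + 1 ∨ k = j + 2 := by clear * -; revert j k; decide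
    rcases hk with rfl | rfl | rfl
    · simp only [c0, zero_smul, Finset.sum_const_zero, lie_self]
    · have := hb (j + 2)
      rw [add_two_add_one, add_two_add_two] at this
      simp only [c1, this]
    · have := hb (j + 1)
      rw [add_one_add_one, add_one_add_two] at this
      rw [← lie_skew, this, Fin.sum_univ_three, Fin.sum_univ_three, c2, c2, c2]
      module
  have cij (i : Fin 3) : c i (i + 1) (i + 1) = γ i 2 - γ i 4 := by
    have := b2 (i + 2)
    rw [add_two_add_two, add_two_add_one] at this
    rw [c1, this]
  have cik (i : Fin 3) : c i (i + 2) (i + 2) = γ i 2 + γ i 3 := by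
    have := b1 (i + 1)
    rw [add_one_add_one, add_one_add_two] at this
    rw [c2, this, neg_neg]
  have cki (i : Fin 3) : c (i + 2) i (i + 2) = -(γ i 2 + γ i 3) := by
    have := b1 (i + 1)
    rw [add_one_add_one, add_one_add_two] at this
    have h1 := c1 (i + 2) (i + 2)
    rw [add_two_add_one, add_two_add_two] at h1
    rw [h1, this]
  have cjk (i : Fin 3) : c (i + 1) (i + 2) i = -2 * γ i 1 := by
    have h1 := c1 (i + 1) i
    rw [add_one_add_one, add_one_add_two] at h1
    rw [h1, b0]
  refine ⟨⟨fun i => γ i 0, F, ξ, c, hc, ?_, fun i => ?_⟩, rfl, fun i a => ?_⟩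
  · exact halg.symm
  · simp only [cij, cik, hξ]
    linear_combination -hcon i
  · fin_cases a
    · rfl
    · change γ i 1 = (-1 / 2 : ℝ) • c (i + 1) (i + 2) i
      rw [cjk, neg_mul, smul_neg, ← neg_smul, two_mul, ← two_smul ℝ, smul_smul]
      norm_num
    · exact (hξ i).symm
    · change γ i 3 = -c (i + 2) i (i + 2) - (F.D i).der ξ
      rw [cki, hξ]
      ring
    · change γ i 4 = -c i (i + 1) (i + 1) + (F.D i).der ξ
      rw [cij, hξ]
      ring

include φ in
theorem normalElement_mem_iff (F : Frame S) (γ : Fin 3 → Fin 5 → CM S) :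
    normalElement F γ ∈ MCFree (CM S) ∩ affineGauge (D0 S) ↔
      ∃ T : MCPre S, T.frame = F ∧ ∀ i a, γ i a = pull (T.g i a) := by
  have hcm := comoving_of_frame φ F γ
  constructor
  -- Only the vanishing of [x,x] carries information; degree, filtration and gauge conditions hold
  -- for all parameters.
  · rintro ⟨⟨-, -, h⟩, -⟩
    rw [normalElement_eq_gaugeElement] at h
    have hr := reducedEquations_of_MC hcm h
    have hγ : γ = fun i a => pull (restr 0 (γ i a)) :=
      funext fun i => funext fun a => eq_pull_of_D0_eq_zero (hr.const i a)
    obtain ⟨T, hT, hg⟩ := exists_MCPre φ F (fun i a => restr 0 (γ i a)) (by rw [← hγ]; exact hr)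
    refine ⟨T, hT, fun i a => ?_⟩
    rw [← hg]
    exact eq_pull_of_D0_eq_zero (hr.const i a)
  · rintro ⟨T, rfl, hg⟩
    obtain rfl : γ = fun i a => pull (T.g i a) := funext fun i => funext fun a => hg i a
    refine ⟨?_, overparam_mem_affineGauge _ _ _ _ _⟩
    rw [normalElement_eq_gaugeElement]
    exact gaugeElement_mem_MCFree hcm (T.reducedEquations φ) (T.jacobiEquation φ)

end MainTheorem
end BKL
end

theorem mainTheorem4 {S : Type*} [TopologicalSpace S]
    [ChartedSpace (EuclideanSpace ℝ (Fin 3)) S] [IsManifold (𝓡 3) ∞ S]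
    (hS : Nonempty (S ≃ₘ⟮𝓡 3, 𝓡 3⟯ EuclideanSpace ℝ (Fin 3))) :
    (∀ (F : BKL.Frame S) (γ : Fin 3 → Fin 5 → BKL.CM S),
      BKL.normalElement F γ ∈ BKL.MCFree (BKL.CM S) ∩ BKL.affineGauge (BKL.D0 S) ↔
        ∃ T : BKL.MCPre S, T.frame = F ∧ ∀ i a, γ i a = BKL.pull (T.g i a)) ∧
    BKL.MCFree (BKL.CM S) ∩ BKL.affineGauge (BKL.D0 S) ∩
        {x | ∃ (F : BKL.Frame S) (γ : Fin 3 → Fin 5 → BKL.CM S), x = BKL.normalElement F γ} =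
      {x | ∃ T : BKL.MCPre S,
        x = BKL.normalElement T.frame fun i a => BKL.pull (T.g i a)} := by
  obtain ⟨φ⟩ := hS
  refine ⟨BKL.normalElement_mem_iff φ, Set.ext fun x => ⟨?_, ?_⟩⟩
  · rintro ⟨h, F, γ, rfl⟩
    obtain ⟨T, rfl, hT⟩ := (BKL.normalElement_mem_iff φ F γ).1 h
    obtain rfl : γ = fun i a => BKL.pull (T.g i a) := funext fun i => funext fun a => hT i a
    exact ⟨T, rfl⟩
  · rintro ⟨T, rfl⟩
    exact ⟨(BKL.normalElement_mem_iff φ _ _).2 ⟨T, rfl, fun _ _ => rfl⟩, _, _, rfl⟩
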